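/- Work over $\mathbb C$. Let $V=\{z\in\mathbb C^6 : z_1+\dots+z_6=0\}$ be the standard representation of $\mathfrak S_6$ (permutation of the coordinates), $\mathbb P^4=\mathbb P(V)$, and let $W=H^0(\mathbb P^4,\mathcal O(2))$ be the space of quadratic forms on $V$ with the induced action of $\mathfrak S_6$, so that $|\mathcal O_{\mathbb P^4}(2)|=\mathbb P(W)\cong\mathbb P^{14}$. For a finite group $G$ acting linearly on a finite-dimensional vector space $U$, $\mathbb P(U)$ denotes the space of lines in $U$ and $\mathbb P(U)/\!/G=\mathrm{Proj}\big(\mathbb C[U]^G\big)$ its GIT quotient. An Igusa pencil is a pencil of quartics $\lambda a^2+\mu b=0$ in $\mathbb P^4$, where $b=\sum z_i^4-\frac14\big(\sum z_i^2\big)^2$ is the equation of the Igusa quartic and $a\neq0$ is a quadratic form. Igusa pencils are parametrized by the quadrics $\{a=0\}$, and their moduli space is the GIT quotient $\mathcal P^I=|\mathcal O_{\mathbb P^4}(2)|/\!/\mathfrak S_6$. Theorem. (1) $\mathcal P^I$ is rational, i.e. birational over $\mathbb C$ to $\mathbb A^{14}$. (2) The Segre cubic $\{\sum z_i^3=0\}\subset\mathbb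 P^4$ has exactly $10$ singular points, and they are nodes. The quadratic forms vanishing at these points form an $\mathfrak S_6$-subrepresentation $I\subset W$ isomorphic to the standard representation $V$. (3) $\mathbb P(I)/\!/\mathfrak S_6$ is isomorphic over $\mathbb C$ to the weighted projective space $\mathbb P(2,3,4,5,6)$. (4) $I$ has an $\mathfrak S_6$-invariant complement in $W$. For every such complement $J$, let $\mathbb P(W)'$ be the blow-up of $\mathbb P(W)$ along $\mathbb P(J)$. The projection $\mathbb P(W)\dashrightarrow\mathbb P(I)$ from $\mathbb P(J)$ induces a morphism $\overline p:\mathbb P(W)'/\!/\mathfrak S_6\to\mathbb P(I)/\!/\mathfrak S_6$ (the first quotient being the GIT quotient for the line bundle $\mathcal O(2H-E)$, with $H$ the pullback of a hyperplane and $E$ the exceptional divisor), and there is a non-empty open subset $U$ of $\mathbb P(I)/\!/\mathfrak S_6$ over which $\overline p$ is a projective bundle with fibre $\mathbb P^{10}$, i.e. Zariski locally on $U$ it is isomorphic over $U$ to $\mathbb P^{10}\times U$. -/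

import Mathlib

open AlgebraicGeometry CategoryTheory CategoryTheory.Limits Polynomial

noncomputable section

namespace IgusaPencils

/-! ### The graded ring `⨁ 𝒮 n` attached to a multiplicative family of subspaces, and `Proj` -/

section GradedRings

variable {A : Type} [CommRing A] [Algebra ℂ A]

/-- For subspaces `𝒮 n ⊆ A` with `1 ∈ 𝒮 0` and `𝒮 m * 𝒮 n ⊆ 𝒮 (m + n)`, the graded ring
`⨁ n, 𝒮 n`, realised as the ring of polynomials `∑ F n * X ^ n` with `F n ∈ 𝒮 n`
(for the powers of an ideal this is the Rees algebra). -/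
def sectionRing (𝒮 : ℕ → Submodule ℂ A) [SetLike.GradedMonoid 𝒮] : Subalgebra ℂ A[X] where
  carrier := {p | ∀ n, p.coeff n ∈ 𝒮 n}
  mul_mem' hf hg n := by
    rw [coeff_mul]
    refine Submodule.sum_mem _ ?_
    rintro ⟨j, k⟩ e
    rw [← Finset.HasAntidiagonal.mem_antidiagonal.mp e]
    exact SetLike.mul_mem_graded (hf j) (hg k)
  add_mem' hf hg n := by
    rw [coeff_add]
    exact Submodule.add_mem _ (hf n) (hg n)
  algebraMap_mem' r n := by
    rw [Polynomial.algebraMap_apply, coeff_C]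
    split_ifs with h
    · subst h
      exact SetLike.algebraMap_mem_graded 𝒮 r
    · exact Submodule.zero_mem _

variable (𝒮 : ℕ → Submodule ℂ A) [SetLike.GradedMonoid 𝒮]

/-- The element of degree `n` of `⨁ n, 𝒮 n` given by `F ∈ 𝒮 n`. -/
def homElem {n : ℕ} (F : A) (hF : F ∈ 𝒮 n) : sectionRing 𝒮 :=
  ⟨monomial n F, fun m => by
    rw [coeff_monomial]
    split_ifs with h
    · exact h ▸ hF
    · exact Submodule.zero_mem _⟩

/-- The summand of degree `n` of `⨁ n, 𝒮 n`. -/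
def sectionGrading (n : ℕ) : Submodule ℂ (sectionRing 𝒮) where
  carrier := {p | ∀ m, m ≠ n → (p : A[X]).coeff m = 0}
  add_mem' hp hq m hm := by simp [hp m hm, hq m hm]
  zero_mem' m _ := by simp
  smul_mem' c p hp m hm := by simp [hp m hm]

lemma homElem_mem {n : ℕ} (F : A) (hF : F ∈ 𝒮 n) : homElem 𝒮 F hF ∈ sectionGrading 𝒮 n := by
  intro m hm
  simp only [homElem]
  rw [coeff_monomial, if_neg hm.symm]

lemma homElem_coeff {n : ℕ} {p : sectionRing 𝒮} (hp : p ∈ sectionGrading 𝒮 n) :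
    homElem 𝒮 ((p : A[X]).coeff n) (p.2 n) = p := by
  apply Subtype.ext
  ext m
  simp only [homElem]
  rw [coeff_monomial]
  split_ifs with h
  · rw [h]
  · exact (hp m (Ne.symm h)).symm

instance sectionGrading_gradedMonoid : SetLike.GradedMonoid (sectionGrading 𝒮) where
  one_mem m hm := by
    simp [coeff_one, hm]
  mul_mem i j p q hp hq m hm := by
    change ((p : A[X]) * (q : A[X])).coeff m = 0
    rw [coeff_mul]
    refine Finset.sum_eq_zero ?_
    rintro ⟨a, b⟩ e
    have e' := Finset.HasAntidiagonal.mem_antidiagonal.mp e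
    by_cases ha : a = i
    · have hb : b ≠ j := by
        rintro rfl
        exact hm (by rw [← e', ha])
      rw [hq b hb, mul_zero]
    · rw [hp a ha, zero_mul]

instance sectionGrading_gradedAlgebra : GradedAlgebra (sectionGrading 𝒮) where
  decompose' p := ∑ n ∈ (p : A[X]).support,
    DirectSum.of (fun n => sectionGrading 𝒮 n) n
      ⟨homElem 𝒮 ((p : A[X]).coeff n) (p.2 n), homElem_mem 𝒮 _ _⟩
  left_inv p := by
    rw [map_sum]
    simp only [DirectSum.coeAddMonoidHom_of]
    apply Subtype.ext
    rw [AddSubmonoidClass.coe_finsetSum]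
    simp only [homElem]
    exact ((p : A[X]).as_sum_support).symm
  right_inv x := by
    classical
    apply DFinsupp.ext
    intro n
    apply Subtype.ext
    have key : ∀ (y : sectionRing 𝒮) (k : ℕ),
        (((∑ n ∈ (y : A[X]).support, DirectSum.of (fun n => sectionGrading 𝒮 n) n
          ⟨homElem 𝒮 ((y : A[X]).coeff n) (y.2 n), homElem_mem 𝒮 _ _⟩) k :
            sectionGrading 𝒮 k) : sectionRing 𝒮) =
          homElem 𝒮 ((y : A[X]).coeff k) (y.2 k) := by
      intro y k
      rw [DFinsupp.finsetSum_apply, AddSubmonoidClass.coe_finsetSum]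
      by_cases hk : k ∈ (y : A[X]).support
      · rw [Finset.sum_eq_single k]
        · exact congrArg Subtype.val (DirectSum.of_eq_same (β := fun n => sectionGrading 𝒮 n) k _)
        · intro b _ hb
          exact congrArg Subtype.val
            (DirectSum.of_eq_of_ne (β := fun n => sectionGrading 𝒮 n) b k _ hb.symm)
        · exact fun h => absurd hk h
      · rw [Finset.sum_eq_zero]
        · apply Subtype.ext
          simp [homElem, notMem_support_iff.mp hk]
        · intro b hb
          have hbk : k ≠ b := fun h => hk (h ▸ hb)
          exact congrArg Subtype.val
            (DirectSum.of_eq_of_ne (β := fun n => sectionGrading 𝒮 n) b k _ hbk)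
    rw [key]
    induction x using DirectSum.induction_on with
    | zero =>
      apply Subtype.ext
      simp [homElem]
    | of i z =>
      rw [DirectSum.coeAddMonoidHom_of]
      by_cases h : n = i
      · subst h
        rw [homElem_coeff 𝒮 z.2]
        exact (congrArg Subtype.val
          (DirectSum.of_eq_same (β := fun n => sectionGrading 𝒮 n) n z)).symm
      · have h0 : (((DirectSum.of (fun n => sectionGrading 𝒮 n) i z) n :
            sectionGrading 𝒮 n) : sectionRing 𝒮) = 0 :=
          congrArg Subtype.val
            (DirectSum.of_eq_of_ne (β := fun n => sectionGrading 𝒮 n) i n z h)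
        rw [h0]
        apply Subtype.ext
        simp [homElem, z.2 n h]
    | add x y hx hy =>
      rw [DirectSum.add_apply, Submodule.coe_add, ← hx, ← hy]
      apply Subtype.ext
      simp [homElem]

/-- The structure morphism `Proj 𝒜 ⟶ Spec ℂ` of a graded `ℂ`-algebra. -/
def projStr {R : Type} [CommRing R] [Algebra ℂ R] (𝒜 : ℕ → Submodule ℂ R) [GradedAlgebra 𝒜] :
    Proj 𝒜 ⟶ Spec (.of ℂ) :=
  Proj.toSpecZero 𝒜 ≫ Spec.map (CommRingCat.ofHom (algebraMap ℂ (𝒜 0)))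

end GradedRings

/-! ### Projective spaces and projective bundles -/

section ProjectiveSpaces

attribute [local instance] MvPolynomial.weightedGradedAlgebra MvPolynomial.gradedAlgebra

/-- The complex weighted projective space with weights `w`. -/
def weightedProj {n : ℕ} (w : Fin n → ℕ) : Scheme :=
  Proj (MvPolynomial.weightedHomogeneousSubmodule ℂ w)

def weightedProjStr {n : ℕ} (w : Fin n → ℕ) : weightedProj w ⟶ Spec (.of ℂ) :=
  projStr (MvPolynomial.weightedHomogeneousSubmodule ℂ w)

/-- The complex projective space `ℙⁿ`. -/
def projSpace (n : ℕ) : Scheme :=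
  Proj (MvPolynomial.homogeneousSubmodule (Fin (n + 1)) ℂ)

def projSpaceStr (n : ℕ) : projSpace n ⟶ Spec (.of ℂ) :=
  projStr (MvPolynomial.homogeneousSubmodule (Fin (n + 1)) ℂ)

/-- `p : X ⟶ U`, with `U` over `Spec ℂ` via `s`, is a projective bundle with fibre `ℙⁿ`: locally
on `U` for the Zariski topology it is isomorphic over `U` to the product `ℙⁿ × U`. -/
def IsProjectiveBundle (n : ℕ) {X U : Scheme} (s : U ⟶ Spec (.of ℂ)) (p : X ⟶ U) : Prop :=
  ∀ x : U, ∃ V : U.Opens, x ∈ V ∧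
    ∃ e : (p ⁻¹ᵁ V).toScheme ≅ pullback (projSpaceStr n) (V.ι ≫ s),
      e.hom ≫ pullback.snd (projSpaceStr n) (V.ι ≫ s) = p ∣_ V

end ProjectiveSpaces

/-! ### Polynomial functions on a representation and GIT quotients -/

section Quotients

variable {G : Type} [Group G] {W : Type} [AddCommGroup W] [Module ℂ W]

/-- The linear forms on `W` that vanish on the subspace `J`, as functions on `W`. -/
def linearForms (J : Submodule ℂ W) : Submodule ℂ (W → ℂ) :=
  J.dualAnnihilator.map (LinearMap.ltoFun ℂ W ℂ ℂ)

lemma comp_mem_linearForms_pow {W' : Type} [AddCommGroup W'] [Module ℂ W'] (π : W →ₗ[ℂ] W')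
    {J : Submodule ℂ W} {J' : Submodule ℂ W'} (hJ : J ≤ J'.comap π) {n : ℕ} {F : W' → ℂ}
    (hF : F ∈ linearForms J' ^ n) : (fun w => F (π w)) ∈ linearForms J ^ n := by
  let Φ : (W' → ℂ) →ₐ[ℂ] (W → ℂ) :=
    { toFun := fun f w => f (π w)
      map_one' := rfl
      map_mul' := fun _ _ => rfl
      map_zero' := rfl
      map_add' := fun _ _ => rfl
      commutes' := fun _ => rfl }
  have h1 : Submodule.map Φ.toLinearMap (linearForms J') ≤ linearForms J := by
    rintro _ ⟨_, ⟨l, hl, rfl⟩, rfl⟩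
    refine ⟨l.comp π, ?_, rfl⟩
    rw [SetLike.mem_coe, Submodule.mem_dualAnnihilator] at hl ⊢
    intro w hw
    exact hl (π w) (hJ hw)
  have h2 : Φ F ∈ Submodule.map Φ.toLinearMap (linearForms J' ^ n) := ⟨F, hF, rfl⟩
  rw [Submodule.map_pow] at h2
  exact pow_le_pow_left' h1 n h2

variable (W) in
/-- The homogeneous polynomial functions of degree `n` on `W`: the span of the products of `n`
linear forms. -/
def homogeneousFunctions (n : ℕ) : Submodule ℂ (W → ℂ) :=
  linearForms (⊥ : Submodule ℂ W) ^ n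

/-- The functions on `W` that are invariant under `G`. -/
def invariantFunctions (ρ : Representation ℂ G W) : Subalgebra ℂ (W → ℂ) where
  carrier := {F | ∀ g v, F (ρ g v) = F v}
  mul_mem' hF hH g v := by simp [hF g v, hH g v]
  add_mem' hF hH g v := by simp [hF g v, hH g v]
  algebraMap_mem' r g v := rfl

/-- The `G`-invariant homogeneous polynomial functions of degree `n` on `W`. -/
def invariantForms (ρ : Representation ℂ G W) (n : ℕ) : Submodule ℂ (W → ℂ) :=
  homogeneousFunctions W n ⊓ Subalgebra.toSubmodule (invariantFunctions ρ)

instance invariantForms_gradedMonoid (ρ : Representation ℂ G W) :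
    SetLike.GradedMonoid (invariantForms ρ) where
  one_mem := ⟨by
    rw [homogeneousFunctions, pow_zero]
    exact Submodule.one_le.mp le_rfl, one_mem (invariantFunctions ρ)⟩
  mul_mem i j x y hx hy := ⟨by
    have := Submodule.mul_mem_mul hx.1 hy.1
    rwa [homogeneousFunctions, homogeneousFunctions, ← pow_add] at this,
    mul_mem (S := Subalgebra ℂ (W → ℂ)) hx.2 hy.2⟩

/-- The GIT quotient `ℙ(W) // G` of the projective space of lines in `W` by the finite group `G`,
i.e. `Proj` of the ring of `G`-invariant polynomial functions on `W`. -/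
def gitQuotient (ρ : Representation ℂ G W) : Scheme :=
  Proj (sectionGrading (invariantForms ρ))

def gitQuotientStr (ρ : Representation ℂ G W) : gitQuotient ρ ⟶ Spec (.of ℂ) :=
  projStr (sectionGrading (invariantForms ρ))

/-! ### The blow-up of `ℙ(W)` along `ℙ(J)` and the linear projection from `ℙ(J)` -/

/-- Let `𝔞` be the ideal of `ℙ(J)` in the homogeneous coordinate ring of `ℙ(W)`; it is generated by
the linear forms vanishing on `J`. The `G`-invariants of the degree `2 n` part of `𝔞 ^ n`, which is
spanned by the products of `n` linear forms vanishing on `J` and of `n` arbitrary linear forms.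
These are the invariant sections of the `n`-th power of the ample line bundle
`𝒪(2 H - E) = 𝒪(H) ⊗ 𝒪(H - E)` on the blow-up of `ℙ(W)` along `ℙ(J)`, where `H` is the pullback
of a hyperplane and `E` the exceptional divisor. -/
def blowupForms {ρ : Representation ℂ G W} (J : Subrepresentation ρ) (n : ℕ) :
    Submodule ℂ (W → ℂ) :=
  linearForms J.toSubmodule ^ n * homogeneousFunctions W n ⊓
    Subalgebra.toSubmodule (invariantFunctions ρ)

instance blowupForms_gradedMonoid {ρ : Representation ℂ G W} (J : Subrepresentation ρ) :
    SetLike.GradedMonoid (blowupForms J) where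
  one_mem := ⟨by
    rw [homogeneousFunctions, pow_zero, pow_zero, one_mul]
    exact Submodule.one_le.mp le_rfl, one_mem (invariantFunctions ρ)⟩
  mul_mem i j x y hx hy := ⟨by
    have := Submodule.mul_mem_mul hx.1 hy.1
    rwa [homogeneousFunctions, homogeneousFunctions, mul_mul_mul_comm, ← pow_add, ← pow_add]
      at this,
    mul_mem (S := Subalgebra ℂ (W → ℂ)) hx.2 hy.2⟩

/-- The GIT quotient by `G` of the blow-up `ℙ(W)' = Proj (⨁ n, (𝔞 ^ n)_{2 n})` of `ℙ(W)` along the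
`G`-stable linear subspace `ℙ(J)`, with respect to `𝒪(2 H - E)`. -/
def blowupQuotient {ρ : Representation ℂ G W} (J : Subrepresentation ρ) : Scheme :=
  Proj (sectionGrading (blowupForms J))

variable {ρ : Representation ℂ G W} (I J : Subrepresentation ρ)

/-- The GIT quotient `ℙ(I) // G` for a subrepresentation `I`. -/
def subQuotient : Scheme := gitQuotient I.toRepresentation

def subQuotientStr : subQuotient I ⟶ Spec (.of ℂ) := gitQuotientStr I.toRepresentation

variable (hIJ : IsCompl I.toSubmodule J.toSubmodule)

/-- The pullback of a function on `I` to `W = I ⊕ J` along the projection onto `I`. -/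
def pullbackFn (f : I.toSubmodule → ℂ) : W → ℂ :=
  fun w => f (I.toSubmodule.projectionOnto J.toSubmodule hIJ w)

lemma pullbackFn_mem_pow {n : ℕ} {f : I.toSubmodule → ℂ}
    (hf : f ∈ homogeneousFunctions I.toSubmodule n) :
    pullbackFn I J hIJ f ∈ linearForms J.toSubmodule ^ n := by
  refine comp_mem_linearForms_pow (I.toSubmodule.projectionOnto J.toSubmodule hIJ) ?_ hf
  intro w hw
  rw [Submodule.mem_comap, Submodule.mem_bot]
  exact (Submodule.projectionOnto_apply_eq_zero_iff hIJ).mpr hw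

lemma pullbackFn_invariant {f : I.toSubmodule → ℂ}
    (hf : f ∈ invariantFunctions I.toRepresentation) :
    pullbackFn I J hIJ f ∈ invariantFunctions ρ := by
  intro g w
  let π := I.toSubmodule.projectionOnto J.toSubmodule hIJ
  have hπ : π (ρ g w) = I.toRepresentation g (π w) := by
    obtain ⟨x, y, rfl⟩ : ∃ (x : I.toSubmodule) (y : J.toSubmodule), (x : W) + y = w := by
      have hw : w ∈ I.toSubmodule ⊔ J.toSubmodule := by
        rw [hIJ.sup_eq_top]
        trivial
      obtain ⟨a, ha, b, hb, hab⟩ := Submodule.mem_sup.mp hw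
      exact ⟨⟨a, ha⟩, ⟨b, hb⟩, hab⟩
    have hx : π (x : W) = x := Submodule.projectionOnto_apply_left hIJ x
    have hy : π (y : W) = 0 := (Submodule.projectionOnto_apply_eq_zero_iff hIJ).mpr y.2
    have hgx : π (ρ g (x : W)) = I.toRepresentation g x :=
      Submodule.projectionOnto_apply_left hIJ (I.toRepresentation g x)
    have hgy : π (ρ g (y : W)) = 0 :=
      (Submodule.projectionOnto_apply_eq_zero_iff hIJ).mpr (J.apply_mem_toSubmodule g y.2)
    rw [map_add, map_add, map_add, hx, hy, hgx, hgy, add_zero, add_zero]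
  change f (π (ρ g w)) = f (π w)
  rw [hπ]
  exact hf g (π w)

lemma pullbackFn_mul_mem {n : ℕ} {f : I.toSubmodule → ℂ} {h : W → ℂ}
    (hf : f ∈ invariantForms I.toRepresentation n) (hh : h ∈ invariantForms ρ n) :
    pullbackFn I J hIJ f * h ∈ blowupForms J n :=
  ⟨Submodule.mul_mem_mul (pullbackFn_mem_pow I J hIJ hf.1) hh.1,
    mul_mem (S := Subalgebra ℂ (W → ℂ)) (pullbackFn_invariant I J hIJ hf.2) hh.2⟩

lemma pow_mem_invariantForms {d : ℕ} {h : W → ℂ} (hh : h ∈ invariantForms ρ d) (k : ℕ) :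
    h ^ k ∈ invariantForms ρ (k • d) :=
  SetLike.pow_mem_graded k hh

/-- The morphism `p : ℙ(W)' // G ⟶ ℙ(I) // G` is the one induced by the projection
`ℙ(W) ⇢ ℙ(I)` from `ℙ(J)`. Let `f` and `h` be invariant forms of the same degree on `I` and `W`.
On the open set where `f h ≠ 0` the morphism `p` takes its values in the open set where `f ≠ 0`,
and it pulls the function `a / f ^ k` back to `a / f ^ k = (a h ^ k) / (f h) ^ k`. -/
def IsInducedByProjection (p : blowupQuotient J ⟶ subQuotient I) : Prop :=
  ∀ (d : ℕ) (hd : 0 < d) (f : I.toSubmodule → ℂ) (hf : f ∈ invariantForms I.toRepresentation d)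
    (h : W → ℂ) (hh : h ∈ invariantForms ρ d),
  ∃ θ : HomogeneousLocalization.Away (sectionGrading (invariantForms I.toRepresentation))
          (homElem (invariantForms I.toRepresentation) f hf) →+*
        HomogeneousLocalization.Away (sectionGrading (blowupForms J))
          (homElem (blowupForms J) (pullbackFn I J hIJ f * h) (pullbackFn_mul_mem I J hIJ hf hh)),
    (∀ (k : ℕ) (a : I.toSubmodule → ℂ) (ha : a ∈ invariantForms I.toRepresentation (k • d)),
      θ (HomogeneousLocalization.Away.mk _ (homElem_mem _ f hf) k
          (homElem _ a ha) (homElem_mem _ a ha)) =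
        HomogeneousLocalization.Away.mk _
          (homElem_mem _ _ (pullbackFn_mul_mem I J hIJ hf hh)) k
          (homElem (blowupForms J) (pullbackFn I J hIJ a * h ^ k)
            (pullbackFn_mul_mem I J hIJ ha (pow_mem_invariantForms hh k)))
          (homElem_mem _ _ _)) ∧
    Proj.awayι (sectionGrading (blowupForms J)) _
        (homElem_mem _ _ (pullbackFn_mul_mem I J hIJ hf hh)) hd ≫ p =
      Spec.map (CommRingCat.ofHom θ) ≫
        Proj.awayι (sectionGrading (invariantForms I.toRepresentation)) _
          (homElem_mem _ f hf) hd

end Quotients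

/-! ### The representation of `𝔖₆` on quadrics and the Segre cubic -/

/-- The hyperplane `z₁ + ⋯ + z₆ = 0` in `ℂ⁶`; its projectivization is the `ℙ⁴` of the Igusa quartic
and of the Segre cubic. -/
def hyperplane : Submodule ℂ (Fin 6 → ℂ) where
  carrier := {z | ∑ i, z i = 0}
  add_mem' {x y} hx hy := by
    simp only [Set.mem_ofPred_eq] at hx hy ⊢
    simp [Finset.sum_add_distrib, hx, hy]
  zero_mem' := by simp
  smul_mem' c x hx := by
    simp only [Set.mem_ofPred_eq] at hx ⊢
    simp [← Finset.mul_sum, hx]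

/-- The standard representation of `𝔖₆`: permutation of the coordinates on the hyperplane. -/
def stdRep : Representation ℂ (Equiv.Perm (Fin 6)) hyperplane where
  toFun σ :=
    { toFun := fun z => ⟨fun i => (z : Fin 6 → ℂ) (σ⁻¹ i),
        (Equiv.sum_comp σ⁻¹ (z : Fin 6 → ℂ)).trans z.2⟩
      map_add' := fun _ _ => rfl
      map_smul' := fun _ _ => rfl }
  map_one' := rfl
  map_mul' σ τ := by
    ext z i
    simp [mul_inv_rev]

/-- The space `H⁰(ℙ⁴, 𝒪(2))` of quadratic forms on the hyperplane. The lines in this space are the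
points of `|𝒪_{ℙ⁴}(2)|`. -/
abbrev quadrics : Submodule ℂ (hyperplane → ℂ) := homogeneousFunctions hyperplane 2

/-- The representation of `𝔖₆` on `H⁰(ℙ⁴, 𝒪(2))`: `(σ Q)(z) = Q(σ⁻¹ z)`. -/
def quadricRep : Representation ℂ (Equiv.Perm (Fin 6)) quadrics where
  toFun σ :=
    { toFun := fun Q => ⟨fun z => (Q : hyperplane → ℂ) (stdRep σ⁻¹ z),
        comp_mem_linearForms_pow (stdRep σ⁻¹) bot_le Q.2⟩
      map_add' := fun _ _ => rfl
      map_smul' := fun _ _ => rfl }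
  map_one' := rfl
  map_mul' σ τ := by
    ext Q z
    change (Q : hyperplane → ℂ) (stdRep (σ * τ)⁻¹ z) =
      (Q : hyperplane → ℂ) (stdRep τ⁻¹ (stdRep σ⁻¹ z))
    rw [mul_inv_rev, map_mul]
    rfl

/-- The moduli space of Igusa pencils, `|𝒪_{ℙ⁴}(2)| // 𝔖₆`. -/
def moduliIgusaPencils : Scheme := gitQuotient quadricRep

def moduliIgusaPencilsStr : moduliIgusaPencils ⟶ Spec (.of ℂ) := gitQuotientStr quadricRep

/-- The cubic form `z₁³ + ⋯ + z₆³` on the hyperplane, defining the Segre cubic. -/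
def segreCubic (z : hyperplane) : ℂ := ∑ i, (z : Fin 6 → ℂ) i ^ 3

/-- The set of singular points of the Segre cubic in `ℙ⁴`. -/
def segreSing : Set (Projectivization ℂ hyperplane) :=
  {x | segreCubic x.rep = 0 ∧ fderiv ℂ segreCubic x.rep = 0}

end IgusaPencils

end

noncomputable section

namespace IgusaPencils

/-! ### Degree-zero fractions as functions -/

section FractionFunctions

variable {X : Type} (𝒮 : ℕ → Submodule ℂ (X → ℂ)) [SetLike.GradedMonoid 𝒮]

/-! The core is the no-name lemma, made explicit over a basic affine open set of `ℙ(I) // G`. Write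
`W = I ⊕ J` with projection `π` to `I`. The group acts generically freely on `ℙ(I)`, so by descent
the linear coordinates along `J` can be replaced by invariant functions. Concretely
(`exists_frame`), let `T` be the matrices of the action on `J`, and let `c` be a form on `I` with
value `1` at a vector `v₀` and `0` at its other translates. The average `A(v) = ∑ c(g v) T(g)`
satisfies `A(g v) T(g) = A(v)` and `A(v₀) = 1`. Hence `φ(w) = A(π w) · (J-coordinates of w)` is
invariant, and Cramer's rule recovers the coordinates from `φ` wherever the invariant `D`, a power
of `det A`, does not vanish. For the standard representation there are invariants `f₁`, `f₂` of
degrees 3 and 2; their quotient `t` has degree one and serves to shift degrees. Put `f = f₁ f₂ D`.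

Bundle: over `{f ≠ 0}` the invariant sections of `𝒪(nH)` are the forms of degree `n` in `t` and `yᵢ
= φᵢ / t ^ δ`, with invariant coefficients of degree zero (`Frame.invFracForms_eq`). The `Proj` of
the ring of these sections is therefore the product of `ℙ¹⁰` with `{f ≠ 0}`
(`Frame.isPullback_toProjSpace`). It is also the preimage of `{f ≠ 0}` in the quotient of the
blow-up (`Frame.isPullback_toBlowup`).

Rationality: divide the fundamental invariants of `I` and the `φᵢ` by powers of `t`. As `t = E₁ /
E₀`, two of the five quotients from `I` coincide, and `4 + 10` functions remain. The coordinate ring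
of `{f ≠ 0}` in `ℙ(W) // G` is a localization of the polynomial ring in these
(`Frame.birationalOver_affineSpace`).

The concrete input is elementary. Lagrange multipliers show that the singular points of the Segre
cubic are those with all `zᵢ²` equal. The quadrics through them are the forms `∑ aᵢ zᵢ²` with `∑ aᵢ
= 0`. The invariants of the standard representation are the polynomials in the elementary symmetric
functions of degrees 2 to 6, which gives `ℙ(2,3,4,5,6)`.

All graded rings of sections consist of functions, and degree-zero fractions are determined by their
values (`evalFrac_injective`). Identities between morphisms of the quotients thus reduce to
pointwise identities. That the basic open sets in use form covers rests on the integrality of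
functions over invariants (`exists_pow_le_mul`). -/

lemma homElem_congr {m n : ℕ} {F H : X → ℂ} (hmn : m = n) (h : F = H) (hF : F ∈ 𝒮 m)
    (hH : H ∈ 𝒮 n) : homElem 𝒮 F hF = homElem 𝒮 H hH := by
  subst hmn h
  rfl

lemma homElem_mul {m n : ℕ} {F H : X → ℂ} (hF : F ∈ 𝒮 m) (hH : H ∈ 𝒮 n) :
    homElem 𝒮 (F * H) (SetLike.mul_mem_graded hF hH) = homElem 𝒮 F hF * homElem 𝒮 H hH :=
  Subtype.ext (monomial_mul_monomial m n F H).symm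

lemma homElem_pow {m : ℕ} {F : X → ℂ} (hF : F ∈ 𝒮 m) (k : ℕ) :
    homElem 𝒮 (F ^ k) (SetLike.pow_mem_graded k hF) = homElem 𝒮 F hF ^ k := by
  apply Subtype.ext
  change monomial (k • m) (F ^ k) = monomial m F ^ k
  rw [monomial_pow, smul_eq_mul, mul_comm]

/-- Evaluation of the sum of the homogeneous parts. -/
def evalSection : sectionRing 𝒮 →+* (X → ℂ) :=
  (Polynomial.evalRingHom 1).comp (sectionRing 𝒮).val.toRingHom

@[simp]
lemma evalSection_homElem {n : ℕ} {F : X → ℂ} (hF : F ∈ 𝒮 n) :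
    evalSection 𝒮 (homElem 𝒮 F hF) = F := by
  simp [evalSection, homElem]

/-- The degree zero part of the localization at a homogeneous element. -/
abbrev FracRing {d : ℕ} (f : X → ℂ) (hf : f ∈ 𝒮 d) : Type :=
  HomogeneousLocalization.Away (sectionGrading 𝒮) (homElem 𝒮 f hf)

variable {𝒮} {d : ℕ} {f : X → ℂ} (hf : f ∈ 𝒮 d)

/-- The fraction `a / f ^ k`. -/
def frac (k : ℕ) (a : X → ℂ) (ha : a ∈ 𝒮 (k • d)) : FracRing 𝒮 f hf :=
  HomogeneousLocalization.Away.mk _ (homElem_mem 𝒮 f hf) k (homElem 𝒮 a ha) (homElem_mem 𝒮 a ha)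

lemma exists_frac (z : FracRing 𝒮 f hf) : ∃ k a ha, z = frac hf k a ha := by
  obtain ⟨k, a, ha, rfl⟩ :=
    HomogeneousLocalization.Away.mk_surjective _ (homElem_mem 𝒮 f hf) z
  refine ⟨k, _, a.2 (k • d), ?_⟩
  simp only [frac, homElem_coeff 𝒮 ha]

/-- Evaluation of fractions with denominator a power of `f` on `{f ≠ 0}`. -/
def evalLocalization : Localization.Away (homElem 𝒮 f hf) →+* ({x // f x ≠ 0} → ℂ) :=
  IsLocalization.Away.lift (homElem 𝒮 f hf)
    (g := (RingHom.pi fun x : {x // f x ≠ 0} => Pi.evalRingHom (fun _ : X => ℂ) x.1).comp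
      (evalSection 𝒮)) (by
      simp only [RingHom.comp_apply, evalSection_homElem]
      exact Pi.isUnit_iff.mpr fun x => isUnit_iff_ne_zero.mpr x.2)

lemma evalLocalization_mk (k : ℕ) (p : sectionRing 𝒮) (b : Submonoid.powers (homElem 𝒮 f hf))
    (hb : (b : sectionRing 𝒮) = homElem 𝒮 f hf ^ k) (x : {x // f x ≠ 0}) :
    evalLocalization hf (Localization.mk p b) x = evalSection 𝒮 p x / f x ^ k := by
  have h := congrFun (congrArg (evalLocalization hf)
    (IsLocalization.mk'_spec (Localization.Away (homElem 𝒮 f hf)) p b)) x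
  rw [eq_div_iff (pow_ne_zero _ x.2), Localization.mk_eq_mk']
  rw [map_mul, evalLocalization, IsLocalization.Away.lift_eq, IsLocalization.Away.lift_eq, hb,
    map_pow, RingHom.comp_apply, evalSection_homElem] at h
  exact h

/-- Elements of the degree zero part of the localization at `f` as functions on `{f ≠ 0}`. -/
def evalFrac : FracRing 𝒮 f hf →+* ({x // f x ≠ 0} → ℂ) :=
  (evalLocalization hf).comp (algebraMap _ _)

@[simp]
lemma evalFrac_frac (k : ℕ) (a : X → ℂ) (ha : a ∈ 𝒮 (k • d)) (x : {x // f x ≠ 0}) :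
    evalFrac hf (frac hf k a ha) x = a x / f x ^ k := by
  change evalLocalization hf (Localization.mk _ _) x = _
  rw [evalLocalization_mk hf k _ _ rfl, evalSection_homElem]

/-- If `a / f ^ k` vanishes wherever `f ≠ 0`, then `a * f` is the zero function, so `a` dies in the
localization. Ring homomorphisms between degree-zero localizations can therefore be compared
pointwise. -/
lemma evalFrac_injective : Function.Injective (evalFrac hf) := by
  rw [injective_iff_map_eq_zero]
  intro z hz
  obtain ⟨k, a, ha, rfl⟩ := exists_frac hf z
  have h0 : a * f = 0 := by
    funext x
    by_cases hx : f x = 0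
    · simp [hx]
    · have h := congrFun hz ⟨x, hx⟩
      rw [evalFrac_frac] at h
      have := (div_eq_zero_iff.mp h).resolve_right (pow_ne_zero _ hx)
      simp only at this
      simp [this]
  have h1 : homElem 𝒮 a ha * homElem 𝒮 f hf = 0 := by
    rw [← homElem_mul]
    apply Subtype.ext
    simp [homElem, h0]
  apply HomogeneousLocalization.val_injective
  rw [HomogeneousLocalization.val_zero, frac, HomogeneousLocalization.Away.val_mk,
    Localization.mk_eq_mk', IsLocalization.mk'_eq_zero_iff]
  exact ⟨⟨_, 1, rfl⟩, by simpa [mul_comm] using h1⟩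

lemma evalFrac_ext {z z' : FracRing 𝒮 f hf} (h : ∀ x, evalFrac hf z x = evalFrac hf z' x) :
    z = z' := evalFrac_injective hf (funext h)

lemma evalFrac_awayMap {e n : ℕ} {g h : X → ℂ} (hg : g ∈ 𝒮 e) (hh : h ∈ 𝒮 n)
    (hx : homElem 𝒮 h hh = homElem 𝒮 f hf * homElem 𝒮 g hg)
    (z : FracRing 𝒮 f hf) (x : {x // h x ≠ 0}) (hfx : f x.1 ≠ 0) :
    evalFrac hh (HomogeneousLocalization.awayMap (sectionGrading 𝒮) (homElem_mem 𝒮 g hg) hx z) x =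
      evalFrac hf z ⟨x.1, hfx⟩ := by
  obtain ⟨k, a, ha, rfl⟩ := exists_frac hf z
  have hhx : h = f * g := by simpa using congrArg (evalSection 𝒮) hx
  have hgx : g x.1 ≠ 0 := fun h0 => x.2 (by simp [hhx, h0])
  rw [evalFrac_frac, eq_div_iff (pow_ne_zero _ hfx)]
  change evalLocalization hh (HomogeneousLocalization.awayMap (sectionGrading 𝒮) _ hx
    (HomogeneousLocalization.Away.mk _ (homElem_mem 𝒮 f hf) k _ (homElem_mem 𝒮 a ha))).val x * _ = _
  rw [HomogeneousLocalization.awayMap_mk, HomogeneousLocalization.Away.val_mk,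
    evalLocalization_mk hh k _ _ rfl, map_mul, map_pow, evalSection_homElem, evalSection_homElem]
  subst hhx
  simp only [Pi.mul_apply, Pi.pow_apply, mul_pow]
  have := x.2
  field_simp

end FractionFunctions

/-! ### Morphisms of `Proj` induced by maps of sets -/

section InducedMorphisms

variable {X Y : Type} (𝒮 : ℕ → Submodule ℂ (X → ℂ)) [SetLike.GradedMonoid 𝒮]
  (𝒯 : ℕ → Submodule ℂ (Y → ℂ)) [SetLike.GradedMonoid 𝒯] (π : X → Y)

/-- A map `π` pulls fractions with denominator `t` back to fractions with denominator `c`. -/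
structure Compatible {m d : ℕ} (c : X → ℂ) (t : Y → ℂ) (hc : c ∈ 𝒮 m) (ht : t ∈ 𝒯 d) : Prop where
  ne_zero : ∀ x, c x ≠ 0 → t (π x) ≠ 0
  pullback : ∀ k a, a ∈ 𝒯 (k • d) → ∃ l s, s ∈ 𝒮 (l • m) ∧
    ∀ x, c x ≠ 0 → a (π x) / t (π x) ^ k = s x / c x ^ l

variable {𝒮 𝒯 π} {m d : ℕ} {c : X → ℂ} {t : Y → ℂ} {hc : c ∈ 𝒮 m} {ht : t ∈ 𝒯 d}

lemma Compatible.exists_eq (h : Compatible 𝒮 𝒯 π c t hc ht) (z : FracRing 𝒯 t ht) :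
    ∃ z' : FracRing 𝒮 c hc, ∀ x : {x // c x ≠ 0},
      evalFrac hc z' x = evalFrac ht z ⟨π x.1, h.ne_zero x.1 x.2⟩ := by
  obtain ⟨k, a, ha, rfl⟩ := exists_frac ht z
  obtain ⟨l, s, hs, e⟩ := h.pullback k a ha
  exact ⟨frac hc l s hs, fun x => by simp [e x.1 x.2]⟩

/-- The pull-back of fractions. -/
def Compatible.hom (h : Compatible 𝒮 𝒯 π c t hc ht) : FracRing 𝒯 t ht →+* FracRing 𝒮 c hc where
  -- The chosen fraction is unique by `evalFrac_injective`, which is what makes the choice a ring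
  -- homomorphism.
  toFun z := (h.exists_eq z).choose
  map_one' := evalFrac_ext hc fun x => ((h.exists_eq 1).choose_spec x).trans (by simp)
  map_zero' := evalFrac_ext hc fun x => ((h.exists_eq 0).choose_spec x).trans (by simp)
  map_mul' z z' := evalFrac_ext hc fun x => ((h.exists_eq (z * z')).choose_spec x).trans <| by
    rw [map_mul, map_mul, Pi.mul_apply, Pi.mul_apply, (h.exists_eq z).choose_spec x,
      (h.exists_eq z').choose_spec x]
  map_add' z z' := evalFrac_ext hc fun x => ((h.exists_eq (z + z')).choose_spec x).trans <| by
    rw [map_add, map_add, Pi.add_apply, Pi.add_apply, (h.exists_eq z).choose_spec x,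
      (h.exists_eq z').choose_spec x]

lemma Compatible.evalFrac_hom (h : Compatible 𝒮 𝒯 π c t hc ht) (z : FracRing 𝒯 t ht)
    (x : {x // c x ≠ 0}) :
    evalFrac hc (h.hom z) x = evalFrac ht z ⟨π x.1, h.ne_zero x.1 x.2⟩ :=
  (h.exists_eq z).choose_spec x

lemma Compatible.mul {m' d' : ℕ} {c' : X → ℂ} {t' : Y → ℂ} {hc' : c' ∈ 𝒮 m'} {ht' : t' ∈ 𝒯 d'}
    (hd : 0 < d)
    (h : Compatible 𝒮 𝒯 π c t hc ht) (h' : Compatible 𝒮 𝒯 π c' t' hc' ht') :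
    Compatible 𝒮 𝒯 π (c * c') (t * t') (SetLike.mul_mem_graded hc hc')
      (SetLike.mul_mem_graded ht ht') where
  ne_zero x hx := mul_ne_zero (h.ne_zero x (left_ne_zero_of_mul hx))
    (h'.ne_zero x (right_ne_zero_of_mul hx))
  pullback k a ha := by
    obtain ⟨d, rfl⟩ := Nat.exists_eq_add_one_of_ne_zero hd.ne'
    -- With `deg t = d + 1`, the fraction `a / (t t') ^ k` is the product of `a t' ^ (k d) / t ^ (k
    -- d' + k)` and `t ^ (k d') / t' ^ (k (d + 1))`. Both have degree zero and involve a single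
    -- denominator.
    have h1 : a * t' ^ (k * d) ∈ 𝒯 ((k * d' + k) • (d + 1)) := by
      convert! SetLike.mul_mem_graded ha (SetLike.pow_mem_graded (k * d) ht') using 2
      simp only [smul_eq_mul]
      ring
    obtain ⟨l, s, hs, e⟩ := h.pullback _ _ h1
    have h2 : t ^ (k * d') ∈ 𝒯 ((k * (d + 1)) • d') := by
      convert! SetLike.pow_mem_graded (k * d') ht using 2
      simp only [smul_eq_mul]
      ring
    obtain ⟨l', s', hs', e'⟩ := h'.pullback _ _ h2
    refine ⟨l + l', s * c' ^ l * (s' * c ^ l'), ?_, fun x hx => ?_⟩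
    · convert! SetLike.mul_mem_graded
        (SetLike.mul_mem_graded hs (SetLike.pow_mem_graded l hc'))
        (SetLike.mul_mem_graded hs' (SetLike.pow_mem_graded l' hc)) using 2
      simp only [smul_eq_mul]
      ring
    · have hcx := left_ne_zero_of_mul hx
      have hcx' := right_ne_zero_of_mul hx
      have htx := h.ne_zero x hcx
      have htx' := h'.ne_zero x hcx'
      have ex := e x hcx
      have ex' := e' x hcx'
      simp only [Pi.mul_apply, Pi.pow_apply] at ex ex' ⊢
      have : s x * c' x ^ l * (s' x * c x ^ l') / (c x * c' x) ^ (l + l') =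
          s x / c x ^ l * (s' x / c' x ^ l') := by
        rw [mul_pow, pow_add, pow_add]
        field_simp
      rw [this, ← ex, ← ex']
      field_simp
      ring

/-- The pairs of denominators along which `π` pulls fractions back. -/
structure CompatiblePair (𝒮 : ℕ → Submodule ℂ (X → ℂ)) [SetLike.GradedMonoid 𝒮]
    (𝒯 : ℕ → Submodule ℂ (Y → ℂ)) [SetLike.GradedMonoid 𝒯] (π : X → Y) : Type where
  m : ℕ
  d : ℕ
  c : X → ℂ
  t : Y → ℂ
  hm : 0 < m
  hd : 0 < d
  hc : c ∈ 𝒮 m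
  ht : t ∈ 𝒯 d
  compat : Compatible 𝒮 𝒯 π c t hc ht

/-- The open subset of the source given by a compatible pair. -/
def CompatiblePair.ι (i : CompatiblePair 𝒮 𝒯 π) :
    Spec (.of (FracRing 𝒮 i.c i.hc)) ⟶ Proj (sectionGrading 𝒮) :=
  Proj.awayι (sectionGrading 𝒮) _ (homElem_mem 𝒮 i.c i.hc) i.hm

instance (i : CompatiblePair 𝒮 𝒯 π) : IsOpenImmersion i.ι := by
  rw [CompatiblePair.ι]
  infer_instance

/-- The induced morphism on the open subset given by a compatible pair. -/
def CompatiblePair.map (i : CompatiblePair 𝒮 𝒯 π) :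
    Spec (.of (FracRing 𝒮 i.c i.hc)) ⟶ Proj (sectionGrading 𝒯) :=
  Spec.map (CommRingCat.ofHom i.compat.hom) ≫
    Proj.awayι (sectionGrading 𝒯) _ (homElem_mem 𝒯 i.t i.ht) i.hd

/-- The overlap of the two charts is the basic open set of `c c'`. There both morphisms factor
through the pull-back of fractions with denominator `t t'`, and the ring maps agree because they
have the same values. -/
lemma CompatiblePair.fst_map_eq (i j : CompatiblePair 𝒮 𝒯 π) :
    pullback.fst i.ι j.ι ≫ i.map = pullback.snd i.ι j.ι ≫ j.map := by
  have hx := homElem_mul 𝒮 i.hc j.hc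
  have hy := homElem_mul 𝒯 i.ht j.ht
  let k := i.compat.mul i.hd j.compat
  have e1 := Proj.pullbackAwayιIso_hom_SpecMap_awayMap_left (sectionGrading 𝒮)
    (homElem_mem 𝒮 i.c i.hc) i.hm (homElem_mem 𝒮 j.c j.hc) j.hm hx
  have e2 := Proj.pullbackAwayιIso_hom_SpecMap_awayMap_right (sectionGrading 𝒮)
    (homElem_mem 𝒮 i.c i.hc) i.hm (homElem_mem 𝒮 j.c j.hc) j.hm hx
  change pullback.fst (Proj.awayι (sectionGrading 𝒮) _ (homElem_mem 𝒮 i.c i.hc) i.hm)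
    (Proj.awayι (sectionGrading 𝒮) _ (homElem_mem 𝒮 j.c j.hc) j.hm) ≫ _ =
    pullback.snd (Proj.awayι (sectionGrading 𝒮) _ (homElem_mem 𝒮 i.c i.hc) i.hm)
    (Proj.awayι (sectionGrading 𝒮) _ (homElem_mem 𝒮 j.c j.hc) j.hm) ≫ _
  rw [← e1, ← e2, Category.assoc, Category.assoc]
  congr 1
  have f1 := Proj.SpecMap_awayMap_awayι (sectionGrading 𝒯) (homElem_mem 𝒯 i.t i.ht) i.hd
    (homElem_mem 𝒯 j.t j.ht) hy
  have f2 := Proj.SpecMap_awayMap_awayι (sectionGrading 𝒯) (homElem_mem 𝒯 j.t j.ht) j.hd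
    (homElem_mem 𝒯 i.t i.ht) (hy.trans (mul_comm _ _))
  have g1 : CommRingCat.ofHom i.compat.hom ≫ CommRingCat.ofHom
      (HomogeneousLocalization.awayMap (sectionGrading 𝒮) (homElem_mem 𝒮 j.c j.hc) hx) =
      CommRingCat.ofHom (HomogeneousLocalization.awayMap (sectionGrading 𝒯)
        (homElem_mem 𝒯 j.t j.ht) hy) ≫ CommRingCat.ofHom k.hom := by
    refine CommRingCat.hom_ext (RingHom.ext fun z => ?_)
    refine evalFrac_ext (SetLike.mul_mem_graded i.hc j.hc) fun x => ?_
    simp only [CommRingCat.hom_comp, CommRingCat.hom_ofHom, RingHom.comp_apply]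
    have hxi : i.c x.1 ≠ 0 := left_ne_zero_of_mul x.2
    rw [evalFrac_awayMap i.hc j.hc _ hx _ x hxi, Compatible.evalFrac_hom, Compatible.evalFrac_hom,
      evalFrac_awayMap i.ht j.ht _ hy _ _ (i.compat.ne_zero _ hxi)]
  have g2 : CommRingCat.ofHom j.compat.hom ≫ CommRingCat.ofHom
      (HomogeneousLocalization.awayMap (sectionGrading 𝒮) (homElem_mem 𝒮 i.c i.hc)
        (hx.trans (mul_comm _ _))) =
      CommRingCat.ofHom (HomogeneousLocalization.awayMap (sectionGrading 𝒯)
        (homElem_mem 𝒯 i.t i.ht) (hy.trans (mul_comm _ _))) ≫ CommRingCat.ofHom k.hom := by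
    refine CommRingCat.hom_ext (RingHom.ext fun z => ?_)
    refine evalFrac_ext (SetLike.mul_mem_graded i.hc j.hc) fun x => ?_
    simp only [CommRingCat.hom_comp, CommRingCat.hom_ofHom, RingHom.comp_apply]
    have hxj : j.c x.1 ≠ 0 := right_ne_zero_of_mul x.2
    rw [evalFrac_awayMap j.hc i.hc _ (hx.trans (mul_comm _ _)) _ x hxj, Compatible.evalFrac_hom,
      Compatible.evalFrac_hom,
      evalFrac_awayMap j.ht i.ht _ (hy.trans (mul_comm _ _)) _ _ (j.compat.ne_zero _ hxj)]
  rw [CompatiblePair.map, CompatiblePair.map, ← Spec.map_comp_assoc, ← Spec.map_comp_assoc,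
    g1, g2, Spec.map_comp_assoc, Spec.map_comp_assoc, f1, f2]
  rfl

/-- An open cover of `Proj` by open subsets given by compatible pairs. -/
def pairCover {κ : Type} (j : κ → CompatiblePair 𝒮 𝒯 π)
    (hj : ⨆ k, Proj.basicOpen (sectionGrading 𝒮) (homElem 𝒮 (j k).c (j k).hc) = ⊤) :
    (Proj (sectionGrading 𝒮)).AffineOpenCover where
  I₀ := κ
  X k := .of (FracRing 𝒮 (j k).c (j k).hc)
  f k := (j k).ι
  idx x := (TopologicalSpace.Opens.mem_iSup.mp (hj.ge (Set.mem_univ x))).choose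
  covers x := by
    change x ∈ (Proj.awayι _ _ _ _).opensRange
    rw [Proj.opensRange_awayι]
    exact (TopologicalSpace.Opens.mem_iSup.mp (hj.ge (Set.mem_univ x))).choose_spec
  map_prop k := by
    change IsOpenImmersion (Proj.awayι _ _ _ _)
    infer_instance

/-- The morphism between `Proj`s induced by a map of sets which pulls fractions back to
fractions. -/
def inducedMap
    (hcov : ⨆ i : CompatiblePair 𝒮 𝒯 π,
      Proj.basicOpen (sectionGrading 𝒮) (homElem 𝒮 i.c i.hc) = ⊤) :
    Proj (sectionGrading 𝒮) ⟶ Proj (sectionGrading 𝒯) :=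
  (pairCover id hcov).openCover.glueMorphisms (fun i => CompatiblePair.map i)
    (fun i j => CompatiblePair.fst_map_eq i j)

variable
  (hcov : ⨆ i : CompatiblePair 𝒮 𝒯 π, Proj.basicOpen (sectionGrading 𝒮) (homElem 𝒮 i.c i.hc) = ⊤)

lemma CompatiblePair.ι_inducedMap (i : CompatiblePair 𝒮 𝒯 π) : i.ι ≫ inducedMap hcov = i.map :=
  (pairCover id hcov).openCover.ι_glueMorphisms _ _ i

lemma awayι_preimage_basicOpen_frac (hd : 0 < d) {e : ℕ} {g : Y → ℂ} (hg : g ∈ 𝒯 e) (he : 0 < e) :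
    Proj.awayι (sectionGrading 𝒯) _ (homElem_mem 𝒯 t ht) hd ⁻¹ᵁ
        Proj.basicOpen (sectionGrading 𝒯) (homElem 𝒯 g hg) =
      PrimeSpectrum.basicOpen (frac ht e (g ^ d) (by
        convert! SetLike.pow_mem_graded d hg using 2; exact mul_comm _ _)) := by
  rw [Proj.awayι_preimage_basicOpen (sectionGrading 𝒯) (homElem_mem 𝒯 t ht) hd
    (homElem_mem 𝒯 g hg) he]
  congr 1
  simp only [frac, HomogeneousLocalization.Away.isLocalizationElem]
  congr 1
  exact (homElem_pow 𝒯 hg d).symm.trans (homElem_congr 𝒯 (mul_comm _ _) rfl _ _)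

lemma CompatiblePair.ι_preimage_inducedMap (i : CompatiblePair 𝒮 𝒯 π) {e : ℕ} {g : Y → ℂ}
    (hg : g ∈ 𝒯 e) (he : 0 < e) :
    i.ι ⁻¹ᵁ (inducedMap hcov ⁻¹ᵁ Proj.basicOpen (sectionGrading 𝒯) (homElem 𝒯 g hg)) =
      PrimeSpectrum.basicOpen (i.compat.hom (frac i.ht e (g ^ i.d) (by
        convert! SetLike.pow_mem_graded i.d hg using 2; exact mul_comm _ _))) := by
  rw [← Scheme.Hom.comp_preimage, CompatiblePair.ι_inducedMap, CompatiblePair.map,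
    Scheme.Hom.comp_preimage, awayι_preimage_basicOpen_frac i.hd hg he]
  rfl

/-- In the chart both open sets are basic, defined by the pull-back of `g ^ d / t ^ e` and by `g' ^
m / c ^ e'`. It suffices that a positive power of the first equals the second, since powers define
the same open set. -/
lemma CompatiblePair.ι_preimage_inducedMap_eq (i : CompatiblePair 𝒮 𝒯 π) {e e' : ℕ} {g : Y → ℂ}
    (hg : g ∈ 𝒯 e) (he : 0 < e) {g' : X → ℂ} (hg' : g' ∈ 𝒮 e') (he' : 0 < e') {r : ℕ} (hr : 0 < r)
    (h : ∀ x, i.c x ≠ 0 → (g (π x) ^ i.d / i.t (π x) ^ e) ^ r = g' x ^ i.m / i.c x ^ e') :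
    i.ι ⁻¹ᵁ (inducedMap hcov ⁻¹ᵁ Proj.basicOpen (sectionGrading 𝒯) (homElem 𝒯 g hg)) =
      i.ι ⁻¹ᵁ Proj.basicOpen (sectionGrading 𝒮) (homElem 𝒮 g' hg') := by
  rw [i.ι_preimage_inducedMap hcov hg he]
  refine Eq.trans ?_ (awayι_preimage_basicOpen_frac i.hm hg' he').symm
  rw [← PrimeSpectrum.basicOpen_pow _ r hr]
  congr 1
  refine evalFrac_ext i.hc fun x => ?_
  simp only [map_pow, Pi.pow_apply, Compatible.evalFrac_hom, evalFrac_frac]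
  exact h x.1 x.2

lemma CompatiblePair.opensRange_ι (i : CompatiblePair 𝒮 𝒯 π) :
    Set.range i.ι = (Proj.basicOpen (sectionGrading 𝒮) (homElem 𝒮 i.c i.hc) : Set _) := by
  rw [← Proj.opensRange_awayι (sectionGrading 𝒮) _ (homElem_mem 𝒮 i.c i.hc) i.hm]
  rfl

lemma eq_of_forall_ι_preimage {κ : Type} (j : κ → CompatiblePair 𝒮 𝒯 π)
    (hj : ⨆ k, Proj.basicOpen (sectionGrading 𝒮) (homElem 𝒮 (j k).c (j k).hc) = ⊤)
    {U V : (Proj (sectionGrading 𝒮)).Opens} (h : ∀ k, (j k).ι ⁻¹ᵁ U = (j k).ι ⁻¹ᵁ V) : U = V := by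
  ext x
  obtain ⟨k, hk⟩ := TopologicalSpace.Opens.mem_iSup.mp (hj.ge (Set.mem_univ x))
  have hk' : x ∈ Set.range (j k).ι := by
    rw [CompatiblePair.opensRange_ι]
    exact hk
  obtain ⟨y, rfl⟩ := hk'
  exact SetLike.ext_iff.mp (h k) y

end InducedMorphisms


/-! ### Averaging over a finite group and integrality over invariants -/

section Reynolds

variable {G : Type} [Group G] {X : Type} (α : G →* Function.End X)

/-- Functions invariant under an action. -/
def fixedFunctions : Subalgebra ℂ (X → ℂ) where
  carrier := {F | ∀ g v, F (α g v) = F v}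
  mul_mem' hF hH g v := by simp [hF g v, hH g v]
  add_mem' hF hH g v := by simp [hF g v, hH g v]
  algebraMap_mem' r g v := rfl

/-- The action on functions by composition. -/
def compAction (g : G) : (X → ℂ) →ₐ[ℂ] (X → ℂ) where
  toFun x v := x (α g v)
  map_one' := rfl
  map_mul' _ _ := rfl
  map_zero' := rfl
  map_add' _ _ := rfl
  commutes' _ := rfl

lemma compAction_apply (g : G) (x : X → ℂ) (v : X) : compAction α g x v = x (α g v) := rfl

lemma compAction_compAction (g h : G) (x : X → ℂ) :
    compAction α h (compAction α g x) = compAction α (g * h) x := by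
  funext v
  simp only [compAction_apply, map_mul]
  rfl

lemma mem_fixedFunctions_iff {x : X → ℂ} :
    x ∈ fixedFunctions α ↔ ∀ g, compAction α g x = x :=
  ⟨fun h g => funext fun v => h g v, fun h g v => congrFun (h g) v⟩

/-- A subspace of functions stable under an action. -/
def IsStable (M : Submodule ℂ (X → ℂ)) : Prop := ∀ g, ∀ x ∈ M, compAction α g x ∈ M

variable {α}

lemma IsStable.map_le {M : Submodule ℂ (X → ℂ)} (hM : IsStable α M) (g : G) :
    M.map (compAction α g).toLinearMap ≤ M := by
  rintro _ ⟨x, hx, rfl⟩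
  exact hM g x hx

lemma IsStable.mul {M N : Submodule ℂ (X → ℂ)} (hM : IsStable α M) (hN : IsStable α N) :
    IsStable α (M * N) := fun g x hx => by
  have h : compAction α g x ∈ (M * N).map (compAction α g).toLinearMap := ⟨x, hx, rfl⟩
  rw [Submodule.map_mul] at h
  exact mul_le_mul' (hM.map_le g) (hN.map_le g) h

lemma IsStable.pow {M : Submodule ℂ (X → ℂ)} (hM : IsStable α M) (n : ℕ) :
    IsStable α (M ^ n) := fun g x hx => by
  have h : compAction α g x ∈ (M ^ n).map (compAction α g).toLinearMap := ⟨x, hx, rfl⟩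
  rw [Submodule.map_pow] at h
  exact pow_le_pow_left' (hM.map_le g) n h

variable [Fintype G]

variable (α) in
/-- Averaging over the group. -/
def reynolds : (X → ℂ) →ₗ[ℂ] (X → ℂ) :=
  (Fintype.card G : ℂ)⁻¹ • ∑ g, (compAction α g).toLinearMap

lemma reynolds_eq (x : X → ℂ) :
    reynolds α x = (Fintype.card G : ℂ)⁻¹ • ∑ g, compAction α g x := by
  simp [reynolds]

lemma compAction_sum (h : G) (x : X → ℂ) :
    compAction α h (∑ g, compAction α g x) = ∑ g, compAction α g x := by
  rw [map_sum]
  simp only [compAction_compAction]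
  exact Fintype.sum_equiv (Equiv.mulRight h) _ _ fun _ => rfl

lemma reynolds_mem_fixedFunctions (x : X → ℂ) : reynolds α x ∈ fixedFunctions α := by
  rw [mem_fixedFunctions_iff]
  intro h
  rw [reynolds_eq, map_smul, compAction_sum]

lemma reynolds_of_mem {x : X → ℂ} (hx : x ∈ fixedFunctions α) : reynolds α x = x := by
  rw [reynolds_eq, Finset.sum_congr rfl fun g _ => (mem_fixedFunctions_iff α).mp hx g]
  simp only [Finset.sum_const, Finset.card_univ]
  rw [← Nat.cast_smul_eq_nsmul ℂ, smul_smul, inv_mul_cancel₀, one_smul]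
  exact_mod_cast Fintype.card_ne_zero

lemma reynolds_mul {x y : X → ℂ} (hy : y ∈ fixedFunctions α) :
    reynolds α (x * y) = reynolds α x * y := by
  simp only [reynolds_eq, map_mul, (mem_fixedFunctions_iff α).mp hy]
  rw [← Finset.sum_mul, smul_mul_assoc]

lemma IsStable.reynolds_mem {M : Submodule ℂ (X → ℂ)} (hM : IsStable α M) {x : X → ℂ}
    (hx : x ∈ M) : reynolds α x ∈ M := by
  rw [reynolds_eq]
  exact M.smul_mem _ (M.sum_mem fun g _ => hM g x hx)

/-- An invariant element of `M * N`, with `M` invariant, lies in `M * N^G`. -/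
lemma mem_mul_of_mem_fixedFunctions {M N : Submodule ℂ (X → ℂ)} (hM : IsStable α M)
    (hN : N ≤ Subalgebra.toSubmodule (fixedFunctions α)) {x : X → ℂ}
    (hx : x ∈ M * N) (hx' : x ∈ fixedFunctions α) :
    x ∈ (M ⊓ Subalgebra.toSubmodule (fixedFunctions α)) * N := by
  rw [← reynolds_of_mem hx']
  clear hx'
  induction hx using Submodule.mul_induction_on' with
  | mem_mul_mem m hm n hn =>
    rw [reynolds_mul (hN hn)]
    exact Submodule.mul_mem_mul ⟨hM.reynolds_mem hm, reynolds_mem_fixedFunctions m⟩ hn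
  | add x _ y _ hx hy =>
    rw [map_add]
    exact add_mem hx hy

/-- Elements of a stable space of functions are homogeneously integral over the invariants. -/
lemma exists_pow_eq_sum (M : Submodule ℂ (X → ℂ)) (hM : IsStable α M) {x : X → ℂ} (hx : x ∈ M) :
    ∃ a : ℕ → X → ℂ, (∀ j, a j ∈ M ^ j ∧ a j ∈ fixedFunctions α) ∧
      x ^ Fintype.card G = ∑ j ∈ Finset.Icc 1 (Fintype.card G), a j * x ^ (Fintype.card G - j) := by
  -- The equation is that of the root `x` of `∏ (T - g x)`; its coefficients are, up to sign, the
  -- elementary symmetric functions of the orbit.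
  let s : Multiset (X → ℂ) := Finset.univ.val.map fun g => compAction α g x
  have hs : s.card = Fintype.card G := by simp [s]
  refine ⟨fun j => -((-1) ^ j * s.esymm j), fun j => ⟨?_, ?_⟩, ?_⟩
  · have h1 : s.esymm j ∈ M ^ j := by
      rw [Finset.esymm_map_val]
      refine Submodule.sum_mem _ fun t ht => ?_
      rw [← (Finset.mem_powersetCard.mp ht).2]
      clear ht
      induction t using Finset.cons_induction with
      | empty => simpa using ⟨1, map_one _⟩
      | cons g t hg ih =>
        rw [Finset.prod_cons, Finset.card_cons, pow_succ']
        exact Submodule.mul_mem_mul (hM g x hx) ih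
    rcases Nat.even_or_odd j with h | h <;> simp [h.neg_one_pow, h1]
  · have h1 : s.esymm j ∈ fixedFunctions α := by
      rw [mem_fixedFunctions_iff]
      intro h
      have h2 : s.map (compAction α h) = s := by
        simp only [s, Multiset.map_map, Function.comp_apply, compAction_compAction]
        have := congrArg (fun u : Finset G => Multiset.map (fun g => compAction α g x) u.val)
          (Finset.map_univ_equiv (Equiv.mulRight h))
        rw [Finset.map_val, Multiset.map_map] at this
        exact this
      conv_rhs => rw [← h2]
      simp only [Multiset.esymm, Multiset.powersetCard_map, Multiset.map_map]
      rw [map_multiset_sum, Multiset.map_map]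
      congr 1
      refine Multiset.map_congr rfl fun t _ => ?_
      simp [map_multiset_prod]
    refine neg_mem (mul_mem (pow_mem (neg_mem (one_mem _)) j) h1)
  · have h := congrArg (Polynomial.eval x) (Multiset.prod_X_sub_X_eq_sum_esymm s)
    have h0 : Polynomial.eval x (s.map fun t => Polynomial.X - Polynomial.C t).prod = 0 := by
      rw [← Polynomial.coe_evalRingHom, map_multiset_prod, Multiset.map_map]
      refine Multiset.prod_eq_zero (Multiset.mem_map.mpr ⟨x, ?_, by simp⟩)
      refine Multiset.mem_map.mpr ⟨1, Finset.mem_univ_val _, ?_⟩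
      funext v
      rw [compAction_apply, map_one]
      rfl
    have hs0 : s.esymm 0 = 1 := by simp [Multiset.esymm]
    rw [h0, hs, Polynomial.eval_finsetSum, Finset.range_eq_Ico,
      Finset.sum_eq_sum_Ico_succ_bot (by omega)] at h
    simp only [pow_zero, hs0, one_mul, Nat.sub_zero, Polynomial.eval_pow,
      Polynomial.eval_X, Polynomial.eval_mul, Polynomial.eval_neg, Polynomial.eval_one,
      Polynomial.eval_C, zero_add] at h
    rw [eq_comm, add_eq_zero_iff_eq_neg] at h
    rw [h, ← Finset.sum_neg_distrib]
    refine Finset.sum_congr ?_ fun j _ => by ring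
    ext
    simp

lemma Submodule.pow_mem_pow_pow {A : Type} [CommRing A] [Algebra ℂ A] {M : Submodule ℂ A} {x : A}
    {i : ℕ} (hx : x ∈ M ^ i) (k : ℕ) : x ^ k ∈ M ^ (i * k) := by
  rw [pow_mul]
  exact Submodule.pow_mem_pow _ hx k

/-- A power of any element of a stable space `M` of functions lies in the ideal generated by
the invariants of a fixed degree. -/
lemma exists_pow_mem_mul (M : Submodule ℂ (X → ℂ)) (hM : IsStable α M) {x : X → ℂ} (hx : x ∈ M) :
    ∃ N, (Fintype.card G).factorial ≤ N ∧
      x ^ N ∈ (M ^ (Fintype.card G).factorial ⊓ Subalgebra.toSubmodule (fixedFunctions α)) *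
        M ^ (N - (Fintype.card G).factorial) := by
  obtain ⟨a, ha, e⟩ := exists_pow_eq_sum M hM hx
  set n := Fintype.card G with hn
  have hn0 : 0 < n := Fintype.card_pos
  set D := n.factorial with hD
  have hD0 : 0 < D := Nat.factorial_pos n
  -- Raise the integral equation for `x ^ n` to the power `n D`, where `D = n!`. The `n` exponents
  -- in each term of the expansion add up to `n D`, so one of them, `k i`, is at least `D`. As `i`
  -- divides `n!`, the factor `a i ^ (D / i)` splits off, and it is an invariant of degree exactly
  -- `D`.
  refine ⟨n * (n * D), ?_, ?_⟩
  · rw [← mul_assoc]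
    exact Nat.le_mul_of_pos_left _ (Nat.mul_pos hn0 hn0)
  rw [pow_mul, e, Finset.sum_pow_eq_sum_piAntidiag]
  refine Submodule.sum_mem _ fun k hk => ?_
  rw [Finset.mem_piAntidiag] at hk
  obtain ⟨i, hi, hik⟩ : ∃ i ∈ Finset.Icc 1 n, D ≤ k i := by
    by_contra! hcon
    have h1 : ∑ i ∈ Finset.Icc 1 n, k i < ∑ i ∈ Finset.Icc 1 n, D :=
      Finset.sum_lt_sum_of_nonempty ⟨1, by simp; omega⟩ hcon
    rw [hk.1] at h1
    simp at h1
  rw [← nsmul_eq_mul]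
  refine nsmul_mem ?_ _
  rw [← Finset.mul_prod_erase _ _ hi]
  obtain ⟨hi1, hin⟩ := Finset.mem_Icc.mp hi
  obtain ⟨q, hq⟩ : i ∣ D := Nat.dvd_factorial hi1 hin
  have hqk : q ≤ k i := le_trans (by rw [hq]; exact Nat.le_mul_of_pos_left _ hi1) hik
  have hrest : ∏ j ∈ (Finset.Icc 1 n).erase i, (a j * x ^ (n - j)) ^ k j ∈
      M ^ (n * ∑ j ∈ (Finset.Icc 1 n).erase i, k j) := by
    have hsub : (Finset.Icc 1 n).erase i ⊆ Finset.Icc 1 n := Finset.erase_subset _ _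
    generalize (Finset.Icc 1 n).erase i = t at hsub
    induction t using Finset.cons_induction with
    | empty => simpa using ⟨1, map_one _⟩
    | cons j t hj ih =>
      rw [Finset.prod_cons, Finset.sum_cons, mul_add, pow_add]
      refine Submodule.mul_mem_mul ?_ (ih fun u hu => hsub (Finset.mem_cons_of_mem hu))
      have hjn := (Finset.mem_Icc.mp (hsub (Finset.mem_cons_self j t))).2
      have : a j * x ^ (n - j) ∈ M ^ n := by
        have := Submodule.mul_mem_mul (ha j).1 (Submodule.pow_mem_pow _ hx (n - j))
        rwa [← pow_add, Nat.add_sub_cancel' hjn] at this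
      exact Submodule.pow_mem_pow_pow this _
  have hsum : k i + ∑ j ∈ (Finset.Icc 1 n).erase i, k j = n * D := by
    rw [Finset.add_sum_erase _ _ hi, hk.1]
  have hfac : (a i * x ^ (n - i)) ^ k i =
      a i ^ q * (a i ^ (k i - q) * (x ^ (n - i)) ^ k i) := by
    rw [mul_pow, ← mul_assoc, ← pow_add, Nat.add_sub_cancel' hqk]
  rw [hfac, mul_assoc]
  refine Submodule.mul_mem_mul ⟨?_, pow_mem (ha i).2 q⟩ ?_
  · rw [hq]
    exact Submodule.pow_mem_pow_pow (ha i).1 q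
  · have h1 := Submodule.mul_mem_mul (Submodule.mul_mem_mul
      (Submodule.pow_mem_pow_pow (ha i).1 (k i - q))
      (Submodule.pow_mem_pow_pow (Submodule.pow_mem_pow _ hx (n - i)) (k i))) hrest
    rw [← pow_add, ← pow_add] at h1
    convert! h1 using 2
    zify [hqk, hin]
    rw [Nat.cast_sub (by
      rw [← mul_assoc]
      exact Nat.le_mul_of_pos_left _ (Nat.mul_pos hn0 hn0))]
    have e1 : (D : ℤ) = i * q := by exact_mod_cast hq
    have e2 : (k i : ℤ) + ∑ j ∈ (Finset.Icc 1 n).erase i, (k j : ℤ) = n * D := by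
      exact_mod_cast hsum
    push_cast
    linear_combination -(n : ℤ) * e2 - e1

end Reynolds


/-! ### Invariants of one degree generate up to radical -/

section FiniteGeneration

variable {A : Type} [CommRing A] [Algebra ℂ A]

/-- In the expansion of `(P + Q) ^ (n + m)` every term contains `P ^ n` or `Q ^ m`, and `M` absorbs
the remaining factors. -/
lemma sup_pow_add_le_mul {P Q M S : Submodule ℂ A} (hP : P ≤ M) (hQ : Q ≤ M) {n m D : ℕ}
    (hn : D ≤ n) (hm : D ≤ m) (hPn : P ^ n ≤ S * M ^ (n - D)) (hQm : Q ^ m ≤ S * M ^ (m - D)) :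
    (P ⊔ Q) ^ (n + m) ≤ S * M ^ (n + m - D) := by
  rw [← Submodule.add_eq_sup, add_pow]
  refine Finset.sum_induction _ (· ≤ S * M ^ (n + m - D)) (fun a b ha hb => sup_le ha hb) bot_le ?_
  intro i hi
  have hi' : i ≤ n + m := Nat.lt_succ_iff.mp (Finset.mem_range.mp hi)
  -- Addition of submodules is their supremum, so a binomial coefficient cannot enlarge a term.
  have hcast : ∀ (x : Submodule ℂ A) (k : ℕ), x * (k : Submodule ℂ A) ≤ x := fun x k => by
    induction k with
    | zero => simp
    | succ k ih =>
      rw [Nat.cast_succ, mul_add, mul_one]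
      exact sup_le ih le_rfl
  refine (hcast _ _).trans ?_
  by_cases h : n ≤ i
  · calc P ^ i * Q ^ (n + m - i) = P ^ n * P ^ (i - n) * Q ^ (n + m - i) := by
          rw [← pow_add, Nat.add_sub_cancel' h]
      _ ≤ S * M ^ (n - D) * M ^ (i - n) * M ^ (n + m - i) :=
          mul_le_mul' (mul_le_mul' hPn (pow_le_pow_left' hP _)) (pow_le_pow_left' hQ _)
      _ = S * M ^ (n + m - D) := by
          rw [mul_assoc, mul_assoc, ← pow_add, ← pow_add]
          congr 2
          omega
  · calc P ^ i * Q ^ (n + m - i) = P ^ i * (Q ^ m * Q ^ (n - i)) := by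
          rw [← pow_add]
          congr 2
          omega
      _ ≤ M ^ i * (S * M ^ (m - D) * M ^ (n - i)) :=
          mul_le_mul' (pow_le_pow_left' hP _) (mul_le_mul' hQm (pow_le_pow_left' hQ _))
      _ = S * M ^ (n + m - D) := by
          rw [mul_assoc, mul_left_comm, ← pow_add, ← pow_add]
          congr 2
          omega

variable {G : Type} [Group G] [Fintype G] {X : Type} {α : G →* Function.End X}

/-- Induction on a finite generating set, from `exists_pow_mem_mul`. It matters that the degree
`|G|!` depends on the group alone: it can be used at once for the forms vanishing on `J` and for all
linear forms. -/
lemma exists_pow_le_mul {M : Submodule ℂ (X → ℂ)} (hM : IsStable α M) (hfg : M.FG) :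
    ∃ N, (Fintype.card G).factorial ≤ N ∧
      M ^ N ≤ (M ^ (Fintype.card G).factorial ⊓ Subalgebra.toSubmodule (fixedFunctions α)) *
        M ^ (N - (Fintype.card G).factorial) := by
  classical
  obtain ⟨s, hs⟩ := hfg
  suffices h : ∀ t : Finset (X → ℂ), Submodule.span ℂ (t : Set (X → ℂ)) ≤ M →
      ∃ N, (Fintype.card G).factorial ≤ N ∧ Submodule.span ℂ (t : Set (X → ℂ)) ^ N ≤
        (M ^ (Fintype.card G).factorial ⊓ Subalgebra.toSubmodule (fixedFunctions α)) *
          M ^ (N - (Fintype.card G).factorial) by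
    have := h s hs.le
    rwa [hs] at this
  intro t
  induction t using Finset.induction_on with
  | empty =>
    intro _
    refine ⟨_, le_rfl, ?_⟩
    rw [Finset.coe_empty, Submodule.span_empty, Submodule.bot_pow (Nat.factorial_pos _).ne']
    exact bot_le
  | insert x t hx ih =>
    intro ht
    rw [Finset.coe_insert, Submodule.span_insert] at ht ⊢
    obtain ⟨m, hm, hm'⟩ := ih (le_sup_right.trans ht)
    have hxM : x ∈ M := ht (Submodule.mem_sup_left (Submodule.mem_span_singleton_self x))
    obtain ⟨n, hn, hn'⟩ := exists_pow_mem_mul M hM hxM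
    refine ⟨n + m, by omega, sup_pow_add_le_mul (le_sup_left.trans ht) (le_sup_right.trans ht)
      hn hm ?_ hm'⟩
    rw [Submodule.span_pow, Set.singleton_pow, Submodule.span_singleton_le_iff_mem]
    exact hn'

lemma pow_le_mul_of_le {M S : Submodule ℂ A} {N N' D : ℕ} (hD : D ≤ N) (hN : N ≤ N')
    (h : M ^ N ≤ S * M ^ (N - D)) : M ^ N' ≤ S * M ^ (N' - D) := by
  calc M ^ N' = M ^ N * M ^ (N' - N) := by rw [← pow_add, Nat.add_sub_cancel' hN]
    _ ≤ S * M ^ (N - D) * M ^ (N' - N) := mul_le_mul' h le_rfl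
    _ = S * M ^ (N' - D) := by
      rw [mul_assoc, ← pow_add]
      congr 2
      omega

end FiniteGeneration

/-! ### The projection from `ℙ(J)` on quotients -/

section Projection

variable {G : Type} [Group G] {W : Type} [AddCommGroup W] [Module ℂ W]

/-- The action of the group on the underlying set of a representation. -/
def setAction (ρ : Representation ℂ G W) : G →* Function.End W where
  toFun g := fun w => ρ g w
  map_one' := by
    rw [map_one]
    rfl
  map_mul' g h := by
    rw [map_mul]
    rfl

variable {ρ : Representation ℂ G W}

lemma isStable_linearForms (J : Subrepresentation ρ) :
    IsStable (setAction ρ) (linearForms J.toSubmodule) := fun g F hF => by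
  have h := comp_mem_linearForms_pow (ρ g) (J := J.toSubmodule) (J' := J.toSubmodule)
    (fun w hw => J.apply_mem_toSubmodule g hw) (n := 1) (by rwa [pow_one])
  rwa [pow_one] at h

lemma isStable_linearForms_bot : IsStable (setAction ρ) (linearForms (⊥ : Submodule ℂ W)) :=
  isStable_linearForms (⊥ : Subrepresentation ρ)

lemma linearForms_fg [FiniteDimensional ℂ W] (J : Submodule ℂ W) : (linearForms J).FG :=
  (IsNoetherian.noetherian J.dualAnnihilator).map _

lemma linearForms_mono {J J' : Submodule ℂ W} (h : J ≤ J') : linearForms J' ≤ linearForms J :=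
  Submodule.map_mono (Submodule.dualAnnihilator_anti h)

variable (I J : Subrepresentation ρ) (hIJ : IsCompl I.toSubmodule J.toSubmodule)

lemma projectionOnto_apply_rho (g : G) (w : W) :
    I.toSubmodule.projectionOnto J.toSubmodule hIJ (ρ g w) =
      I.toRepresentation g (I.toSubmodule.projectionOnto J.toSubmodule hIJ w) := by
  obtain ⟨a, ha, b, hb, rfl⟩ := Submodule.mem_sup.mp
    (show w ∈ I.toSubmodule ⊔ J.toSubmodule by rw [hIJ.sup_eq_top]; trivial)
  rw [map_add, map_add, map_add,
    Submodule.projectionOnto_apply_of_mem_left hIJ (I.apply_mem_toSubmodule g ha),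
    Submodule.projectionOnto_apply_of_mem_left hIJ ha,
    (Submodule.projectionOnto_apply_eq_zero_iff hIJ).mpr (J.apply_mem_toSubmodule g hb),
    (Submodule.projectionOnto_apply_eq_zero_iff hIJ).mpr hb, add_zero, add_zero]
  rfl

/-- The functions in `linearForms J ^ n` are the pull-backs of functions on `I`. -/
lemma exists_pullbackFn_eq {n : ℕ} {g : W → ℂ} (hg : g ∈ linearForms J.toSubmodule ^ n) :
    ∃ f ∈ homogeneousFunctions I.toSubmodule n, pullbackFn I J hIJ f = g := by
  let Φ : (I.toSubmodule → ℂ) →ₐ[ℂ] (W → ℂ) :=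
    { toFun := pullbackFn I J hIJ
      map_one' := rfl
      map_mul' := fun _ _ => rfl
      map_zero' := rfl
      map_add' := fun _ _ => rfl
      commutes' := fun _ => rfl }
  have h1 : linearForms J.toSubmodule ≤
      (linearForms (⊥ : Submodule ℂ I.toSubmodule)).map Φ.toLinearMap := by
    rintro _ ⟨l, hl, rfl⟩
    rw [SetLike.mem_coe, Submodule.mem_dualAnnihilator] at hl
    refine ⟨fun v => l v, ⟨l.comp I.toSubmodule.subtype, ?_, rfl⟩, ?_⟩
    · simp
    · funext w
      obtain ⟨a, ha, b, hb, rfl⟩ := Submodule.mem_sup.mp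
        (show w ∈ I.toSubmodule ⊔ J.toSubmodule by rw [hIJ.sup_eq_top]; trivial)
      change l (I.toSubmodule.projectionOnto J.toSubmodule hIJ (a + b)) = l (a + b)
      rw [map_add, map_add, Submodule.projectionOnto_apply_of_mem_left hIJ ha,
        (Submodule.projectionOnto_apply_eq_zero_iff hIJ).mpr hb, add_zero, hl b hb, add_zero]
  have h2 := pow_le_pow_left' h1 n hg
  rw [← Submodule.map_pow] at h2
  obtain ⟨f, hf, rfl⟩ := h2
  exact ⟨f, hf, rfl⟩

lemma exists_invariant_pullbackFn_eq {n : ℕ} {g : W → ℂ} (hg : g ∈ linearForms J.toSubmodule ^ n)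
    (hg' : g ∈ invariantFunctions ρ) :
    ∃ f ∈ invariantForms I.toRepresentation n, pullbackFn I J hIJ f = g := by
  obtain ⟨f, hf, rfl⟩ := exists_pullbackFn_eq I J hIJ hg
  refine ⟨f, ⟨hf, fun σ v => ?_⟩, rfl⟩
  have h := hg' σ v
  simp only [pullbackFn, projectionOnto_apply_rho, Submodule.projectionOnto_apply_left] at h
  exact h

/-- The compatible pairs defining the projection on quotients. -/
def projectionPair {d : ℕ} (hd : 0 < d) {f : I.toSubmodule → ℂ}
    (hf : f ∈ invariantForms I.toRepresentation d) {h : W → ℂ} (hh : h ∈ invariantForms ρ d) :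
    CompatiblePair (blowupForms J) (invariantForms I.toRepresentation)
      (I.toSubmodule.projectionOnto J.toSubmodule hIJ) where
  m := d
  d := d
  c := pullbackFn I J hIJ f * h
  t := f
  hm := hd
  hd := hd
  hc := pullbackFn_mul_mem I J hIJ hf hh
  ht := hf
  compat :=
    { ne_zero := fun w hw => left_ne_zero_of_mul hw
      pullback := fun k a ha => ⟨k, pullbackFn I J hIJ a * h ^ k,
        pullbackFn_mul_mem I J hIJ ha (pow_mem_invariantForms hh k), fun w hw => by
          have h1 : pullbackFn I J hIJ f w ≠ 0 := left_ne_zero_of_mul hw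
          have h2 := right_ne_zero_of_mul hw
          change pullbackFn I J hIJ a w / pullbackFn I J hIJ f w ^ k = _
          simp only [Pi.mul_apply, Pi.pow_apply, mul_pow]
          field_simp⟩ }

variable [Fintype G] [FiniteDimensional ℂ W]

/-- A power of an element of positive degree lies in the ideal generated by the products `f * h`. -/
lemma exists_pow_mem_blowup {n : ℕ} (hn : 0 < n) {b : W → ℂ} (hb : b ∈ blowupForms J n) :
    ∃ N D, 0 < D ∧ D ≤ n * N ∧ b ^ N ∈
      ((linearForms J.toSubmodule ^ D ⊓ Subalgebra.toSubmodule (invariantFunctions ρ)) *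
        invariantForms ρ D) * blowupForms J (n * N - D) := by
  -- Invariants of the common degree `|G|!` split off from the forms vanishing on `J` and from all
  -- forms; together they make a product `f * h` as in `IsInducedByProjection`. Averaging then makes
  -- the cofactor invariant.
  obtain ⟨N₁, h₁, h₁'⟩ := exists_pow_le_mul (isStable_linearForms J) (linearForms_fg J.toSubmodule)
  obtain ⟨N₂, h₂, h₂'⟩ := exists_pow_le_mul (isStable_linearForms_bot (ρ := ρ)) (linearForms_fg ⊥)
  set D := (Fintype.card G).factorial
  have hle : N₁ + N₂ ≤ n * (N₁ + N₂) := Nat.le_mul_of_pos_left _ hn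
  refine ⟨N₁ + N₂, D, Nat.factorial_pos _, by omega, ?_⟩
  have k₁ := pow_le_mul_of_le h₁ (N' := n * (N₁ + N₂)) (by omega) h₁'
  have k₂ := pow_le_mul_of_le h₂ (N' := n * (N₁ + N₂)) (by omega) h₂'
  rw [mul_comm]
  have hmem : b ^ (N₁ + N₂) ∈
      (linearForms J.toSubmodule ^ (n * (N₁ + N₂) - D) *
        linearForms (⊥ : Submodule ℂ W) ^ (n * (N₁ + N₂) - D)) *
      ((linearForms J.toSubmodule ^ D ⊓ Subalgebra.toSubmodule (invariantFunctions ρ)) *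
        invariantForms ρ D) := by
    have h3 := Submodule.pow_mem_pow _ hb.1 (N₁ + N₂)
    rw [homogeneousFunctions, mul_pow, ← pow_mul, ← pow_mul] at h3
    have h4 := mul_le_mul' k₁ k₂ h3
    rw [mul_mul_mul_comm, mul_comm] at h4
    exact h4
  refine mem_mul_of_mem_fixedFunctions (α := setAction ρ)
    (((isStable_linearForms J).pow _).mul (isStable_linearForms_bot.pow _)) ?_ hmem
    ((fixedFunctions (setAction ρ)).pow_mem hb.2 _)
  rw [Submodule.mul_le]
  exact fun x hx y hy => mul_mem (S := Subalgebra ℂ (W → ℂ)) hx.2 hy.2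

/-- A point outside all these open sets is a prime containing every product `f * h`. By
`exists_pow_mem_blowup` it would contain everything of positive degree. -/
lemma iSup_projectionPair :
    ⨆ i : {x : (Σ _ : ℕ, (I.toSubmodule → ℂ) × (W → ℂ)) // 0 < x.1 ∧
        x.2.1 ∈ invariantForms I.toRepresentation x.1 ∧ x.2.2 ∈ invariantForms ρ x.1},
      Proj.basicOpen (sectionGrading (blowupForms J)) (homElem (blowupForms J) _
        (pullbackFn_mul_mem I J hIJ i.2.2.1 i.2.2.2)) = ⊤ := by
  refine top_le_iff.mp fun x _ => TopologicalSpace.Opens.mem_iSup.mpr ?_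
  by_contra! H
  simp only [Proj.mem_basicOpen, not_not] at H
  refine x.not_irrelevant_le ((HomogeneousIdeal.irrelevant_le _).mpr fun n hn z hz => ?_)
  have hz' := homElem_coeff (blowupForms J) hz
  have hb := z.2 n
  rw [← hz']
  set b := (z : (W → ℂ)[X]).coeff n
  obtain ⟨N, D, hD, hDN, h⟩ := exists_pow_mem_blowup J hn hb
  refine x.isPrime.mem_of_pow_mem N ?_
  rw [← homElem_pow]
  suffices key : ∀ y, y ∈ ((linearForms J.toSubmodule ^ D ⊓
      Subalgebra.toSubmodule (invariantFunctions ρ)) *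
        invariantForms ρ D) * blowupForms J (n * N - D) →
      ∃ hy : y ∈ blowupForms J (D + (n * N - D)),
        homElem (blowupForms J) y hy ∈ x.asHomogeneousIdeal by
    obtain ⟨hy, hy'⟩ := key _ h
    convert! hy' using 1
    exact homElem_congr _ (by rw [Nat.add_sub_cancel' hDN, smul_eq_mul, mul_comm]) rfl _ _
  have hadd : ∀ {k} {y y' : W → ℂ}, (∃ hy : y ∈ blowupForms J k,
      homElem (blowupForms J) y hy ∈ x.asHomogeneousIdeal) → (∃ hy : y' ∈ blowupForms J k,
      homElem (blowupForms J) y' hy ∈ x.asHomogeneousIdeal) →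
      ∃ hy : y + y' ∈ blowupForms J k, homElem (blowupForms J) _ hy ∈ x.asHomogeneousIdeal := by
    rintro k y y' ⟨h1, h1'⟩ ⟨h2, h2'⟩
    refine ⟨add_mem h1 h2, ?_⟩
    convert! add_mem h1' h2' using 1
    exact Subtype.ext (map_add (monomial k) y y')
  intro y hy
  induction hy using Submodule.mul_induction_on' with
  | add y _ y' _ h1 h2 => exact hadd h1 h2
  | mem_mul_mem u hu v hv =>
    induction hu using Submodule.mul_induction_on' with
    | add y _ y' _ h1 h2 =>
      rw [add_mul]
      exact hadd h1 h2
    | mem_mul_mem p hp q hq =>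
      obtain ⟨f, hf, rfl⟩ := exists_invariant_pullbackFn_eq I J hIJ hp.1 hp.2
      refine ⟨SetLike.mul_mem_graded (pullbackFn_mul_mem I J hIJ hf hq) hv, ?_⟩
      rw [homElem_mul _ (pullbackFn_mul_mem I J hIJ hf hq) hv]
      exact Ideal.mul_mem_right _ _ (H ⟨⟨D, f, q⟩, hD, hf, hq⟩)

lemma iSup_compatiblePair_projection :
    ⨆ i : CompatiblePair (blowupForms J) (invariantForms I.toRepresentation)
        (I.toSubmodule.projectionOnto J.toSubmodule hIJ),
      Proj.basicOpen (sectionGrading (blowupForms J)) (homElem (blowupForms J) i.c i.hc) = ⊤ := by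
  rw [eq_top_iff, ← iSup_projectionPair I J hIJ]
  exact iSup_le fun i => le_iSup_of_le (projectionPair I J hIJ i.2.1 i.2.2.1 i.2.2.2) le_rfl

/-- The morphism of quotients induced by the projection from `ℙ(J)`. -/
def projectionMap : blowupQuotient J ⟶ subQuotient I :=
  inducedMap (iSup_compatiblePair_projection I J hIJ)

lemma isInducedByProjection_projectionMap :
    IsInducedByProjection I J hIJ (projectionMap I J hIJ) := by
  intro d hd f hf h hh
  let i := projectionPair I J hIJ hd hf hh
  refine ⟨i.compat.hom, fun k a ha => ?_, i.ι_inducedMap (iSup_compatiblePair_projection I J hIJ)⟩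
  refine evalFrac_ext i.hc fun x => ?_
  refine (i.compat.evalFrac_hom _ x).trans ?_
  refine (evalFrac_frac hf k a ha _).trans (Eq.trans ?_ (evalFrac_frac i.hc k _ _ x).symm)
  have h1 : pullbackFn I J hIJ f x.1 ≠ 0 := left_ne_zero_of_mul x.2
  have h2 : h x.1 ≠ 0 := right_ne_zero_of_mul x.2
  change pullbackFn I J hIJ a x.1 / pullbackFn I J hIJ f x.1 ^ k =
    (pullbackFn I J hIJ a x.1 * h x.1 ^ k) / (pullbackFn I J hIJ f x.1 * h x.1) ^ k
  rw [mul_pow]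
  field_simp

end Projection


/-! ### Frames: invariant coordinates on the fibres of the projection -/

variable {G : Type} [Group G] {W : Type} [AddCommGroup W] [Module ℂ W] {ρ : Representation ℂ G W}

/-- Invariant forms `f₁, f₂` on `I` of consecutive degrees and invariant functions `φ i` on `W`,
of degree `1` along `J`, which are coordinates on the fibres of the projection to `I` away from
the zero set of an invariant form `D`. -/
structure Frame (I J : Subrepresentation ρ) (hIJ : IsCompl I.toSubmodule J.toSubmodule)
    (r : ℕ) where
  e : ℕ
  q : ℕ
  δ : ℕ
  f₁ : I.toSubmodule → ℂ
  f₂ : I.toSubmodule → ℂ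
  D : I.toSubmodule → ℂ
  φ : Fin r → W → ℂ
  f₁_mem : f₁ ∈ invariantForms I.toRepresentation (e + 1)
  f₂_mem : f₂ ∈ invariantForms I.toRepresentation e
  D_mem : D ∈ invariantForms I.toRepresentation q
  φ_mem : ∀ i, φ i ∈ linearForms J.toSubmodule ^ δ * homogeneousFunctions W 1
  φ_inv : ∀ i, φ i ∈ invariantFunctions ρ
  le : δ ≤ q
  cramer : ∀ l ∈ linearForms I.toSubmodule, ∃ N : Fin r → W → ℂ,
    (∀ i, N i ∈ linearForms J.toSubmodule ^ (q - δ)) ∧ pullbackFn I J hIJ D * l = ∑ i, N i * φ i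
  surj : ∀ v : I.toSubmodule, D v ≠ 0 → ∀ z : Fin r → ℂ, ∃ w : W,
    I.toSubmodule.projectionOnto J.toSubmodule hIJ w = v ∧ ∀ i, φ i w = z i
  exists_ne_zero : ∃ v, f₁ v * f₂ v * D v ≠ 0

namespace Frame

variable {I J : Subrepresentation ρ} {hIJ : IsCompl I.toSubmodule J.toSubmodule} {r : ℕ}
  (F : Frame I J hIJ r)

/-- The degree of the form `f`. -/
def d : ℕ := F.e + 1 + F.e + F.q

lemma d_pos : 0 < F.d := by
  simp only [d]
  omega

/-- The product `f₁ f₂ D`. -/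
def f : I.toSubmodule → ℂ := F.f₁ * F.f₂ * F.D

lemma f_mem : F.f ∈ invariantForms I.toRepresentation F.d :=
  SetLike.mul_mem_graded (SetLike.mul_mem_graded F.f₁_mem F.f₂_mem) F.D_mem

/-- The open subset of `W` where `f` does not vanish. -/
abbrev Dom : Type := {w : W // F.f (I.toSubmodule.projectionOnto J.toSubmodule hIJ w) ≠ 0}

/-- The projection to `I`. -/
def proj (w : F.Dom) : I.toSubmodule := I.toSubmodule.projectionOnto J.toSubmodule hIJ w.1

lemma f_ne_zero (w : F.Dom) : F.f (F.proj w) ≠ 0 := w.2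

lemma f_proj (w : F.Dom) :
    F.f (F.proj w) = F.f₁ (F.proj w) * F.f₂ (F.proj w) * F.D (F.proj w) := rfl

lemma f₁_ne_zero (w : F.Dom) : F.f₁ (F.proj w) ≠ 0 :=
  left_ne_zero_of_mul (left_ne_zero_of_mul (F.f_ne_zero w))

lemma f₂_ne_zero (w : F.Dom) : F.f₂ (F.proj w) ≠ 0 :=
  right_ne_zero_of_mul (left_ne_zero_of_mul (F.f_ne_zero w))

lemma D_ne_zero (w : F.Dom) : F.D (F.proj w) ≠ 0 := right_ne_zero_of_mul (F.f_ne_zero w)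

/-- The action on the open subset. -/
def action : G →* Function.End F.Dom where
  toFun g w := ⟨ρ g w.1, by
    rw [projectionOnto_apply_rho]
    exact fun h => w.2 ((F.f_mem.2 g _).symm.trans h)⟩
  map_one' := by
    funext w
    exact Subtype.ext (congrArg (fun L : W →ₗ[ℂ] W => L w.1) (map_one ρ))
  map_mul' g h := by
    funext w
    exact Subtype.ext (congrArg (fun L : W →ₗ[ℂ] W => L w.1) (map_mul ρ g h))

lemma proj_action (g : G) (w : F.Dom) : F.proj (F.action g w) = I.toRepresentation g (F.proj w) :=
  projectionOnto_apply_rho I J hIJ g w.1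

lemma invariant_proj_action {n : ℕ} {a : I.toSubmodule → ℂ}
    (ha : a ∈ invariantForms I.toRepresentation n) (g : G) (w : F.Dom) :
    a (F.proj (F.action g w)) = a (F.proj w) := by
  rw [proj_action, ha.2]

/-- Restriction of functions. -/
def res : (W → ℂ) →ₐ[ℂ] (F.Dom → ℂ) where
  toFun x w := x w.1
  map_one' := rfl
  map_mul' _ _ := rfl
  map_zero' := rfl
  map_add' _ _ := rfl
  commutes' _ := rfl

lemma res_apply (x : W → ℂ) (w : F.Dom) : F.res x w = x w.1 := rfl

/-- Functions which are of degree `n`, with denominators powers of `f` of degree zero. -/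
def fracForms (n : ℕ) : Submodule ℂ (F.Dom → ℂ) where
  -- The `k * d` forms vanishing on `J` offset the degree of `f ^ k`. These are thus the sections of
  -- `𝒪(nH)` on the part of the blow-up over `{f ≠ 0}`.
  carrier := {x | ∃ k, ∃ g ∈ linearForms J.toSubmodule ^ (k * F.d) * homogeneousFunctions W n,
    ∀ w : F.Dom, x w * F.f (F.proj w) ^ k = g w.1}
  zero_mem' := ⟨0, 0, zero_mem _, fun w => by simp⟩
  add_mem' := by
    rintro x y ⟨k, g, hg, hx⟩ ⟨k', g', hg', hy⟩
    have hf : ∀ j, pullbackFn I J hIJ F.f ^ j ∈ linearForms J.toSubmodule ^ (j * F.d) := fun j => by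
      rw [mul_comm, pow_mul]
      exact Submodule.pow_mem_pow _ (pullbackFn_mem_pow I J hIJ F.f_mem.1) j
    refine ⟨k + k', pullbackFn I J hIJ F.f ^ k' * g + pullbackFn I J hIJ F.f ^ k * g',
      add_mem ?_ ?_, fun w => ?_⟩
    · have := Submodule.mul_mem_mul (hf k') hg
      rwa [← mul_assoc, ← pow_add, ← add_mul, add_comm k'] at this
    · have := Submodule.mul_mem_mul (hf k) hg'
      rwa [← mul_assoc, ← pow_add, ← add_mul] at this
    · have e1 := hx w
      have e2 := hy w
      change (x w + y w) * _ = F.f (F.proj w) ^ k' * g w.1 + F.f (F.proj w) ^ k * g' w.1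
      rw [← e1, ← e2]
      ring
  smul_mem' := by
    rintro c x ⟨k, g, hg, hx⟩
    refine ⟨k, c • g, Submodule.smul_mem _ c hg, fun w => ?_⟩
    simp only [Pi.smul_apply, smul_eq_mul, mul_assoc, hx w]

lemma res_mem_fracForms {n : ℕ} {g : W → ℂ} (hg : g ∈ homogeneousFunctions W n) :
    F.res g ∈ F.fracForms n :=
  ⟨0, g, by simpa using hg, fun w => by simp [res_apply]⟩

lemma mul_mem_fracForms {m n : ℕ} {x y : F.Dom → ℂ} (hx : x ∈ F.fracForms m)
    (hy : y ∈ F.fracForms n) : x * y ∈ F.fracForms (m + n) := by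
  obtain ⟨k, g, hg, hx⟩ := hx
  obtain ⟨k', g', hg', hy⟩ := hy
  refine ⟨k + k', g * g', ?_, fun w => ?_⟩
  · have := Submodule.mul_mem_mul hg hg'
    rwa [mul_mul_mul_comm, ← pow_add, ← add_mul, homogeneousFunctions, homogeneousFunctions,
      ← pow_add] at this
  · have e1 := hx w
    have e2 := hy w
    simp only [Pi.mul_apply]
    rw [← e1, ← e2]
    ring

lemma one_mem_fracForms : (1 : F.Dom → ℂ) ∈ F.fracForms 0 := by
  have := F.res_mem_fracForms (n := 0) (g := 1) (by
    rw [homogeneousFunctions, pow_zero]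
    exact Submodule.one_le.mp le_rfl)
  rwa [map_one] at this

lemma isStable_fracForms (n : ℕ) : IsStable F.action (F.fracForms n) := by
  rintro g x ⟨k, a, ha, hx⟩
  refine ⟨k, compAction (setAction ρ) g a,
    (((isStable_linearForms J).pow _).mul (isStable_linearForms_bot.pow _)) g a ha, fun w => ?_⟩
  have e1 := hx (F.action g w)
  rw [F.invariant_proj_action F.f_mem] at e1
  exact e1

/-- The invariants of degree `n`, with denominators powers of `f` of degree zero. -/
def invFracForms (n : ℕ) : Submodule ℂ (F.Dom → ℂ) :=
  F.fracForms n ⊓ Subalgebra.toSubmodule (fixedFunctions F.action)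

instance invFracForms_gradedMonoid : SetLike.GradedMonoid F.invFracForms where
  one_mem := ⟨F.one_mem_fracForms, one_mem (fixedFunctions F.action)⟩
  mul_mem _ _ _ _ hx hy := ⟨F.mul_mem_fracForms hx.1 hy.1,
    mul_mem (S := Subalgebra ℂ (F.Dom → ℂ)) hx.2 hy.2⟩

/-- The quotient `f₁ / f₂`, an invariant of degree one. -/
def t : F.Dom → ℂ := fun w => F.f₁ (F.proj w) / F.f₂ (F.proj w)

lemma t_ne_zero (w : F.Dom) : F.t w ≠ 0 := div_ne_zero (F.f₁_ne_zero w) (F.f₂_ne_zero w)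

lemma linearForms_le : linearForms J.toSubmodule ≤ linearForms (⊥ : Submodule ℂ W) :=
  linearForms_mono bot_le

lemma pullbackFn_pow_mem {n : ℕ} {a : I.toSubmodule → ℂ}
    (ha : a ∈ invariantForms I.toRepresentation n) (k : ℕ) :
    pullbackFn I J hIJ a ^ k ∈ linearForms J.toSubmodule ^ (n * k) :=
  Submodule.pow_mem_pow_pow (pullbackFn_mem_pow I J hIJ ha.1) k

lemma t_mem : F.t ∈ F.invFracForms 1 := by
  -- `t = f₁² D / f`, and `f₁² D` has degree `d + 1`.
  refine ⟨⟨1, pullbackFn I J hIJ F.f₁ ^ 2 * pullbackFn I J hIJ F.D ^ 1, ?_, fun w => ?_⟩,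
    fun g w => ?_⟩
  · have h := Submodule.mul_mem_mul (pullbackFn_pow_mem (hIJ := hIJ) F.f₁_mem 2)
      (pullbackFn_pow_mem (hIJ := hIJ) F.D_mem 1)
    rw [← pow_add, show (F.e + 1) * 2 + F.q * 1 = 1 * F.d + 1 by simp only [d]; ring, pow_add,
      pow_one] at h
    rw [homogeneousFunctions, pow_one]
    exact mul_le_mul' le_rfl linearForms_le h
  · change F.f₁ (F.proj w) / F.f₂ (F.proj w) * F.f (F.proj w) ^ 1 =
      F.f₁ (F.proj w) ^ 2 * F.D (F.proj w) ^ 1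
    have := F.f₂_ne_zero w
    rw [F.f_proj]
    field_simp
  · simp only [t, F.invariant_proj_action F.f₁_mem, F.invariant_proj_action F.f₂_mem]

/-- A form of degree `n` on `I`, divided by `t ^ n`. -/
lemma res_div_t_mem {n : ℕ} {a : W → ℂ} (ha : a ∈ linearForms J.toSubmodule ^ n) :
    F.res a * F.t⁻¹ ^ n ∈ F.fracForms 0 := by
  -- `a / t ^ n = a f₂ ^ (2 n) D ^ n / f ^ n`.
  refine ⟨n, a * (pullbackFn I J hIJ F.f₂ ^ (2 * n) * pullbackFn I J hIJ F.D ^ n), ?_, fun w => ?_⟩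
  · have h := Submodule.mul_mem_mul ha (Submodule.mul_mem_mul
      (pullbackFn_pow_mem (hIJ := hIJ) F.f₂_mem (2 * n))
      (pullbackFn_pow_mem (hIJ := hIJ) F.D_mem n))
    rw [← pow_add, ← pow_add,
      show n + (F.e * (2 * n) + F.q * n) = n * F.d by simp only [d]; ring] at h
    rwa [homogeneousFunctions, pow_zero, mul_one]
  · change a w.1 * (F.f₁ (F.proj w) / F.f₂ (F.proj w))⁻¹ ^ n * F.f (F.proj w) ^ n =
      a w.1 * (F.f₂ (F.proj w) ^ (2 * n) * F.D (F.proj w) ^ n)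
    have h1 := F.f₁_ne_zero w
    have h2 := F.f₂_ne_zero w
    rw [F.f_proj, inv_div, div_pow, mul_pow, mul_pow]
    field_simp
    ring

/-- The fibre coordinates, made of degree one. -/
def y (i : Fin r) : F.Dom → ℂ := F.res (F.φ i) * F.t⁻¹ ^ F.δ

lemma t_inv (g : G) (w : F.Dom) : F.t (F.action g w) = F.t w := F.t_mem.2 g w

lemma y_mem (i : Fin r) : F.y i ∈ F.invFracForms 1 := by
  refine ⟨?_, fun g w => ?_⟩
  · refine Submodule.mul_induction_on (C := fun x => F.res x * F.t⁻¹ ^ F.δ ∈ F.fracForms 1)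
      (F.φ_mem i) (fun a ha b hb => ?_) (fun a b ha hb => ?_)
    · have := F.mul_mem_fracForms (F.res_div_t_mem ha) (F.res_mem_fracForms hb)
      rw [map_mul, mul_right_comm]
      simpa using this
    · rw [map_add, add_mul]
      exact add_mem ha hb
  · change F.φ i (ρ g w.1) * (F.t (F.action g w))⁻¹ ^ F.δ = F.φ i w.1 * (F.t w)⁻¹ ^ F.δ
    rw [F.t_inv, F.φ_inv]

/-- Homogeneous fibre coordinates. -/
def Y : Fin (r + 1) → F.Dom → ℂ := Fin.cons F.t F.y

lemma Y_mem (i : Fin (r + 1)) : F.Y i ∈ F.invFracForms 1 := by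
  refine Fin.cases F.t_mem F.y_mem i

/-- The span of the homogeneous fibre coordinates. -/
def coordSpan : Submodule ℂ (F.Dom → ℂ) := Submodule.span ℂ (Set.range F.Y)

lemma coordSpan_le : F.coordSpan ≤ F.invFracForms 1 := by
  rw [coordSpan, Submodule.span_le]
  rintro _ ⟨i, rfl⟩
  exact F.Y_mem i

lemma coordSpan_pow_le (n : ℕ) :
    F.coordSpan ^ n ≤ Subalgebra.toSubmodule (fixedFunctions F.action) := by
  induction n with
  | zero =>
    rw [pow_zero]
    exact Submodule.one_le.mpr (one_mem (fixedFunctions F.action))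
  | succ n ih =>
    rw [pow_succ, Submodule.mul_le]
    exact fun x hx y hy => mul_mem (S := Subalgebra ℂ (F.Dom → ℂ)) (ih hx) (F.coordSpan_le hy).2

lemma t_mem_coordSpan : F.t ∈ F.coordSpan := Submodule.subset_span ⟨0, rfl⟩

lemma y_mem_coordSpan (i : Fin r) : F.y i ∈ F.coordSpan := Submodule.subset_span ⟨i.succ, rfl⟩

lemma linearForms_bot_le (hIJ : IsCompl I.toSubmodule J.toSubmodule) :
    linearForms (⊥ : Submodule ℂ W) ≤
    linearForms J.toSubmodule ⊔ linearForms I.toSubmodule := by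
  rw [linearForms, linearForms, linearForms, ← Submodule.map_sup]
  refine Submodule.map_mono fun l _ => ?_
  have h : l = (l.comp (I.toSubmodule.projection J.toSubmodule hIJ)) +
      (l.comp (J.toSubmodule.projection I.toSubmodule hIJ.symm)) := by
    ext w
    rw [LinearMap.add_apply, LinearMap.comp_apply, LinearMap.comp_apply, ← map_add,
      Submodule.projection_add_projection_eq_self hIJ]
  rw [h]
  refine Submodule.add_mem_sup ?_ ?_
  · rw [Submodule.mem_dualAnnihilator]
    intro w hw
    rw [LinearMap.comp_apply, (Submodule.projection_apply_eq_zero_iff hIJ).mpr hw, map_zero]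
  · rw [Submodule.mem_dualAnnihilator]
    intro w hw
    rw [LinearMap.comp_apply, (Submodule.projection_apply_eq_zero_iff hIJ.symm).mpr hw, map_zero]

/-- A linear form splits into a part `a` vanishing on `J` and a part `b` vanishing on `I`. The first
is `(a / t) t`, and Cramer's rule expresses the second through the `yᵢ`. -/
lemma res_mem_mul {l : W → ℂ} (hl : l ∈ homogeneousFunctions W 1) :
    F.res l ∈ F.fracForms 0 * F.coordSpan := by
  rw [homogeneousFunctions, pow_one] at hl
  obtain ⟨a, ha, b, hb, rfl⟩ := Submodule.mem_sup.mp (linearForms_bot_le hIJ hl)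
  rw [map_add]
  refine add_mem ?_ ?_
  · have h := Submodule.mul_mem_mul (F.res_div_t_mem (n := 1) (by rwa [pow_one])) F.t_mem_coordSpan
    convert! h using 1
    funext w
    have := F.t_ne_zero w
    simp only [Pi.mul_apply, Pi.inv_apply, pow_one]
    field_simp
  · obtain ⟨N, hN, e⟩ := F.cramer b hb
    -- The coefficient is `Nᵢ t ^ δ / D`. The power of `t` undoes the one in `yᵢ`, and the degree is
    -- `(q - δ) + δ - q = 0`.
    let c : Fin r → F.Dom → ℂ := fun i w => N i w.1 * F.f₁ (F.proj w) ^ F.δ /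
      (F.f₂ (F.proj w) ^ F.δ * F.D (F.proj w))
    have hc : ∀ i, c i ∈ F.fracForms 0 := fun i => by
      refine ⟨F.δ + 1, N i * (pullbackFn I J hIJ F.f₁ ^ (2 * F.δ + 1) *
        (pullbackFn I J hIJ F.f₂ ^ 1 * pullbackFn I J hIJ F.D ^ F.δ)), ?_, fun w => ?_⟩
      · have h := Submodule.mul_mem_mul (hN i) (Submodule.mul_mem_mul
          (pullbackFn_pow_mem (hIJ := hIJ) F.f₁_mem (2 * F.δ + 1)) (Submodule.mul_mem_mul
          (pullbackFn_pow_mem (hIJ := hIJ) F.f₂_mem 1)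
          (pullbackFn_pow_mem (hIJ := hIJ) F.D_mem F.δ)))
        rw [← pow_add, ← pow_add, ← pow_add] at h
        rw [homogeneousFunctions, pow_zero, mul_one]
        convert! h using 2
        simp only [d]
        zify [F.le]
        ring
      · change N i w.1 * F.f₁ (F.proj w) ^ F.δ / (F.f₂ (F.proj w) ^ F.δ * F.D (F.proj w)) *
          F.f (F.proj w) ^ (F.δ + 1) = N i w.1 * (F.f₁ (F.proj w) ^ (2 * F.δ + 1) *
            (F.f₂ (F.proj w) ^ 1 * F.D (F.proj w) ^ F.δ))
        have h2 := F.f₂_ne_zero w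
        have h3 := F.D_ne_zero w
        rw [F.f_proj]
        field_simp
        ring
    have hb' : F.res b = ∑ i, c i * F.y i := by
      funext w
      have e1 := congrFun e w.1
      simp only [Pi.mul_apply, Finset.sum_apply] at e1 ⊢
      have h1 := F.f₁_ne_zero w
      have h2 := F.f₂_ne_zero w
      have h3 := F.D_ne_zero w
      have e2 : ∀ i, c i w * F.y i w = N i w.1 * F.φ i w.1 / F.D (F.proj w) := fun i => by
        change N i w.1 * F.f₁ (F.proj w) ^ F.δ / (F.f₂ (F.proj w) ^ F.δ * F.D (F.proj w)) *
          (F.φ i w.1 * (F.f₁ (F.proj w) / F.f₂ (F.proj w))⁻¹ ^ F.δ) = _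
        rw [inv_div, div_pow]
        field_simp
      rw [Finset.sum_congr rfl fun i _ => e2 i, ← Finset.sum_div, ← e1, res_apply]
      exact (mul_div_cancel_left₀ _ h3).symm
    rw [hb']
    exact Submodule.sum_mem _ fun i _ => Submodule.mul_mem_mul (hc i) (F.y_mem_coordSpan i)

lemma fracForms_zero_mul_self : F.fracForms 0 * F.fracForms 0 ≤ F.fracForms 0 := by
  rw [Submodule.mul_le]
  intro x hx y hy
  have h := F.mul_mem_fracForms hx hy
  rwa [add_zero] at h

lemma fracForms_zero_pow_le (n : ℕ) : F.fracForms 0 ^ n ≤ F.fracForms 0 := by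
  induction n with
  | zero =>
    rw [pow_zero]
    exact Submodule.one_le.mpr F.one_mem_fracForms
  | succ n ih =>
    rw [pow_succ]
    exact (mul_le_mul' ih le_rfl).trans F.fracForms_zero_mul_self

lemma fracForms_le (n : ℕ) : F.fracForms n ≤ F.fracForms 0 * F.coordSpan ^ n := by
  rintro x ⟨k, g, hg, hx⟩
  have hx' : x = F.res g * fun w => (F.f (F.proj w) ^ k)⁻¹ := by
    funext w
    have := F.f_ne_zero w
    rw [Pi.mul_apply, res_apply, ← hx w]
    field_simp
  rw [hx']
  clear hx hx'
  induction hg using Submodule.mul_induction_on' with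
  | add a _ b _ ha hb =>
    rw [map_add, add_mul]
    exact add_mem ha hb
  | mem_mul_mem a ha b hb =>
    have h1 : (F.res a * fun w => (F.f (F.proj w) ^ k)⁻¹) ∈ F.fracForms 0 := by
      refine ⟨k, a, by simpa [homogeneousFunctions] using ha, fun w => ?_⟩
      have := F.f_ne_zero w
      simp only [Pi.mul_apply, res_apply]
      field_simp
    have h2 : F.res b ∈ (F.fracForms 0 * F.coordSpan) ^ n := by
      have h3 : F.res b ∈ (homogeneousFunctions W n).map F.res.toLinearMap := ⟨b, hb, rfl⟩
      rw [homogeneousFunctions, Submodule.map_pow] at h3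
      have h4 : (linearForms (⊥ : Submodule ℂ W)).map F.res.toLinearMap ≤
          F.fracForms 0 * F.coordSpan := by
        rintro _ ⟨l, hl, rfl⟩
        exact F.res_mem_mul (by rwa [homogeneousFunctions, pow_one])
      exact pow_le_pow_left' h4 n h3
    have h4 := Submodule.mul_mem_mul h1 h2
    rw [mul_pow, ← mul_assoc] at h4
    rw [map_mul, mul_right_comm]
    exact mul_le_mul' ((mul_le_mul' le_rfl (F.fracForms_zero_pow_le n)).trans
      F.fracForms_zero_mul_self) le_rfl h4

lemma coordSpan_pow_le_invFracForms (n : ℕ) : F.coordSpan ^ n ≤ F.invFracForms n := by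
  induction n with
  | zero =>
    rw [pow_zero]
    exact Submodule.one_le.mpr (SetLike.one_mem_graded F.invFracForms)
  | succ n ih =>
    rw [pow_succ, Submodule.mul_le]
    exact fun x hx y hy => SetLike.mul_mem_graded (ih hx) (F.coordSpan_le hy)

/-- The invariants of degree `n` are homogeneous polynomials in the fibre coordinates, with
coefficients invariants of degree zero. -/
lemma invFracForms_eq [Fintype G] (n : ℕ) :
    F.invFracForms n = F.invFracForms 0 * F.coordSpan ^ n := by
  refine le_antisymm (fun x hx => ?_) ?_
  -- Only the coefficients have to be averaged, the fibre coordinates being invariant already.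
  · exact mem_mul_of_mem_fixedFunctions (F.isStable_fracForms 0) (F.coordSpan_pow_le n)
      (F.fracForms_le n hx.1) hx.2
  · rw [Submodule.mul_le]
    intro x hx y hy
    simpa using SetLike.mul_mem_graded (A := F.invFracForms) hx
      (F.coordSpan_pow_le_invFracForms n hy)

end Frame


/-! ### Recognizing pullbacks along open immersions -/

section OpenImmersions

lemma isIso_morphismRestrict_opensRange {X Y A B : Scheme} (Ψ : X ⟶ Y) (i : A ⟶ X) (j : B ⟶ Y)
    [IsOpenImmersion i] [IsOpenImmersion j] (θ : A ⟶ B) [IsIso θ] (w : i ≫ Ψ = θ ≫ j)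
    (h : Ψ ⁻¹ᵁ j.opensRange = i.opensRange) : IsIso (Ψ ∣_ j.opensRange) := by
  have h1 : IsPullback i θ Ψ j := (IsOpenImmersion.isPullback _ _ _ _ w h).flip
  have h2 := (isPullback_morphismRestrict Ψ j.opensRange).flip
  let k := IsOpenImmersion.lift j j.opensRange.ι (by
    rw [← Scheme.Hom.coe_opensRange, Scheme.Opens.opensRange_ι, Scheme.Hom.coe_opensRange])
  have hk : k ≫ j = j.opensRange.ι := IsOpenImmersion.lift_fac _ _ _
  let l := h1.lift (Ψ ⁻¹ᵁ j.opensRange).ι ((Ψ ∣_ j.opensRange) ≫ k) (by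
    rw [Category.assoc, hk]
    exact h2.w)
  have hl : l ≫ i = (Ψ ⁻¹ᵁ j.opensRange).ι := h1.lift_fst _ _ _
  have h4 : IsPullback (l ≫ i) (Ψ ∣_ j.opensRange) Ψ (k ≫ j) := by
    rw [hl, hk]
    exact h2
  have h5 := IsPullback.of_right h4 (h1.lift_snd _ _ _) h1
  exact h5.isIso_snd_of_isIso

lemma isIso_morphismRestrict_of_le {X Y : Scheme} (f : X ⟶ Y) [IsOpenImmersion f] (D : Y.Opens)
    (hD : D ≤ f.opensRange) : IsIso (f ∣_ D) := by
  have h2 := (isPullback_morphismRestrict f D).flip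
  let k := IsOpenImmersion.lift f D.ι (by
    rw [← Scheme.Hom.coe_opensRange, Scheme.Opens.opensRange_ι, ← Scheme.Hom.coe_opensRange]
    exact hD)
  have hk : k ≫ f = D.ι := IsOpenImmersion.lift_fac _ _ _
  have : IsSplitEpi (f ∣_ D) :=
    ⟨⟨h2.lift k (𝟙 _) (by rw [hk, Category.id_comp]), h2.lift_snd _ _ _⟩⟩
  exact isIso_of_mono_of_isSplitEpi _

lemma isIso_of_isIso_morphismRestrict {Z T P : Scheme} (u : Z ⟶ T) (f : T ⟶ P) [IsOpenImmersion f]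
    {κ : Type} (D : κ → P.Opens) (hD : ⨆ k, D k = f.opensRange)
    (h : ∀ k, IsIso ((u ≫ f) ∣_ D k)) : IsIso u := by
  have hU : ⨆ k, f ⁻¹ᵁ D k = ⊤ := by
    rw [← Scheme.Hom.preimage_iSup, hD, Scheme.Hom.preimage_opensRange]
  refine (IsZariskiLocalAtTarget.iff_of_iSup_eq_top (P := MorphismProperty.isomorphisms Scheme)
    _ hU).mpr fun k => ?_
  have h1 := isIso_morphismRestrict_of_le f (D k) ((le_iSup D k).trans hD.le)
  have h3 : IsIso ((u ∣_ (f ⁻¹ᵁ D k)) ≫ (f ∣_ D k)) := morphismRestrict_comp u f (D k) ▸ h k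
  exact IsIso.of_isIso_comp_right _ (f ∣_ D k)

/-- The comparison map to the fibre product becomes `Ψ` after the open immersion onto the preimage
of the range of `a`. It is thus an isomorphism as soon as `Ψ` is one over a cover of that preimage.
-/
lemma isPullback_of_isIso_morphismRestrict {Z P T S : Scheme} {Ψ : Z ⟶ P} {r : Z ⟶ T} {p : P ⟶ S}
    {a : T ⟶ S} [IsOpenImmersion a] (w : Ψ ≫ p = r ≫ a) {κ : Type} (D : κ → P.Opens)
    (hD : ⨆ k, D k = p ⁻¹ᵁ a.opensRange) (h : ∀ k, IsIso (Ψ ∣_ D k)) : IsPullback Ψ r p a := by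
  have hu : pullback.lift Ψ r w ≫ pullback.fst p a = Ψ := pullback.lift_fst _ _ _
  have : IsIso (pullback.lift Ψ r w) := by
    refine isIso_of_isIso_morphismRestrict _ (pullback.fst p a) D ?_ fun k => ?_
    · rw [hD, Scheme.Hom.opensRange_pullbackFst]
    · rw [hu]
      exact h k
  exact IsPullback.of_iso_pullback ⟨w⟩ (asIso (pullback.lift Ψ r w)) (pullback.lift_fst _ _ _)
    (pullback.lift_snd _ _ _)

end OpenImmersions

lemma evalFrac_fromZeroRingHom {X : Type} {𝒮 : ℕ → Submodule ℂ (X → ℂ)} [SetLike.GradedMonoid 𝒮]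
    {d : ℕ} {f : X → ℂ} (hf : f ∈ 𝒮 d) (a : sectionGrading 𝒮 0) (x : {x // f x ≠ 0}) :
    evalFrac hf (HomogeneousLocalization.fromZeroRingHom (sectionGrading 𝒮)
      (Submonoid.powers (homElem 𝒮 f hf)) a) x = evalSection 𝒮 a.1 x := by
  refine (evalLocalization_mk hf 0 _ 1 (pow_zero _).symm x).trans ?_
  rw [pow_zero, div_one]

/-! ### The part of the blow-up quotient over `{f ≠ 0}` -/

section Cover

variable {G : Type} [Group G] {W : Type} [AddCommGroup W] [Module ℂ W]
  {ρ : Representation ℂ G W} {I J : Subrepresentation ρ}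
  {hIJ : IsCompl I.toSubmodule J.toSubmodule} {r : ℕ} (F : Frame I J hIJ r)

namespace Frame

/-- Invariant forms on `W` of positive degree divisible by `d`. -/
structure Index : Type where
  k : ℕ
  h : W → ℂ
  pos : 0 < k
  mem : h ∈ invariantForms ρ (k * F.d)

variable {F}

lemma Index.deg_pos (x : F.Index) : 0 < x.k * F.d := Nat.mul_pos x.pos F.d_pos

variable (F)

lemma res_mem_invFracForms {n : ℕ} {h : W → ℂ} (hh : h ∈ invariantForms ρ n) :
    F.res h ∈ F.invFracForms n := ⟨F.res_mem_fracForms hh.1, fun g w => hh.2 g w.1⟩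

lemma pow_f_mem (k : ℕ) : F.f ^ k ∈ invariantForms I.toRepresentation (k * F.d) :=
  SetLike.pow_mem_graded k F.f_mem

/-- The denominator in the ring of the blow-up. -/
def den (x : F.Index) : W → ℂ := pullbackFn I J hIJ (F.f ^ x.k) * x.h

lemma den_mem (x : F.Index) : F.den x ∈ blowupForms J (x.k * F.d) :=
  pullbackFn_mul_mem I J hIJ (F.pow_f_mem _) x.mem

lemma den_apply (x : F.Index) (w : W) : F.den x w =
    F.f (I.toSubmodule.projectionOnto J.toSubmodule hIJ w) ^ x.k * x.h w := rfl

lemma den_res (x : F.Index) (w : F.Dom) : F.den x w.1 = F.f (F.proj w) ^ x.k * F.res x.h w := rfl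

/-- The compatible pairs defining the morphism to the quotient of the blow-up. -/
def pair (x : F.Index) :
    CompatiblePair F.invFracForms (blowupForms J) (Subtype.val : F.Dom → W) where
  m := x.k * F.d
  d := x.k * F.d
  c := F.res x.h
  t := F.den x
  hm := x.deg_pos
  hd := x.deg_pos
  hc := F.res_mem_invFracForms x.mem
  ht := F.den_mem x
  compat :=
    { ne_zero := fun w hw => mul_ne_zero (pow_ne_zero _ (F.f_ne_zero w)) hw
      pullback := fun k a ha => by
        refine ⟨k, fun w => a w.1 / F.f (F.proj w) ^ (k * x.k),
          ⟨⟨k * x.k, a, ?_, fun w => ?_⟩, fun g w => ?_⟩, fun w hw => ?_⟩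
        · have := ha.1
          rwa [smul_eq_mul, ← mul_assoc] at this ⊢
        · exact div_mul_cancel₀ _ (pow_ne_zero _ (F.f_ne_zero w))
        · change a (ρ g w.1) / F.f (F.proj (F.action g w)) ^ _ = a w.1 / _
          rw [F.invariant_proj_action F.f_mem, ha.2]
        · rw [den_res, mul_pow, ← pow_mul, mul_comm k, div_div] }

/-- The pull-back of fractions along the morphism to the quotient of the blow-up. -/
def denHom (x : F.Index) : FracRing (blowupForms J) _ (F.den_mem x) →+*
    FracRing F.invFracForms _ (F.res_mem_invFracForms x.mem) := (F.pair x).compat.hom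

lemma evalFrac_denHom (x : F.Index) (z) (w : {w : F.Dom // F.res x.h w ≠ 0}) :
    evalFrac (F.res_mem_invFracForms x.mem) (F.denHom x z) w =
      evalFrac (F.den_mem x) z ⟨w.1.1, mul_ne_zero (pow_ne_zero _ (F.f_ne_zero w.1)) w.2⟩ :=
  (F.pair x).compat.evalFrac_hom z w

/-- Injectivity: since `k > 0`, the function `f ^ k h` is nonzero only where `f` and `h` both are,
so evaluation over `{f ≠ 0}` loses no point. Surjectivity: a fraction `s / h ^ L` hides a
denominator `f ^ m`, which is completed to a power of `f ^ k h`. -/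
lemma denHom_bijective (x : F.Index) : Function.Bijective (F.denHom x) := by
  constructor
  · intro z z' h
    refine evalFrac_ext (F.den_mem x) fun w => ?_
    have h1 : F.f (I.toSubmodule.projectionOnto J.toSubmodule hIJ w.1) ≠ 0 := fun h0 => w.2 (by
      rw [den_apply, h0, zero_pow x.pos.ne', zero_mul])
    have h2 : F.res x.h ⟨w.1, h1⟩ ≠ 0 := right_ne_zero_of_mul w.2
    have e1 := F.evalFrac_denHom x z ⟨⟨w.1, h1⟩, h2⟩
    have e2 := F.evalFrac_denHom x z' ⟨⟨w.1, h1⟩, h2⟩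
    rw [h, e2] at e1
    exact e1.symm
  · intro z
    obtain ⟨L, s, hs, rfl⟩ := exists_frac _ z
    obtain ⟨m, g, hg, e⟩ := hs.1
    have hk := x.pos
    obtain ⟨k, hk'⟩ := Nat.exists_eq_add_one_of_ne_zero hk.ne'
    -- With `m + j = k (L + m + 1)` the fraction `b / (f ^ k h) ^ (L + m + 1)` equals `s / h ^ L`.
    -- Also `j > 0`, so `b` vanishes where `f` does; the invariance of `g` is known only away from
    -- there.
    let j := x.k * (L + m + 1) - m
    have hj : m + j = x.k * (L + m + 1) := by
      have : L + m + 1 ≤ x.k * (L + m + 1) := Nat.le_mul_of_pos_left _ hk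
      omega
    have hj0 : j ≠ 0 := by
      have : L + m + 1 ≤ x.k * (L + m + 1) := Nat.le_mul_of_pos_left _ hk
      omega
    let b : W → ℂ := g * (pullbackFn I J hIJ (F.f ^ j) * x.h ^ (m + 1))
    have hb : b ∈ blowupForms J ((L + m + 1) • (x.k * F.d)) := by
      refine ⟨?_, fun σ w => ?_⟩
      · have h1 := Submodule.mul_mem_mul hg (Submodule.mul_mem_mul
          (pullbackFn_mem_pow I J hIJ (F.pow_f_mem j).1) (SetLike.pow_mem_graded (m + 1) x.mem).1)
        rw [mul_mul_mul_comm, ← pow_add, homogeneousFunctions, homogeneousFunctions, ← pow_add,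
          ← add_mul, hj] at h1
        have h2 : L • (x.k * F.d) + (m + 1) • (x.k * F.d) = (L + m + 1) • (x.k * F.d) := by
          rw [← add_smul, add_assoc]
        have h3 : (L + m + 1) • (x.k * F.d) = x.k * (L + m + 1) * F.d := by
          rw [smul_eq_mul]
          ring
        rw [h2, h3] at h1
        rw [h3]
        exact h1
      · have e1 := F.f_mem.2 σ (I.toSubmodule.projectionOnto J.toSubmodule hIJ w)
        rw [← projectionOnto_apply_rho] at e1
        have e2 := x.mem.2 σ w
        change g _ * (F.f _ ^ j * x.h _ ^ (m + 1)) = g _ * (F.f _ ^ j * x.h _ ^ (m + 1))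
        rw [e1, e2]
        by_cases h0 : F.f (I.toSubmodule.projectionOnto J.toSubmodule hIJ w) = 0
        · rw [h0, zero_pow hj0]
          simp
        · congr 1
          have e3 := e ⟨w, h0⟩
          have e4 := e (F.action σ ⟨w, h0⟩)
          rw [F.invariant_proj_action F.f_mem, hs.2] at e4
          exact e4.symm.trans e3
    refine ⟨frac (F.den_mem x) (L + m + 1) b hb, evalFrac_ext _ fun w => ?_⟩
    refine (F.evalFrac_denHom x _ w).trans ((evalFrac_frac _ _ _ _ _).trans
      (Eq.trans ?_ (evalFrac_frac _ _ _ _ _).symm))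
    change b w.1.1 / F.den x w.1.1 ^ (L + m + 1) = s w.1 / F.res x.h w.1 ^ L
    have h1 : F.res x.h w.1 ≠ 0 := w.2
    have h2 := F.f_ne_zero w.1
    have h3 : b w.1.1 = s w.1 * F.f (F.proj w.1) ^ m *
        (F.f (F.proj w.1) ^ j * F.res x.h w.1 ^ (m + 1)) := by
      rw [e]
      rfl
    rw [h3, den_res, mul_pow, ← pow_mul, ← hj]
    field_simp
    ring

instance (x : F.Index) : IsIso (Spec.map (CommRingCat.ofHom (F.denHom x))) := by
  have : IsIso (CommRingCat.ofHom (F.denHom x)) :=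
    (ConcreteCategory.isIso_iff_bijective _).mpr (F.denHom_bijective x)
  infer_instance

/-- The open subset of the quotient of the blow-up where a denominator does not vanish. -/
def denι (x : F.Index) : Spec (.of (FracRing (blowupForms J) _ (F.den_mem x))) ⟶ blowupQuotient J :=
  Proj.awayι (sectionGrading (blowupForms J)) _ (homElem_mem _ _ (F.den_mem x)) x.deg_pos

instance (x : F.Index) : IsOpenImmersion (F.denι x) :=
  inferInstanceAs (IsOpenImmersion (Proj.awayι (sectionGrading (blowupForms J)) _ _ _))

lemma opensRange_denι (x : F.Index) : (F.denι x).opensRange =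
    Proj.basicOpen (sectionGrading (blowupForms J)) (homElem (blowupForms J) _ (F.den_mem x)) :=
  Proj.opensRange_awayι _ _ _ _

/-- The quotient of the part of the blow-up where `f` does not vanish. -/
abbrev chart : Scheme := Proj (sectionGrading F.invFracForms)

/-- The affine open subset of `ℙ(I) // G` where `f` does not vanish. -/
def baseι : Spec (.of (FracRing (invariantForms I.toRepresentation) F.f F.f_mem)) ⟶ subQuotient I :=
  Proj.awayι (sectionGrading (invariantForms I.toRepresentation)) _ (homElem_mem _ _ F.f_mem)
    F.d_pos

instance : IsOpenImmersion F.baseι :=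
  inferInstanceAs (IsOpenImmersion (Proj.awayι (sectionGrading _) _ _ _))

lemma opensRange_baseι : F.baseι.opensRange =
    Proj.basicOpen (sectionGrading (invariantForms I.toRepresentation)) (homElem _ _ F.f_mem) :=
  Proj.opensRange_awayι _ _ _ _

/-- Fractions with denominator a power of `f`, as invariants of degree zero. -/
def baseHom : FracRing (invariantForms I.toRepresentation) F.f F.f_mem →+*
    sectionGrading F.invFracForms 0 where
  toFun z := ⟨homElem F.invFracForms (fun w => evalFrac F.f_mem z ⟨F.proj w, F.f_ne_zero w⟩) (by
    obtain ⟨k, a, ha, rfl⟩ := exists_frac F.f_mem z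
    simp only [evalFrac_frac]
    refine ⟨⟨k, pullbackFn I J hIJ a, ?_, fun w => ?_⟩, fun g w => ?_⟩
    · rw [homogeneousFunctions, pow_zero, mul_one]
      exact pullbackFn_mem_pow I J hIJ ha.1
    · exact div_mul_cancel₀ _ (pow_ne_zero _ (F.f_ne_zero w))
    · change a (F.proj (F.action g w)) / F.f (F.proj (F.action g w)) ^ k = _
      rw [F.invariant_proj_action F.f_mem, F.invariant_proj_action ha]), homElem_mem _ _ _⟩
  map_one' := by
    refine Subtype.ext (Subtype.ext ?_)
    simp only [map_one]
    rfl
  map_zero' := by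
    refine Subtype.ext (Subtype.ext ?_)
    simp only [map_zero]
    exact map_zero (monomial 0)
  map_mul' x y := by
    refine Subtype.ext (Subtype.ext ?_)
    simp only [map_mul]
    exact (monomial_mul_monomial 0 0 _ _).symm
  map_add' x y := by
    refine Subtype.ext (Subtype.ext ?_)
    simp only [map_add]
    exact map_add (monomial 0) _ _

lemma evalSection_baseHom (z) (w : F.Dom) : evalSection F.invFracForms (F.baseHom z).1 w =
    evalFrac F.f_mem z ⟨F.proj w, F.f_ne_zero w⟩ := by
  simp [baseHom]

/-- The morphism to the affine open subset of `ℙ(I) // G`. -/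
def toBase : F.chart ⟶ Spec (.of (FracRing (invariantForms I.toRepresentation) F.f F.f_mem)) :=
  Proj.toSpecZero _ ≫ Spec.map (CommRingCat.ofHom F.baseHom)

/-- The same affine open subset, as the one where a power of `f` does not vanish. -/
def powι {k : ℕ} (hk : 0 < k) :
    Spec (.of (FracRing (invariantForms I.toRepresentation) (F.f ^ k) (F.pow_f_mem k))) ⟶
      subQuotient I :=
  Proj.awayι (sectionGrading (invariantForms I.toRepresentation)) _
    (homElem_mem _ _ (F.pow_f_mem k)) (Nat.mul_pos hk F.d_pos)

lemma exists_hom_pow {k : ℕ} (hk : 0 < k) :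
    ∃ φ : FracRing (invariantForms I.toRepresentation) F.f F.f_mem →+*
        FracRing (invariantForms I.toRepresentation) (F.f ^ k) (F.pow_f_mem k),
      (∀ z (v : {v // (F.f ^ k) v ≠ 0}) (hv : F.f v.1 ≠ 0), evalFrac (F.pow_f_mem k) (φ z) v =
        evalFrac F.f_mem z ⟨v.1, hv⟩) ∧
      Spec.map (CommRingCat.ofHom φ) ≫ F.baseι = F.powι hk := by
  obtain ⟨k, rfl⟩ := Nat.exists_eq_add_one_of_ne_zero hk.ne'
  have hx : homElem (invariantForms I.toRepresentation) (F.f ^ (k + 1)) (F.pow_f_mem (k + 1)) =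
      homElem _ F.f F.f_mem * homElem _ (F.f ^ k) (F.pow_f_mem k) := by
    rw [← homElem_mul]
    exact homElem_congr _ (by ring) (pow_succ' _ _) _ _
  exact ⟨HomogeneousLocalization.awayMap _ (homElem_mem _ _ (F.pow_f_mem k)) hx,
    fun z v hv => evalFrac_awayMap F.f_mem (F.pow_f_mem k) (F.pow_f_mem (k + 1)) hx z v hv,
    Proj.SpecMap_awayMap_awayι _ _ _ _ hx⟩

lemma exists_hom_base {m : ℕ} (hm : 0 < m) {c : F.Dom → ℂ} (hc : c ∈ F.invFracForms m) :
    ∃ φ : FracRing (invariantForms I.toRepresentation) F.f F.f_mem →+* FracRing F.invFracForms c hc,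
      (∀ z (w : {w // c w ≠ 0}), evalFrac hc (φ z) w =
        evalFrac F.f_mem z ⟨F.proj w.1, F.f_ne_zero w.1⟩) ∧
      Proj.awayι (sectionGrading F.invFracForms) _ (homElem_mem _ _ hc) hm ≫ F.toBase =
        Spec.map (CommRingCat.ofHom φ) := by
  refine ⟨(HomogeneousLocalization.fromZeroRingHom _ _).comp F.baseHom, fun z w => ?_, ?_⟩
  · rw [RingHom.comp_apply, evalFrac_fromZeroRingHom, evalSection_baseHom]
  · rw [toBase, Proj.awayι_toSpecZero_assoc, ← Spec.map_comp]
    rfl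

variable [Fintype G] [FiniteDimensional ℂ W]

/-- Invariant forms on `W` are enough to cover the chart. This is `exists_pow_le_mul` for all linear
forms on `W`, with the denominators `f ^ k` left in the cofactor. -/
lemma exists_pow_mem_mul_res {n : ℕ} (hn : 0 < n) {z : F.Dom → ℂ} (hz : z ∈ F.invFracForms n) :
    ∃ N D, 0 < D ∧ D ≤ n * N ∧
      z ^ N ∈ F.invFracForms (n * N - D) * (invariantForms ρ D).map F.res.toLinearMap := by
  obtain ⟨N, h, h'⟩ := exists_pow_le_mul (isStable_linearForms_bot (ρ := ρ)) (linearForms_fg ⊥)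
  set D := (Fintype.card G).factorial
  have hle : N ≤ n * N := Nat.le_mul_of_pos_left _ hn
  refine ⟨N, D, Nat.factorial_pos _, by omega, ?_⟩
  have k₂ := pow_le_mul_of_le h hle h'
  refine mem_mul_of_mem_fixedFunctions (F.isStable_fracForms _) ?_ ?_
    ((fixedFunctions F.action).pow_mem hz.2 _)
  · rintro _ ⟨y, hy, rfl⟩
    exact (F.res_mem_invFracForms hy).2
  obtain ⟨k, g, hg, hz⟩ := hz.1
  have h3 := Submodule.pow_mem_pow _ hg N
  rw [homogeneousFunctions, mul_pow, ← pow_mul, ← pow_mul] at h3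
  have h4 := mul_le_mul' (le_refl _) k₂ h3
  rw [mul_left_comm, mul_comm] at h4
  have hx' : z ^ N = F.res (g ^ N) * fun w => (F.f (F.proj w) ^ (k * N))⁻¹ := by
    funext w
    have := F.f_ne_zero w
    rw [Pi.mul_apply, res_apply, Pi.pow_apply, Pi.pow_apply, ← hz w, mul_pow, ← pow_mul]
    field_simp
  rw [hx']
  generalize g ^ N = b at h4
  induction h4 using Submodule.mul_induction_on' with
  | add a _ b _ ha hb =>
    rw [map_add, add_mul]
    exact add_mem ha hb
  | mem_mul_mem a ha b hb =>
    rw [map_mul, mul_right_comm]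
    refine Submodule.mul_mem_mul ⟨k * N, a, ?_, fun w => ?_⟩ ⟨b, hb, rfl⟩
    · rwa [mul_right_comm] at ha
    · have := F.f_ne_zero w
      simp only [Pi.mul_apply, res_apply]
      field_simp

lemma iSup_pair : ⨆ x : F.Index, Proj.basicOpen (sectionGrading F.invFracForms)
    (homElem F.invFracForms (F.pair x).c (F.pair x).hc) = ⊤ := by
  refine top_le_iff.mp fun x _ => TopologicalSpace.Opens.mem_iSup.mpr ?_
  by_contra! H
  simp only [Proj.mem_basicOpen, not_not] at H
  refine x.not_irrelevant_le ((HomogeneousIdeal.irrelevant_le _).mpr fun n hn z hz => ?_)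
  have hz' := homElem_coeff F.invFracForms hz
  have hb := z.2 n
  rw [← hz']
  set b := (z : (F.Dom → ℂ)[X]).coeff n
  obtain ⟨N, D, hD, hDN, h⟩ := F.exists_pow_mem_mul_res hn hb
  refine x.isPrime.mem_of_pow_mem N ?_
  rw [← homElem_pow]
  suffices key : ∀ y, y ∈ F.invFracForms (n * N - D) * (invariantForms ρ D).map F.res.toLinearMap →
      ∃ hy : y ∈ F.invFracForms (n * N - D + D),
        homElem F.invFracForms y hy ∈ x.asHomogeneousIdeal by
    obtain ⟨hy, hy'⟩ := key _ h
    convert! hy' using 1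
    exact homElem_congr _ (by rw [Nat.sub_add_cancel hDN, smul_eq_mul, mul_comm]) rfl _ _
  intro y hy
  induction hy using Submodule.mul_induction_on' with
  | add y _ y' _ h1 h2 =>
    obtain ⟨h1, h1'⟩ := h1
    obtain ⟨h2, h2'⟩ := h2
    refine ⟨add_mem h1 h2, ?_⟩
    convert! add_mem h1' h2' using 1
    exact Subtype.ext (map_add (monomial _) y y')
  | mem_mul_mem u hu v hv =>
    obtain ⟨v, hv, rfl⟩ := hv
    have hv' := F.res_mem_invFracForms hv
    refine ⟨SetLike.mul_mem_graded hu hv', ?_⟩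
    refine (congrArg (· ∈ x.asHomogeneousIdeal) (homElem_mul F.invFracForms hu hv')).mpr ?_
    -- The cover is indexed by forms of degree divisible by `d`; a `d`-th power has such a degree.
    refine Ideal.mul_mem_left _ _ (x.isPrime.mem_of_pow_mem F.d ?_)
    rw [← homElem_pow]
    have h5 : v ^ F.d ∈ invariantForms ρ (D * F.d) := by
      rw [mul_comm]
      exact SetLike.pow_mem_graded F.d hv
    convert! H ⟨D, v ^ F.d, hD, h5⟩ using 1
    exact homElem_congr _ (mul_comm _ _) (map_pow F.res v _).symm _ _

lemma iSup_compatiblePair : ⨆ i : CompatiblePair F.invFracForms (blowupForms J)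
    (Subtype.val : F.Dom → W), Proj.basicOpen (sectionGrading F.invFracForms)
      (homElem F.invFracForms i.c i.hc) = ⊤ := by
  rw [eq_top_iff, ← F.iSup_pair]
  exact iSup_le fun i => le_iSup_of_le (F.pair i) le_rfl

/-- The morphism to the quotient of the blow-up. -/
def toBlowup : F.chart ⟶ blowupQuotient J := inducedMap F.iSup_compatiblePair

lemma ι_toBlowup (x : F.Index) : (F.pair x).ι ≫ F.toBlowup = (F.pair x).map :=
  (F.pair x).ι_inducedMap F.iSup_compatiblePair

lemma toBlowup_preimage (x : F.Index) :
    F.toBlowup ⁻¹ᵁ Proj.basicOpen (sectionGrading (blowupForms J))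
      (homElem (blowupForms J) _ (F.den_mem x)) =
      Proj.basicOpen (sectionGrading F.invFracForms)
        (homElem F.invFracForms (F.pair x).c (F.pair x).hc) := by
  refine eq_of_forall_ι_preimage F.pair F.iSup_pair fun y => ?_
  refine (F.pair y).ι_preimage_inducedMap_eq F.iSup_compatiblePair (F.den_mem x) x.deg_pos
    (F.pair x).hc x.deg_pos one_pos fun w hw => ?_
  change (F.den x w.1 ^ (y.k * F.d) / F.den y w.1 ^ (x.k * F.d)) ^ 1 =
    F.res x.h w ^ (y.k * F.d) / F.res y.h w ^ (x.k * F.d)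
  have h1 : F.res y.h w ≠ 0 := hw
  have h2 := F.f_ne_zero w
  rw [den_res, den_res, pow_one, mul_pow, mul_pow, ← pow_mul, ← pow_mul,
    mul_left_comm x.k, mul_div_mul_left _ _ (pow_ne_zero _ h2)]

lemma isIso_toBlowup_restrict (x : F.Index) : IsIso (F.toBlowup ∣_ (F.denι x).opensRange) := by
  have h : IsIso (Spec.map (CommRingCat.ofHom (F.denHom x))) := inferInstance
  exact @isIso_morphismRestrict_opensRange _ _ _ _ F.toBlowup (F.pair x).ι (F.denι x) _ _ _ h
    (F.ι_toBlowup x) ((congrArg _ (F.opensRange_denι x)).trans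
      ((F.toBlowup_preimage x).trans (Proj.opensRange_awayι _ _ _ _).symm))

lemma ι_preimage_projectionMap {d' : ℕ} (hd' : 0 < d') {f' : I.toSubmodule → ℂ}
    (hf' : f' ∈ invariantForms I.toRepresentation d') {h' : W → ℂ}
    (hh' : h' ∈ invariantForms ρ d') {x : F.Index} {s : ℕ} (hs : 0 < s)
    (h : ∀ w, pullbackFn I J hIJ f' w * h' w ≠ 0 →
      (pullbackFn I J hIJ F.f w ^ d' / pullbackFn I J hIJ f' w ^ F.d) ^ s =
        F.den x w ^ d' / (pullbackFn I J hIJ f' w * h' w) ^ (x.k * F.d)) :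
    (projectionPair I J hIJ hd' hf' hh').ι ⁻¹ᵁ (projectionMap I J hIJ ⁻¹ᵁ
        Proj.basicOpen (sectionGrading (invariantForms I.toRepresentation))
          (homElem _ _ F.f_mem)) =
      (projectionPair I J hIJ hd' hf' hh').ι ⁻¹ᵁ
        Proj.basicOpen (sectionGrading (blowupForms J)) (homElem (blowupForms J) _ (F.den_mem x)) :=
  CompatiblePair.ι_preimage_inducedMap_eq (iSup_compatiblePair_projection I J hIJ)
    (projectionPair I J hIJ hd' hf' hh') F.f_mem F.d_pos (F.den_mem x) x.deg_pos hs h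

/-- On the open set of `f' * h'` the condition `f ≠ 0` on the base is the invertibility of `f ^ d' /
f' ^ d`. The `d'`-th power of this is a power of `f ^ d' h' ^ d` over a power of `f' h'`, and `f ^
d' h' ^ d` is one of the denominators `f ^ k h`. -/
lemma iSup_den : ⨆ x : F.Index, Proj.basicOpen (sectionGrading (blowupForms J))
      (homElem (blowupForms J) _ (F.den_mem x)) =
    projectionMap I J hIJ ⁻¹ᵁ Proj.basicOpen (sectionGrading (invariantForms I.toRepresentation))
      (homElem _ _ F.f_mem) := by
  refine le_antisymm (iSup_le fun x y hy => ?_) fun y hy => ?_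
  · have h := F.ι_preimage_projectionMap x.deg_pos (F.pow_f_mem x.k) x.mem (x := x) one_pos
      fun w hw => by
        have h1 : pullbackFn I J hIJ F.f w ^ x.k ≠ 0 := left_ne_zero_of_mul hw
        have h2 : x.h w ≠ 0 := right_ne_zero_of_mul hw
        change (pullbackFn I J hIJ F.f w ^ _ / (pullbackFn I J hIJ F.f w ^ x.k) ^ _) ^ 1 =
          (pullbackFn I J hIJ F.f w ^ x.k * x.h w) ^ _ /
            (pullbackFn I J hIJ F.f w ^ x.k * x.h w) ^ _
        rw [← pow_mul, div_self (pow_ne_zero _ (mul_ne_zero h1 h2)), pow_one, div_self]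
        rw [pow_mul]
        exact pow_ne_zero _ h1
    have hy' : y ∈ Set.range
        (projectionPair I J hIJ x.deg_pos (F.pow_f_mem x.k) x.mem).ι := by
      rw [CompatiblePair.opensRange_ι]
      exact hy
    obtain ⟨y, rfl⟩ := hy'
    exact (SetLike.ext_iff.mp h y).mpr hy
  · obtain ⟨i, hi⟩ := TopologicalSpace.Opens.mem_iSup.mp
      ((iSup_projectionPair I J hIJ).ge (Set.mem_univ y))
    obtain ⟨⟨d', f', h'⟩, hd', hf', hh'⟩ := i
    have hy' : y ∈ Set.range (projectionPair I J hIJ hd' hf' hh').ι := by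
      rw [CompatiblePair.opensRange_ι]
      exact hi
    let x : F.Index := ⟨d', h' ^ F.d, hd', by
      rw [mul_comm]
      exact SetLike.pow_mem_graded F.d hh'⟩
    have h := F.ι_preimage_projectionMap hd' hf' hh' (x := x) hd' fun w hw => by
      have h1 : pullbackFn I J hIJ f' w ≠ 0 := left_ne_zero_of_mul hw
      have h2 : h' w ≠ 0 := right_ne_zero_of_mul hw
      change (pullbackFn I J hIJ F.f w ^ _ / _) ^ d' =
        (pullbackFn I J hIJ F.f w ^ d' * h' w ^ F.d) ^ _ / (_ * _) ^ (d' * F.d)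
      rw [div_pow, mul_pow, mul_pow, ← pow_mul, ← pow_mul, ← pow_mul, mul_comm F.d,
        mul_div_mul_right _ _ (pow_ne_zero _ h2)]
    refine TopologicalSpace.Opens.mem_iSup.mpr ⟨x, ?_⟩
    obtain ⟨y, rfl⟩ := hy'
    exact (SetLike.ext_iff.mp h y).mp hy

lemma exists_hom_den (x : F.Index) :
    ∃ φ : FracRing (invariantForms I.toRepresentation) (F.f ^ x.k) (F.pow_f_mem x.k) →+*
        FracRing (blowupForms J) _ (F.den_mem x),
      (∀ z (w : {w // F.den x w ≠ 0}), evalFrac (F.den_mem x) (φ z) w =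
        evalFrac (F.pow_f_mem x.k) z ⟨_, left_ne_zero_of_mul w.2⟩) ∧
      F.denι x ≫ projectionMap I J hIJ = Spec.map (CommRingCat.ofHom φ) ≫ F.powι x.pos :=
  let j := projectionPair I J hIJ x.deg_pos (F.pow_f_mem x.k) x.mem
  ⟨j.compat.hom, j.compat.evalFrac_hom, j.ι_inducedMap (iSup_compatiblePair_projection I J hIJ)⟩

lemma ι_toBlowup_projectionMap (x : F.Index) :
    (F.pair x).ι ≫ F.toBlowup ≫ projectionMap I J hIJ = (F.pair x).ι ≫ F.toBase ≫ F.baseι := by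
  obtain ⟨φ, hφ, e⟩ := F.exists_hom_pow x.pos
  obtain ⟨ψ, hψ, e'⟩ := F.exists_hom_den x
  obtain ⟨φ₀, hφ₀, e₀⟩ := F.exists_hom_base x.deg_pos (F.res_mem_invFracForms x.mem)
  have h : φ₀ = (F.denHom x).comp (ψ.comp φ) := by
    refine RingHom.ext fun z => evalFrac_ext (F.res_mem_invFracForms x.mem) fun w => ?_
    have hw : F.den x w.1.1 ≠ 0 := mul_ne_zero (pow_ne_zero _ (F.f_ne_zero w.1)) w.2
    have h₁ := F.evalFrac_denHom x (ψ (φ z)) w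
    have h₂ := hψ (φ z) ⟨w.1.1, hw⟩
    have h₃ := hφ z ⟨F.proj w.1, pow_ne_zero _ (F.f_ne_zero w.1)⟩ (F.f_ne_zero w.1)
    exact (hφ₀ z w).trans (h₃.symm.trans (h₂.symm.trans h₁.symm))
  have e₁ : (F.pair x).ι ≫ F.toBlowup = Spec.map (CommRingCat.ofHom (F.denHom x)) ≫ F.denι x :=
    F.ι_toBlowup x
  have e₂ : (F.pair x).ι ≫ F.toBase = Spec.map (CommRingCat.ofHom φ₀) := e₀
  have key : (Spec.map (CommRingCat.ofHom (F.denHom x)) ≫ F.denι x) ≫ projectionMap I J hIJ =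
      Spec.map (CommRingCat.ofHom φ₀) ≫ F.baseι := by
    rw [Category.assoc, e', ← e, ← Spec.map_comp_assoc, ← Spec.map_comp_assoc, h]
    rfl
  rw [← Category.assoc, ← Category.assoc]
  exact (congrArg (· ≫ projectionMap I J hIJ) e₁).trans
    (key.trans (congrArg (· ≫ F.baseι) e₂).symm)

lemma toBlowup_projectionMap : F.toBlowup ≫ projectionMap I J hIJ = F.toBase ≫ F.baseι :=
  Scheme.Cover.hom_ext (pairCover F.pair F.iSup_pair).openCover _ _ F.ι_toBlowup_projectionMap

/-- The open set of `h` in the chart maps isomorphically to that of `f ^ k h` by `denHom_bijective`,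
and by `iSup_den` the latter fill the preimage of `{f ≠ 0}`. -/
lemma isPullback_toBlowup :
    IsPullback F.toBlowup F.toBase (projectionMap I J hIJ) F.baseι := by
  refine isPullback_of_isIso_morphismRestrict F.toBlowup_projectionMap
    (fun x => (F.denι x).opensRange) ?_ F.isIso_toBlowup_restrict
  simp only [opensRange_denι, opensRange_baseι]
  exact F.iSup_den

end Frame

end Cover


/-! ### Constants in degree-zero localizations -/

section ConstantFunctions

variable {R : Type} [CommRing R] [Algebra ℂ R] (𝒜 : ℕ → Submodule ℂ R) [GradedAlgebra 𝒜]

/-- The constants in the degree zero part of a localization. -/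
def constHom (f : R) : ℂ →+* HomogeneousLocalization.Away 𝒜 f :=
  (HomogeneousLocalization.fromZeroRingHom 𝒜 _).comp (algebraMap ℂ (𝒜 0))

lemma awayι_projStr {f : R} {m : ℕ} (hf : f ∈ 𝒜 m) (hm : 0 < m) :
    Proj.awayι 𝒜 f hf hm ≫ projStr 𝒜 = Spec.map (CommRingCat.ofHom (constHom 𝒜 f)) := by
  rw [projStr, Proj.awayι_toSpecZero_assoc, ← Spec.map_comp]
  rfl

lemma constHom_eq_mk {f : R} {m : ℕ} (hf : f ∈ 𝒜 m) (c : ℂ) : constHom 𝒜 f c =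
    HomogeneousLocalization.Away.mk 𝒜 hf 0 (algebraMap ℂ R c) (by
      rw [zero_smul]
      exact SetLike.algebraMap_mem_graded 𝒜 c) := by
  apply HomogeneousLocalization.val_injective
  rw [HomogeneousLocalization.Away.val_mk]
  change Localization.mk _ _ = _
  congr 1
  exact Subtype.ext (pow_zero f).symm

lemma evalFrac_constHom {X : Type} {𝒮 : ℕ → Submodule ℂ (X → ℂ)} [SetLike.GradedMonoid 𝒮] {d : ℕ}
    {f : X → ℂ} (hf : f ∈ 𝒮 d) (c : ℂ) (x : {x // f x ≠ 0}) :
    evalFrac hf (constHom (sectionGrading 𝒮) (homElem 𝒮 f hf) c) x = c := by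
  rw [constHom, RingHom.comp_apply, evalFrac_fromZeroRingHom]
  simp [evalSection]

end ConstantFunctions

/-! ### Recognizing tensor products over `ℂ` -/

section Pushout

open TensorProduct

variable {P A C : Type} [CommRing P] [CommRing A] [CommRing C] [Algebra ℂ P] [Algebra ℂ A]
  [Algebra ℂ C]

/-- An element of `P ⊗ A` is uniquely `∑ pₖ ⊗ xₖ` with the `xₖ` from a basis of `A` over `ℂ`.
Injectivity is the first hypothesis applied to that basis. -/
lemma productMap_bijective (a : P →ₐ[ℂ] C) (b : A →ₐ[ℂ] C)
    (hinj : ∀ (κ : Type) (s : Finset κ) (p : κ → P) (x : κ → A),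
      (∀ c : κ → ℂ, ∑ k ∈ s, algebraMap ℂ A (c k) * x k = 0 → ∀ k ∈ s, c k = 0) →
      ∑ k ∈ s, a (p k) * b (x k) = 0 → ∀ k ∈ s, p k = 0)
    (hsurj : ∀ c, c ∈ AddSubmonoid.closure (Set.range fun u : P × A => a u.1 * b u.2)) :
    Function.Bijective (Algebra.TensorProduct.productMap a b) := by
  constructor
  · rw [injective_iff_map_eq_zero]
    intro u hu
    classical
    let B := Module.Basis.ofVectorSpace ℂ A
    obtain ⟨p, rfl⟩ := (TensorProduct.equivFinsuppOfBasisRight B).symm.surjective u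
    rw [TensorProduct.equivFinsuppOfBasisRight_symm_apply, Finsupp.sum, map_sum] at hu
    simp only [Algebra.TensorProduct.productMap_apply_tmul] at hu
    have h := hinj _ _ _ _ (fun c hc => linearIndependent_iff'.mp B.linearIndependent _ c (by
      simpa only [Algebra.smul_def] using hc)) hu
    have hp : p = 0 := by
      ext k
      by_cases hk : k ∈ p.support
      · exact h k hk
      · exact Finsupp.notMem_support_iff.mp hk
    rw [hp, map_zero]
  · intro c
    induction hsurj c using AddSubmonoid.closure_induction with
    | mem _ h =>
      obtain ⟨⟨p, x⟩, rfl⟩ := h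
      exact ⟨p ⊗ₜ x, Algebra.TensorProduct.productMap_apply_tmul _ _ _ _⟩
    | zero => exact ⟨0, map_zero _⟩
    | add _ _ _ _ h₁ h₂ =>
      obtain ⟨u, rfl⟩ := h₁
      obtain ⟨v, rfl⟩ := h₂
      exact ⟨u + v, map_add _ _ _⟩

lemma isPushout_of_bijective (a : P →ₐ[ℂ] C) (b : A →ₐ[ℂ] C)
    (h : Function.Bijective (Algebra.TensorProduct.productMap a b)) :
    IsPushout (CommRingCat.ofHom (algebraMap ℂ P)) (CommRingCat.ofHom (algebraMap ℂ A))
      (CommRingCat.ofHom a.toRingHom) (CommRingCat.ofHom b.toRingHom) :=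
  (CommRingCat.isPushout_tensorProduct ℂ P A).of_iso (Iso.refl _) (Iso.refl _) (Iso.refl _)
    (RingEquiv.ofBijective _ h).toCommRingCatIso (by simp) (by simp) (by ext; simp) (by ext; simp)

/-- A criterion for a square of rings over a field to be a pushout. -/
lemma isPushout_of_sums {P A C : Type} [CommRing P] [CommRing A] [CommRing C] (i : ℂ →+* P)
    (j : ℂ →+* A) (a : P →+* C) (b : A →+* C) (hab : ∀ c, a (i c) = b (j c))
    (hinj : ∀ (κ : Type) (s : Finset κ) (p : κ → P) (x : κ → A),
      (∀ c : κ → ℂ, ∑ k ∈ s, j (c k) * x k = 0 → ∀ k ∈ s, c k = 0) →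
      ∑ k ∈ s, a (p k) * b (x k) = 0 → ∀ k ∈ s, p k = 0)
    (hsurj : ∀ c, c ∈ AddSubmonoid.closure (Set.range fun u : P × A => a u.1 * b u.2)) :
    IsPushout (CommRingCat.ofHom i) (CommRingCat.ofHom j) (CommRingCat.ofHom a)
      (CommRingCat.ofHom b) := by
  let _ := i.toAlgebra
  let _ := j.toAlgebra
  let _ := (a.comp i).toAlgebra
  exact isPushout_of_bijective { a with commutes' := fun _ => rfl }
    { b with commutes' := fun c => (hab c).symm } (productMap_bijective _ _ hinj hsurj)

end Pushout

/-! ### Pullbacks checked on an open cover -/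

section Cover

lemma isPullback_of_cover {W X Y Z : Scheme} (a : W ⟶ X) (b : W ⟶ Y) (c : X ⟶ Z) (d : Y ⟶ Z)
    (𝒰 : X.OpenCover) (V : 𝒰.I₀ → Scheme) (j : ∀ i, V i ⟶ W) (g : ∀ i, V i ⟶ 𝒰.X i)
    (h₁ : ∀ i, IsPullback (j i) (g i) a (𝒰.f i))
    (h₂ : ∀ i, IsPullback (g i) (j i ≫ b) (𝒰.f i ≫ c) d) : IsPullback a b c d := by
  refine Scheme.isPullback_of_openCover a b c d 𝒰 fun i => ?_
  refine (h₂ i).of_iso (h₁ i).isoPullback (Iso.refl _) (Iso.refl _) (Iso.refl _) ?_ ?_ ?_ ?_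
  · rw [Iso.refl_hom, Category.comp_id]
    exact (h₁ i).isoPullback_hom_snd.symm
  · rw [Iso.refl_hom, Category.comp_id]
    exact congrArg (· ≫ b) (h₁ i).isoPullback_hom_fst.symm
  · simp
  · simp

end Cover

/-! ### Standard charts of projective space -/

section GradedPolynomials

open MvPolynomial

variable {σ : Type} {R : Type} [CommRing R] [Algebra ℂ R] (𝒜 : ℕ → Submodule ℂ R) [GradedAlgebra 𝒜]

lemma aeval_mem_graded {w : σ → ℕ} {a : σ → R} (ha : ∀ i, a i ∈ 𝒜 (w i)) {n : ℕ}
    {p : MvPolynomial σ ℂ} (hp : p.IsWeightedHomogeneous w n) : MvPolynomial.aeval a p ∈ 𝒜 n := by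
  rw [MvPolynomial.aeval_def, eval₂_eq]
  refine Submodule.sum_mem _ fun m hm => ?_
  rw [← Algebra.smul_def]
  refine Submodule.smul_mem _ _ ?_
  rw [← hp (mem_support_iff.mp hm), Finsupp.weight_apply]
  exact SetLike.prod_pow_mem_graded 𝒜 w a m fun i _ => ha i

attribute [local instance] MvPolynomial.gradedAlgebra

/-- The graded homomorphism from a polynomial ring given by elements of degree one. -/
def gradedAeval {a : σ → R} (ha : ∀ i, a i ∈ 𝒜 1) :
    MvPolynomial.homogeneousSubmodule σ ℂ →+*ᵍ 𝒜 where
  __ := (MvPolynomial.aeval a).toRingHom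
  map_mem {n p} hp := by
    have hp' : p.IsWeightedHomogeneous (1 : σ → ℕ) n := hp
    exact aeval_mem_graded 𝒜 ha hp'

lemma gradedAeval_apply {a : σ → R} (ha : ∀ i, a i ∈ 𝒜 1) (p : MvPolynomial σ ℂ) :
    gradedAeval 𝒜 ha p = MvPolynomial.aeval a p := rfl

lemma X_mem_homogeneousSubmodule (i : σ) : X i ∈ homogeneousSubmodule σ ℂ 1 :=
  isHomogeneous_X ℂ i

/-- The standard affine open subsets of projective space. -/
def coordι {n : ℕ} (i : Fin (n + 1)) :
    Spec (.of (HomogeneousLocalization.Away (homogeneousSubmodule (Fin (n + 1)) ℂ) (X i))) ⟶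
      projSpace n :=
  Proj.awayι _ _ (X_mem_homogeneousSubmodule i) one_pos

instance {n : ℕ} (i : Fin (n + 1)) : IsOpenImmersion (coordι i) :=
  inferInstanceAs (IsOpenImmersion (Proj.awayι _ _ _ _))

lemma opensRange_coordι {n : ℕ} (i : Fin (n + 1)) : (coordι i).opensRange =
    Proj.basicOpen (homogeneousSubmodule (Fin (n + 1)) ℂ) (X i) :=
  Proj.opensRange_awayι _ _ _ _

lemma irrelevant_le_span_X (n : ℕ) : (HomogeneousIdeal.irrelevant
    (homogeneousSubmodule (Fin (n + 1)) ℂ)).toIdeal ≤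
      Ideal.span (Set.range fun i : Fin (n + 1) => X i) := by
  refine (HomogeneousIdeal.toIdeal_irrelevant_le _).mpr fun m hm p hp => ?_
  rw [← Set.image_univ]
  refine mem_ideal_span_X_image.mpr ?_
  intro d hd
  have h := hp (mem_support_iff.mp hd)
  by_contra! h0
  have hd0 : d = 0 := by
    ext i
    exact h0 i trivial
  rw [hd0, map_zero] at h
  exact hm.ne h

/-- The standard affine open cover of projective space. -/
def coordCover (n : ℕ) : (projSpace n).OpenCover :=
  (Proj.affineOpenCoverOfIrrelevantLESpan (MvPolynomial.homogeneousSubmodule (Fin (n + 1)) ℂ)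
    (fun i : Fin (n + 1) => MvPolynomial.X i) (m := fun _ => 1)
    (fun i => X_mem_homogeneousSubmodule i) (fun _ => one_pos) (irrelevant_le_span_X n)).openCover

end GradedPolynomials

/-! ### The chart as a product with projective space -/

section Fibres

attribute [local instance] MvPolynomial.gradedAlgebra

variable {G : Type} [Group G] {W : Type} [AddCommGroup W] [Module ℂ W] {ρ : Representation ℂ G W}
  {I J : Subrepresentation ρ} {hIJ : IsCompl I.toSubmodule J.toSubmodule} {r : ℕ}
  (F : Frame I J hIJ r)

namespace Frame

/-- The graded homomorphism given by the homogeneous fibre coordinates. -/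
def coordHom : MvPolynomial.homogeneousSubmodule (Fin (r + 1)) ℂ →+*ᵍ
    sectionGrading F.invFracForms :=
  gradedAeval _ fun i => homElem_mem F.invFracForms (F.Y i) (F.Y_mem i)

lemma coordHom_X (i : Fin (r + 1)) :
    F.coordHom (MvPolynomial.X i) = homElem F.invFracForms (F.Y i) (F.Y_mem i) :=
  MvPolynomial.aeval_X _ i

lemma evalSection_coordHom (p : MvPolynomial (Fin (r + 1)) ℂ) (w : F.Dom) :
    evalSection F.invFracForms (F.coordHom p) w = MvPolynomial.eval (fun i => F.Y i w) p := by
  induction p using MvPolynomial.induction_on with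
  | C c =>
    rw [MvPolynomial.eval_C]
    rw [coordHom, gradedAeval_apply, MvPolynomial.aeval_C]
    simp [evalSection]
  | add p q hp hq => rw [map_add, map_add, map_add, Pi.add_apply, hp, hq]
  | mul_X p i hp =>
    rw [map_mul, map_mul, map_mul, Pi.mul_apply, hp, coordHom_X, evalSection_homElem,
      MvPolynomial.eval_X]

lemma eval_mul_of_isWeightedHomogeneous {σ : Type} {w : σ → ℕ} {m : ℕ} {P : MvPolynomial σ ℂ}
    (hP : P.IsWeightedHomogeneous w m) (c : ℂ) (z : σ → ℂ) :
    MvPolynomial.eval (fun j => c ^ w j * z j) P = c ^ m * MvPolynomial.eval z P := by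
  rw [MvPolynomial.eval_eq, MvPolynomial.eval_eq, Finset.mul_sum]
  refine Finset.sum_congr rfl fun s hs => ?_
  have h := hP (MvPolynomial.mem_support_iff.mp hs)
  simp only [mul_pow, ← pow_mul]
  rw [Finset.prod_mul_distrib, Finset.prod_pow_eq_pow_sum, ← h, Finsupp.weight_apply]
  simp only [Finsupp.sum, smul_eq_mul, mul_comm (w _)]
  ring

lemma eval_mul_of_isHomogeneous {σ : Type} {m : ℕ} {P : MvPolynomial σ ℂ}
    (hP : P ∈ MvPolynomial.homogeneousSubmodule σ ℂ (m • 1)) (c : ℂ) (z : σ → ℂ) :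
    MvPolynomial.eval (fun j => c * z j) P = c ^ m * MvPolynomial.eval z P := by
  rw [smul_eq_mul, mul_one, MvPolynomial.mem_homogeneousSubmodule] at hP
  simpa using eval_mul_of_isWeightedHomogeneous hP c z

lemma exists_evalFrac_eq {u : F.Dom → ℂ} (hu : u ∈ F.invFracForms 0) :
    ∃ z, ∀ w, evalFrac F.f_mem z ⟨F.proj w, F.f_ne_zero w⟩ = u w := by
  obtain ⟨k, g, hg, e⟩ := hu.1
  rw [homogeneousFunctions, pow_zero, mul_one] at hg
  have h := Submodule.mul_mem_mul hg (pullbackFn_mem_pow I J hIJ F.f_mem.1)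
  rw [← pow_add] at h
  obtain ⟨a, ha, ha'⟩ := exists_invariant_pullbackFn_eq I J hIJ h fun σ w => by
    have e1 := F.f_mem.2 σ (I.toSubmodule.projectionOnto J.toSubmodule hIJ w)
    rw [← projectionOnto_apply_rho] at e1
    change g _ * F.f _ = g _ * F.f _
    rw [e1]
    by_cases h0 : F.f (I.toSubmodule.projectionOnto J.toSubmodule hIJ w) = 0
    · rw [h0, mul_zero, mul_zero]
    · have e3 := e ⟨w, h0⟩
      have e4 := e (F.action σ ⟨w, h0⟩)
      rw [F.invariant_proj_action F.f_mem, hu.2] at e4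
      exact congrArg (· * _) (e4.symm.trans e3)
  refine ⟨frac F.f_mem (k + 1) a (by
    rwa [show (k + 1) • F.d = k * F.d + F.d by rw [smul_eq_mul]; ring]), fun w => ?_⟩
  rw [evalFrac_frac, div_eq_iff (pow_ne_zero _ (F.f_ne_zero w)), pow_succ, ← mul_assoc, e]
  exact congrFun ha' w.1

lemma exists_isHomogeneous_eq {m : ℕ} {v : F.Dom → ℂ} (hv : v ∈ F.coordSpan ^ m) :
    ∃ P : MvPolynomial (Fin (r + 1)) ℂ, P.IsHomogeneous m ∧
      ∀ w, MvPolynomial.eval (fun j => F.Y j w) P = v w := by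
  have h : F.coordSpan = (MvPolynomial.homogeneousSubmodule (Fin (r + 1)) ℂ 1).map
      (MvPolynomial.aeval F.Y).toLinearMap := by
    rw [MvPolynomial.homogeneousSubmodule_one_eq_span_X, Submodule.map_span, ← Set.range_comp,
      coordSpan]
    congr 2
    funext i
    exact (MvPolynomial.aeval_X F.Y i).symm
  rw [h, ← Submodule.map_pow, MvPolynomial.homogeneousSubmodule_one_pow] at hv
  obtain ⟨P, hP, rfl⟩ := hv
  refine ⟨P, hP, fun w => ?_⟩
  clear hP
  change _ = MvPolynomial.aeval F.Y P w
  induction P using MvPolynomial.induction_on with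
  | C c =>
    rw [MvPolynomial.eval_C, MvPolynomial.aeval_C]
    rfl
  | add p q hp hq => rw [map_add, map_add, Pi.add_apply, hp, hq]
  | mul_X p i hp =>
    rw [map_mul, map_mul, Pi.mul_apply, hp, MvPolynomial.aeval_X, MvPolynomial.eval_X]

/-- The coordinate `Y 0 = t` is determined by `v`, which forces the scaling factor `c = t / z 0`.
The other coordinates are free on the fibre by `surj`. -/
lemma exists_Y_eq {v : I.toSubmodule} (hv : F.f v ≠ 0) {z : Fin (r + 1) → ℂ} (hz : z 0 ≠ 0) :
    ∃ c : ℂ, c ≠ 0 ∧ ∃ w : F.Dom, F.proj w = v ∧ ∀ j, F.Y j w = c * z j := by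
  let t : ℂ := F.f₁ v / F.f₂ v
  have ht : t ≠ 0 := div_ne_zero (left_ne_zero_of_mul (left_ne_zero_of_mul hv))
    (right_ne_zero_of_mul (left_ne_zero_of_mul hv))
  obtain ⟨w, hw, hw'⟩ := F.surj v (right_ne_zero_of_mul hv)
    fun j => t / z 0 * z j.succ * t ^ F.δ
  refine ⟨t / z 0, div_ne_zero ht hz, ⟨w, by rwa [hw]⟩, hw, Fin.cases ?_ fun j => ?_⟩
  · change F.f₁ (I.toSubmodule.projectionOnto J.toSubmodule hIJ w) /
      F.f₂ (I.toSubmodule.projectionOnto J.toSubmodule hIJ w) = _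
    rw [hw, div_mul_cancel₀ _ hz]
  · change F.φ j w * (F.f₁ (I.toSubmodule.projectionOnto J.toSubmodule hIJ w) /
      F.f₂ (I.toSubmodule.projectionOnto J.toSubmodule hIJ w))⁻¹ ^ F.δ = _
    rw [hw, hw']
    change t / z 0 * z j.succ * t ^ F.δ * t⁻¹ ^ F.δ = _
    rw [mul_assoc, ← mul_pow, mul_inv_cancel₀ ht, one_pow, mul_one]

lemma eq_zero_of_forall_eval_eq_zero {n m : ℕ} (i : Fin (n + 1))
    (p : HomogeneousLocalization.Away (MvPolynomial.homogeneousSubmodule (Fin (n + 1)) ℂ)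
        (MvPolynomial.X i)) (P : MvPolynomial (Fin (n + 1)) ℂ) (hP)
    (hp : p = HomogeneousLocalization.Away.mk _ (X_mem_homogeneousSubmodule i) m P hP)
    (h : ∀ z : Fin (n + 1) → ℂ, z 0 ≠ 0 → z i ≠ 0 → MvPolynomial.eval z P = 0) : p = 0 := by
  have hP0 : P = 0 := by
    -- The product vanishes at every point, including those where `z 0` or `z i` is zero.
    have h1 : MvPolynomial.X 0 * MvPolynomial.X i * P = 0 := by
      refine MvPolynomial.funext fun z => ?_
      rw [map_mul, map_mul, MvPolynomial.eval_X, MvPolynomial.eval_X, map_zero]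
      by_cases h0 : z 0 = 0
      · rw [h0, zero_mul, zero_mul]
      by_cases hi : z i = 0
      · rw [hi, mul_zero, zero_mul]
      rw [h z h0 hi, mul_zero]
    exact (mul_eq_zero.mp h1).resolve_left
      (mul_ne_zero (MvPolynomial.X_ne_zero _) (MvPolynomial.X_ne_zero _))
  subst hP0 hp
  apply HomogeneousLocalization.val_injective
  rw [HomogeneousLocalization.Away.val_mk, HomogeneousLocalization.val_zero, Localization.mk_zero]

/-- Evaluate at a point over `v` whose fibre coordinates are proportional to `z`. Homogeneity
removes the factor, and a linear relation between the `xₖ` remains, with coefficients `Pₖ(z) / zᵢ ^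
mₖ` independent of `v`. Independence of the `xₖ` kills them for every `z` with `z 0` and `z i`
nonzero. -/
lemma eq_zero_of_sum_eq_zero (i : Fin (r + 1)) {a : HomogeneousLocalization.Away
      (MvPolynomial.homogeneousSubmodule (Fin (r + 1)) ℂ) (MvPolynomial.X i) →+*
        FracRing F.invFracForms (F.Y i) (F.Y_mem i)}
    (ha : ∀ m P hP w, evalFrac (F.Y_mem i) (a (HomogeneousLocalization.Away.mk _
        (X_mem_homogeneousSubmodule i) m P hP)) w =
          MvPolynomial.eval (fun j => F.Y j w.1) P / F.Y i w.1 ^ m)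
    {b : FracRing (invariantForms I.toRepresentation) F.f F.f_mem →+*
      FracRing F.invFracForms (F.Y i) (F.Y_mem i)}
    (hb : ∀ z w, evalFrac (F.Y_mem i) (b z) w = evalFrac F.f_mem z ⟨F.proj w.1, F.f_ne_zero w.1⟩)
    {κ : Type} (s : Finset κ)
    (p : κ → HomogeneousLocalization.Away
      (MvPolynomial.homogeneousSubmodule (Fin (r + 1)) ℂ) (MvPolynomial.X i))
    (x : κ → FracRing (invariantForms I.toRepresentation) F.f F.f_mem)
    (hx : ∀ c : κ → ℂ, ∑ k ∈ s, constHom (sectionGrading (invariantForms I.toRepresentation))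
        (homElem _ F.f F.f_mem) (c k) * x k = 0 → ∀ k ∈ s, c k = 0)
    (h : ∑ k ∈ s, a (p k) * b (x k) = 0) : ∀ k ∈ s, p k = 0 := by
  intro k hk
  choose m P hP hp using fun k => HomogeneousLocalization.Away.mk_surjective _
    (X_mem_homogeneousSubmodule i) (p k)
  refine eq_zero_of_forall_eval_eq_zero i (p k) (P k) (hP k) (hp k).symm fun z h0 hi => ?_
  have h1 : MvPolynomial.eval z (P k) / z i ^ m k = 0 := by
    refine hx (fun k => MvPolynomial.eval z (P k) / z i ^ m k) ?_ k hk
    refine evalFrac_ext F.f_mem fun v => ?_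
    obtain ⟨c, hc, w, hw, hY⟩ := F.exists_Y_eq v.2 h0
    have hwi : F.Y i w ≠ 0 := by
      rw [hY]
      exact mul_ne_zero hc hi
    have h2 := congrFun (congrArg (evalFrac (F.Y_mem i)) h) ⟨w, hwi⟩
    rw [map_zero, Pi.zero_apply, map_sum, Finset.sum_apply] at h2
    rw [map_zero, Pi.zero_apply, map_sum, Finset.sum_apply]
    refine Eq.trans ?_ h2
    refine Finset.sum_congr rfl fun k _ => ?_
    rw [map_mul, map_mul, Pi.mul_apply, Pi.mul_apply]
    have e1 := evalFrac_constHom F.f_mem (MvPolynomial.eval z (P k) / z i ^ m k) v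
    have e2 := ha (m k) (P k) (hP k) ⟨w, hwi⟩
    have e3 := hb (x k) ⟨w, hwi⟩
    have e4 : (⟨F.proj w, F.f_ne_zero w⟩ : {x // F.f x ≠ 0}) = v := Subtype.ext hw
    have h3 : (fun j => F.Y j w) = fun j => c * z j := funext hY
    rw [hp k] at e2
    refine congr (congrArg _ (e1.trans (Eq.trans ?_ e2.symm)))
      ((e3.trans (congrArg _ e4)).symm)
    change _ = MvPolynomial.eval (fun j => F.Y j w) (P k) / F.Y i w ^ m k
    rw [h3, hY, eval_mul_of_isHomogeneous (hP k), mul_pow,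
      mul_div_mul_left _ _ (pow_ne_zero _ hc)]
  exact (div_eq_zero_iff.mp h1).resolve_right (pow_ne_zero _ hi)

variable [Fintype G]

/-- By `invFracForms_eq`, an invariant of degree `n + 1` is a sum of products of invariants of
degree `n` with combinations of the fibre coordinates. Hence the coordinates have no common zero on
the chart. -/
lemma mem_map_coordHom {n : ℕ} {x : F.Dom → ℂ} (hx : x ∈ F.invFracForms (n + 1)) :
    homElem F.invFracForms x hx ∈
      Ideal.map F.coordHom (HomogeneousIdeal.irrelevant
        (MvPolynomial.homogeneousSubmodule (Fin (r + 1)) ℂ)).toIdeal := by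
  set K := Ideal.map F.coordHom (HomogeneousIdeal.irrelevant
        (MvPolynomial.homogeneousSubmodule (Fin (r + 1)) ℂ)).toIdeal
  have h₁ : ∀ v ∈ F.coordSpan, ∃ hv : v ∈ F.invFracForms 1,
      homElem F.invFracForms v hv ∈ K := by
    intro v hv
    induction hv using Submodule.span_induction with
    | mem v hv =>
      obtain ⟨i, rfl⟩ := hv
      refine ⟨F.Y_mem i, ?_⟩
      rw [← F.coordHom_X i]
      refine Ideal.mem_map_of_mem _ (HomogeneousIdeal.mem_irrelevant_of_mem _ one_pos ?_)
      exact X_mem_homogeneousSubmodule i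
    | zero =>
      refine ⟨zero_mem _, ?_⟩
      convert! zero_mem K
      exact Subtype.ext (map_zero (monomial 1))
    | add u v _ _ hu hv =>
      obtain ⟨hu, hu'⟩ := hu
      obtain ⟨hv, hv'⟩ := hv
      refine ⟨add_mem hu hv, ?_⟩
      convert! add_mem hu' hv' using 1
      exact Subtype.ext (map_add (monomial 1) u v)
    | smul c v _ hv =>
      obtain ⟨hv, hv'⟩ := hv
      refine ⟨Submodule.smul_mem _ c hv, ?_⟩
      have hc : algebraMap ℂ (F.Dom → ℂ) c ∈ F.invFracForms 0 :=
        SetLike.algebraMap_mem_graded F.invFracForms c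
      convert! K.mul_mem_left (homElem F.invFracForms _ hc) hv' using 1
      rw [← homElem_mul]
      exact homElem_congr _ (zero_add 1).symm (Algebra.smul_def c v) _ _
  have h₂ : x ∈ F.invFracForms n * F.coordSpan := by
    rwa [F.invFracForms_eq (n + 1), pow_succ, ← mul_assoc, ← F.invFracForms_eq n] at hx
  suffices h₃ : ∃ hx : x ∈ F.invFracForms (n + 1), homElem F.invFracForms x hx ∈ K from h₃.2
  clear_value K
  clear hx
  induction h₂ using Submodule.mul_induction_on' with
  | add u _ v _ hu hv =>
    obtain ⟨hu, hu'⟩ := hu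
    obtain ⟨hv, hv'⟩ := hv
    refine ⟨add_mem hu hv, ?_⟩
    convert! add_mem hu' hv' using 1
    exact Subtype.ext (map_add (monomial (n + 1)) u v)
  | mem_mul_mem u hu v hv =>
    obtain ⟨hv, hv'⟩ := h₁ v hv
    refine ⟨SetLike.mul_mem_graded hu hv, ?_⟩
    rw [homElem_mul _ hu hv]
    exact K.mul_mem_left _ hv'

lemma irrelevant_le_map : HomogeneousIdeal.irrelevant (sectionGrading F.invFracForms) ≤
    (HomogeneousIdeal.irrelevant
      (MvPolynomial.homogeneousSubmodule (Fin (r + 1)) ℂ)).map F.coordHom := by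
  refine (HomogeneousIdeal.irrelevant_le _).mpr fun n hn z hz => ?_
  obtain ⟨n, rfl⟩ := Nat.exists_eq_add_one_of_ne_zero hn.ne'
  rw [← homElem_coeff _ hz]
  exact F.mem_map_coordHom _

/-- The morphism to projective space given by the homogeneous fibre coordinates. -/
def toProjSpace : F.chart ⟶ projSpace r := Proj.map F.coordHom F.irrelevant_le_map

lemma exists_hom_coord (i : Fin (r + 1)) :
    ∃ a : HomogeneousLocalization.Away (MvPolynomial.homogeneousSubmodule (Fin (r + 1)) ℂ)
        (MvPolynomial.X i) →+* FracRing F.invFracForms (F.Y i) (F.Y_mem i),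
      (∀ m P hP w, evalFrac (F.Y_mem i) (a (HomogeneousLocalization.Away.mk _
        (X_mem_homogeneousSubmodule i) m P hP)) w =
          MvPolynomial.eval (fun j => F.Y j w.1) P / F.Y i w.1 ^ m) ∧
      Proj.awayι (sectionGrading F.invFracForms) _ (homElem_mem _ _ (F.Y_mem i)) one_pos ≫
          F.toProjSpace = Spec.map (CommRingCat.ofHom a) ≫
        coordι i := by
  have key : ∀ (s : sectionRing F.invFracForms) (hs : s ∈ sectionGrading F.invFracForms 1),
      s = F.coordHom (MvPolynomial.X i) →
      ∃ a : HomogeneousLocalization.Away (MvPolynomial.homogeneousSubmodule (Fin (r + 1)) ℂ)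
        (MvPolynomial.X i) →+* HomogeneousLocalization.Away (sectionGrading F.invFracForms) s,
      (∀ m P hP, a (HomogeneousLocalization.Away.mk _
        (X_mem_homogeneousSubmodule i) m P hP) = HomogeneousLocalization.Away.mk _ hs m
          (F.coordHom P) (F.coordHom.map_mem hP)) ∧
      Proj.awayι (sectionGrading F.invFracForms) s hs one_pos ≫
          F.toProjSpace = Spec.map (CommRingCat.ofHom a) ≫
        coordι i := by
    rintro s hs rfl
    exact ⟨HomogeneousLocalization.Away.map F.coordHom (MvPolynomial.X i),
      fun m P hP => HomogeneousLocalization.Away.map_mk _ _ _ _ _ _,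
      Proj.awayι_comp_map F.coordHom F.irrelevant_le_map one_pos _ _⟩
  obtain ⟨a, ha, e⟩ := key _ (homElem_mem _ _ (F.Y_mem i)) (F.coordHom_X i).symm
  refine ⟨a, fun m P hP w => ?_, e⟩
  rw [ha, ← evalSection_coordHom]
  exact evalLocalization_mk (F.Y_mem i) m _ _ rfl w

lemma isPullback_coord (i : Fin (r + 1)) :
    IsPullback (Proj.awayι (sectionGrading F.invFracForms) _ (homElem_mem _ _ (F.Y_mem i)) one_pos)
      (Spec.map (CommRingCat.ofHom (F.exists_hom_coord i).choose)) F.toProjSpace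
      (coordι i) := by
  refine (IsOpenImmersion.isPullback _ _ _ _ (F.exists_hom_coord i).choose_spec.2 ?_).flip
  rw [Proj.opensRange_awayι, opensRange_coordι, ← F.coordHom_X i]
  rfl

/-- Where `Yᵢ ≠ 0`, the ring of the chart is the tensor product of the ring of the `Yⱼ / Yᵢ` with
that of the base. Independence is `eq_zero_of_sum_eq_zero`, generation is `invFracForms_eq`. -/
lemma isPushout_coord (i : Fin (r + 1)) {a : HomogeneousLocalization.Away
      (MvPolynomial.homogeneousSubmodule (Fin (r + 1)) ℂ) (MvPolynomial.X i) →+*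
        FracRing F.invFracForms (F.Y i) (F.Y_mem i)}
    (ha : ∀ m P hP w, evalFrac (F.Y_mem i) (a (HomogeneousLocalization.Away.mk _
        (X_mem_homogeneousSubmodule i) m P hP)) w =
          MvPolynomial.eval (fun j => F.Y j w.1) P / F.Y i w.1 ^ m)
    {b : FracRing (invariantForms I.toRepresentation) F.f F.f_mem →+*
      FracRing F.invFracForms (F.Y i) (F.Y_mem i)}
    (hb : ∀ z w, evalFrac (F.Y_mem i) (b z) w = evalFrac F.f_mem z ⟨F.proj w.1, F.f_ne_zero w.1⟩) :
    IsPushout (CommRingCat.ofHom (constHom (MvPolynomial.homogeneousSubmodule (Fin (r + 1)) ℂ)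
        (MvPolynomial.X i)))
      (CommRingCat.ofHom (constHom (sectionGrading (invariantForms I.toRepresentation))
        (homElem _ F.f F.f_mem)))
      (CommRingCat.ofHom a) (CommRingCat.ofHom b) := by
  refine isPushout_of_sums _ _ _ _ (fun c => ?_) ?_ ?_
  · refine evalFrac_ext (F.Y_mem i) fun w => ?_
    refine Eq.trans ?_ ((hb _ w).trans (evalFrac_constHom F.f_mem c _)).symm
    refine (congrArg (fun z => evalFrac (F.Y_mem i) (a z) w)
      (constHom_eq_mk _ (X_mem_homogeneousSubmodule i) c)).trans ((ha _ _ _ w).trans ?_)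
    rw [pow_zero, div_one]
    exact MvPolynomial.eval_C c
  · intro κ s p x hx h
    exact F.eq_zero_of_sum_eq_zero i ha hb s p x hx h
  · intro c
    obtain ⟨m, s, hs, rfl⟩ := exists_frac _ c
    have hs' := hs
    rw [smul_eq_mul, mul_one, F.invFracForms_eq] at hs'
    suffices h : ∃ z ∈ AddSubmonoid.closure (Set.range fun u : HomogeneousLocalization.Away
        (MvPolynomial.homogeneousSubmodule (Fin (r + 1)) ℂ) (MvPolynomial.X i) ×
        FracRing (invariantForms I.toRepresentation) F.f F.f_mem => a u.1 * b u.2),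
        ∀ w, evalFrac (F.Y_mem i) z w = s w.1 / F.Y i w.1 ^ m by
      obtain ⟨z, hz, hz'⟩ := h
      convert! hz
      exact evalFrac_ext _ fun w => (evalFrac_frac _ _ _ _ _).trans (hz' w).symm
    clear hs
    induction hs' using Submodule.mul_induction_on' with
    | add u _ v _ hu hv =>
      obtain ⟨z, hz, hz'⟩ := hu
      obtain ⟨y, hy, hy'⟩ := hv
      refine ⟨z + y, add_mem hz hy, fun w => ?_⟩
      rw [map_add, Pi.add_apply, hz', hy', Pi.add_apply, add_div]
    | mem_mul_mem u hu v hv =>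
      obtain ⟨z, hz⟩ := F.exists_evalFrac_eq hu
      obtain ⟨P, hP, hP'⟩ := F.exists_isHomogeneous_eq hv
      have hP₁ : P ∈ MvPolynomial.homogeneousSubmodule (Fin (r + 1)) ℂ (m • 1) := by
        rw [smul_eq_mul, mul_one]
        exact hP
      refine ⟨_, AddSubmonoid.subset_closure ⟨⟨HomogeneousLocalization.Away.mk _
        (X_mem_homogeneousSubmodule i) m P hP₁, z⟩, rfl⟩, fun w => ?_⟩
      refine (congrFun (map_mul (evalFrac (F.Y_mem i)) _ _) w).trans
        ((congrArg₂ (· * ·) (ha m P hP₁ w) ((hb z w).trans (hz _))).trans ?_)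
      change _ * _ = u w.1 * v w.1 / _
      rw [← hP']
      ring

lemma isPullback_toProjSpace [FiniteDimensional ℂ W] :
    IsPullback F.toProjSpace F.toBase (projSpaceStr r) (F.baseι ≫ subQuotientStr I) := by
  refine isPullback_of_cover _ _ _ _ (coordCover r)
    (fun i : Fin (r + 1) => Spec (.of (FracRing F.invFracForms (F.Y i) (F.Y_mem i))))
    (fun i => Proj.awayι (sectionGrading F.invFracForms) _
      (homElem_mem _ _ (F.Y_mem i)) one_pos)
    (fun i => Spec.map (CommRingCat.ofHom (F.exists_hom_coord i).choose))
    (fun i => F.isPullback_coord i) fun i => ?_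
  obtain ⟨b, hb, hb'⟩ := F.exists_hom_base one_pos (F.Y_mem i)
  have h := isPullback_SpecMap_of_isPushout _ _ _ _
    (F.isPushout_coord i (F.exists_hom_coord i).choose_spec.1 hb)
  have h1 : (coordCover r).f i ≫ projSpaceStr r = _ :=
    awayι_projStr (MvPolynomial.homogeneousSubmodule (Fin (r + 1)) ℂ)
      (X_mem_homogeneousSubmodule i) one_pos
  have h2 : F.baseι ≫ subQuotientStr I = _ :=
    awayι_projStr (sectionGrading (invariantForms I.toRepresentation))
      (homElem_mem _ F.f F.f_mem) F.d_pos
  rw [h1, h2]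
  refine h.of_iso (Iso.refl _) (Iso.refl _) (Iso.refl _) (Iso.refl _) ?_ ?_ ?_ ?_
  · exact (Category.comp_id _).trans (Category.id_comp _).symm
  · exact (Category.comp_id _).trans (hb'.symm.trans (Category.id_comp _).symm)
  · exact (Category.comp_id _).trans (Category.id_comp _).symm
  · exact (Category.comp_id _).trans (Category.id_comp _).symm

end Frame

end Fibres


/-! ### Projective bundles from two pullback squares -/

lemma isProjectiveBundle_of_isPullback {X U B Z : Scheme} {n : ℕ} {p : X ⟶ U}
    (s : U ⟶ Spec (.of ℂ)) {a : Z ⟶ projSpace n} {b : Z ⟶ B} {x : Z ⟶ X} {ι : B ⟶ U}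
    [IsOpenImmersion ι] (h₁ : IsPullback x b p ι)
    (h₂ : IsPullback a b (projSpaceStr n) (ι ≫ s)) :
    IsProjectiveBundle n (ι.opensRange.ι ≫ s) (p ∣_ ι.opensRange) := by
  intro u
  -- The bundle is trivial over the whole range of `ι`, so no shrinking is needed.
  refine ⟨⊤, trivial, ?_⟩
  let V : ι.opensRange.toScheme.Opens := ⊤
  let k : ι.opensRange.toScheme ⟶ B := (ι.isoOpensRange).inv
  have hk : k ≫ ι = ι.opensRange.ι := ι.isoOpensRange_inv_comp
  have h₃ := ((isPullback_morphismRestrict (p ∣_ ι.opensRange) V).flip.paste_horiz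
    (isPullback_morphismRestrict p ι.opensRange).flip)
  have hc : (V.ι ≫ k) ≫ ι = V.ι ≫ ι.opensRange.ι := by rw [Category.assoc, hk]
  rw [← hc] at h₃
  obtain ⟨l, hl, hl'⟩ := h₁.exists_lift _ _ (h₃.w.trans (Category.assoc _ _ _).symm)
  rw [← hl] at h₃
  have h₄ := (IsPullback.of_right h₃ hl' h₁).paste_horiz h₂
  have hs : (V.ι ≫ k) ≫ ι ≫ s = V.ι ≫ ι.opensRange.ι ≫ s := by
    rw [← Category.assoc, hc, Category.assoc]
  rw [hs] at h₄
  exact ⟨h₄.isoPullback, h₄.isoPullback_hom_snd⟩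

lemma Frame.isProjectiveBundle {G : Type} [Group G] [Fintype G] {W : Type} [AddCommGroup W]
    [Module ℂ W] [FiniteDimensional ℂ W] {ρ : Representation ℂ G W}
    {I J : Subrepresentation ρ} {hIJ : IsCompl I.toSubmodule J.toSubmodule} {r : ℕ}
    (F : Frame I J hIJ r) : IsProjectiveBundle r (F.baseι.opensRange.ι ≫ subQuotientStr I)
      (projectionMap I J hIJ ∣_ F.baseι.opensRange) :=
  isProjectiveBundle_of_isPullback _ F.isPullback_toBlowup F.isPullback_toProjSpace

lemma nonempty_specFracRing {X : Type} {𝒮 : ℕ → Submodule ℂ (X → ℂ)} [SetLike.GradedMonoid 𝒮]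
    {d : ℕ} {f : X → ℂ} (hf : f ∈ 𝒮 d) {x : X} (hx : f x ≠ 0) :
    Nonempty (Spec (.of (FracRing 𝒮 f hf))) := by
  have : Nontrivial (FracRing 𝒮 f hf) :=
    RingHom.domain_nontrivial ((Pi.evalRingHom _ ⟨x, hx⟩).comp (evalFrac hf) : _ →+* ℂ)
  exact inferInstanceAs (Nonempty (PrimeSpectrum (FracRing 𝒮 f hf)))

lemma Frame.nonempty_opensRange_baseι {G : Type} [Group G] {W : Type} [AddCommGroup W]
    [Module ℂ W] {ρ : Representation ℂ G W}
    {I J : Subrepresentation ρ} {hIJ : IsCompl I.toSubmodule J.toSubmodule} {r : ℕ}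
    (F : Frame I J hIJ r) : (F.baseι.opensRange : Set (subQuotient I)).Nonempty := by
  obtain ⟨v, hv⟩ := F.exists_ne_zero
  obtain ⟨x⟩ := nonempty_specFracRing F.f_mem hv
  exact ⟨_, x, rfl⟩


/-! ### Determinants and adjugates of matrices of forms -/

open scoped Matrix

lemma det_mem_pow {A : Type} [CommRing A] [Algebra ℂ A] (S : Submodule ℂ A) {n : ℕ}
    {M : Matrix (Fin n) (Fin n) A} (hM : ∀ i k, M i k ∈ S) : M.det ∈ S ^ n := by
  induction n with
  | zero =>
    rw [Matrix.det_fin_zero, pow_zero]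
    exact Submodule.one_le.mp le_rfl
  | succ n ih =>
    rw [Matrix.det_succ_row_zero]
    refine Submodule.sum_mem _ fun k _ => ?_
    rw [mul_assoc]
    have h : M 0 k * (M.submatrix Fin.succ k.succAbove).det ∈ S ^ (n + 1) := by
      rw [pow_succ']
      exact Submodule.mul_mem_mul (hM 0 k) (ih fun i l => hM _ _)
    obtain h1 | h1 := neg_one_pow_eq_or A (k : ℕ) <;> rw [h1]
    · rwa [one_mul]
    · rw [neg_one_mul]
      exact Submodule.neg_mem _ h

lemma adjugate_mem_pow {A : Type} [CommRing A] [Algebra ℂ A] (S : Submodule ℂ A) {n : ℕ}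
    {M : Matrix (Fin (n + 1)) (Fin (n + 1)) A} (hM : ∀ i k, M i k ∈ S) (i k : Fin (n + 1)) :
    M.adjugate i k ∈ S ^ n := by
  rw [Matrix.adjugate_fin_succ_eq_det_submatrix]
  have h := det_mem_pow S (M := M.submatrix k.succAbove i.succAbove) fun i l => hM _ _
  obtain h1 | h1 := neg_one_pow_eq_or A (k + i : ℕ) <;> rw [h1]
  · rwa [one_mul]
  · rw [neg_one_mul]
    exact Submodule.neg_mem _ h

lemma prod_mem_pow_card {A κ : Type} [CommRing A] [Algebra ℂ A] (S : Submodule ℂ A)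
    (s : Finset κ) {x : κ → A} (hx : ∀ k ∈ s, x k ∈ S) : ∏ k ∈ s, x k ∈ S ^ s.card := by
  classical
  induction s using Finset.induction_on with
  | empty =>
    rw [Finset.prod_empty, Finset.card_empty, pow_zero]
    exact Submodule.one_le.mp le_rfl
  | insert a s ha ih =>
    rw [Finset.prod_insert ha, Finset.card_insert_of_notMem ha, pow_succ']
    exact Submodule.mul_mem_mul (hx a (Finset.mem_insert_self a s))
      (ih fun k hk => hx k (Finset.mem_insert_of_mem hk))

/-! ### A form concentrated at one vector of an orbit -/

section Separation

variable {G : Type} [Group G] [Fintype G] {V : Type} [AddCommGroup V] [Module ℂ V]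

/-- A homogeneous function that separates a vector from the rest of its orbit. -/
lemma exists_separating (τ : Representation ℂ G V) {v₀ : V} (h0 : v₀ ≠ 0)
    (hv : ∀ g, g ≠ 1 → ∀ a : ℂ, τ g v₀ ≠ a • v₀) :
    ∃ c ∈ homogeneousFunctions V (Fintype.card G - 1), c v₀ = 1 ∧ ∀ g, g ≠ 1 → c (τ g v₀) = 0 := by
  classical
  have h : ∀ g, g ≠ 1 → ∃ l : V →ₗ[ℂ] ℂ, l v₀ = 1 ∧ l (τ g v₀) = 0 := by
    intro g hg
    have h1 : v₀ ∉ Submodule.span ℂ {τ g v₀} := by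
      rw [Submodule.mem_span_singleton]
      rintro ⟨a, ha⟩
      have ha0 : a ≠ 0 := by
        rintro rfl
        exact h0 (by rw [← ha, zero_smul])
      refine hv g hg a⁻¹ ?_
      nth_rewrite 2 [← ha]
      rw [smul_smul, inv_mul_cancel₀ ha0, one_smul]
    obtain ⟨l, hl, hl'⟩ := Submodule.exists_le_ker_of_notMem h1
    refine ⟨(l v₀)⁻¹ • l, ?_, ?_⟩
    · rw [LinearMap.smul_apply, smul_eq_mul, inv_mul_cancel₀ hl]
    · rw [LinearMap.smul_apply, LinearMap.mem_ker.mp (hl' (Submodule.mem_span_singleton_self _)),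
        smul_zero]
  choose! l hl hl' using h
  -- One linear factor for each `g ≠ 1`, equal to `1` at `v₀` and `0` at `g v₀`; it exists because
  -- the two vectors lie on different lines.
  refine ⟨∏ g ∈ Finset.univ.erase 1, (l g : V → ℂ), ?_, ?_, ?_⟩
  · rw [← Finset.card_univ, ← Finset.card_erase_of_mem (Finset.mem_univ 1)]
    refine prod_mem_pow_card _ _ fun g _ => ⟨l g, ?_, rfl⟩
    rw [SetLike.mem_coe, Submodule.mem_dualAnnihilator]
    intro w hw
    rw [(Submodule.mem_bot ℂ).mp hw, map_zero]
  · rw [Finset.prod_apply]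
    exact Finset.prod_eq_one fun g hg => hl g (Finset.ne_of_mem_erase hg)
  · intro g hg
    rw [Finset.prod_apply]
    exact Finset.prod_eq_zero (Finset.mem_erase.mpr ⟨hg, Finset.mem_univ g⟩) (hl' g hg)

end Separation

/-! ### Averages twisted by a matrix representation -/

section TwistedAverage

variable {G : Type} [Group G] [Fintype G] {V : Type} [AddCommGroup V] [Module ℂ V]
  (τ : Representation ℂ G V) {r : ℕ} (T : G →* Matrix (Fin r) (Fin r) ℂ) (c : V → ℂ)

/-- The average of the matrices `T g`, weighted by the translates of a function. -/
def twistedAverage (v : V) : Matrix (Fin r) (Fin r) ℂ := ∑ g, c (τ g v) • T g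

/-- Reindexing of the sum by right multiplication. This transformation rule cancels that of the
coordinates along `J` and makes the `φᵢ` invariant. -/
lemma twistedAverage_mul (g : G) (v : V) :
    twistedAverage τ T c (τ g v) * T g = twistedAverage τ T c v := by
  simp only [twistedAverage, Finset.sum_mul, smul_mul_assoc, ← map_mul]
  refine Fintype.sum_equiv (Equiv.mulRight g) _ _ fun h => ?_
  rw [Equiv.coe_mulRight, map_mul τ, Module.End.mul_apply]

/-- The average as a matrix of functions. -/
def averageMatrix : Matrix (Fin r) (Fin r) (V → ℂ) :=
  Matrix.of fun i k v => twistedAverage τ T c v i k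

lemma averageMatrix_mem {δ : ℕ} (hc : c ∈ homogeneousFunctions V δ) (i k : Fin r) :
    averageMatrix τ T c i k ∈ homogeneousFunctions V δ := by
  have h : averageMatrix τ T c i k = ∑ g, T g i k • fun v => c (τ g v) := by
    funext v
    simp [averageMatrix, twistedAverage, Matrix.sum_apply, mul_comm]
  rw [h]
  exact Submodule.sum_mem _ fun g _ => Submodule.smul_mem _ _
    (comp_mem_linearForms_pow (τ g) bot_le hc)

lemma det_averageMatrix (v : V) :
    (averageMatrix τ T c).det v = (twistedAverage τ T c v).det :=
  RingHom.map_det (Pi.evalRingHom (fun _ : V => ℂ) v) (averageMatrix τ T c)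

/-- Under `g` the determinant changes by the factor `(det T(g))⁻¹`, a root of unity of order
dividing `|G|`. -/
lemma det_averageMatrix_pow_invariant :
    (averageMatrix τ T c).det ^ Fintype.card G ∈ invariantFunctions τ := by
  intro g v
  rw [Pi.pow_apply, Pi.pow_apply, det_averageMatrix, det_averageMatrix,
    ← twistedAverage_mul τ T c g v, Matrix.det_mul, mul_pow, ← Matrix.det_pow (T g), ← map_pow,
    pow_card_eq_one, map_one, Matrix.det_one, mul_one]

lemma twistedAverage_eq_one [DecidableEq G] {v₀ : V} (h1 : c v₀ = 1)
    (h0 : ∀ g, g ≠ 1 → c (τ g v₀) = 0) :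
    twistedAverage τ T c v₀ = 1 := by
  rw [twistedAverage, Finset.sum_eq_single 1]
  · rw [map_one, map_one, Module.End.one_apply, h1, one_smul]
  · intro g _ hg
    rw [h0 g hg, zero_smul]
  · exact fun h => absurd (Finset.mem_univ _) h

end TwistedAverage

/-! ### Construction of a frame -/

section ExistsFrame

variable {G : Type} [Group G] {W : Type} [AddCommGroup W] [Module ℂ W]
  {ρ : Representation ℂ G W} (I J : Subrepresentation ρ)
  (hIJ : IsCompl I.toSubmodule J.toSubmodule)

lemma coord_mem_linearForms {r : ℕ} (b : Module.Basis (Fin r) ℂ J.toSubmodule) (k : Fin r) :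
    (fun w => b.repr (J.toSubmodule.projectionOnto I.toSubmodule hIJ.symm w) k) ∈
      linearForms I.toSubmodule := by
  refine ⟨(b.coord k).comp (J.toSubmodule.projectionOnto I.toSubmodule hIJ.symm), ?_, rfl⟩
  rw [SetLike.mem_coe, Submodule.mem_dualAnnihilator]
  intro w hw
  rw [LinearMap.comp_apply, (Submodule.projectionOnto_apply_eq_zero_iff hIJ.symm).mpr hw, map_zero]

variable [Fintype G]

/-- A pair of invariant forms of consecutive degrees and a vector whose line has trivial stabilizer
give a frame. -/
lemma exists_frame {r : ℕ} (hr : 0 < r) (b : Module.Basis (Fin r) ℂ J.toSubmodule) {e : ℕ}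
    {f₁ f₂ : I.toSubmodule → ℂ} (hf₁ : f₁ ∈ invariantForms I.toRepresentation (e + 1))
    (hf₂ : f₂ ∈ invariantForms I.toRepresentation e) {v₀ : I.toSubmodule}
    (h0 : v₀ ≠ 0) (hv : ∀ g, g ≠ 1 → ∀ a : ℂ, I.toRepresentation g v₀ ≠ a • v₀)
    (hf : f₁ v₀ * f₂ v₀ ≠ 0) : ∃ F : Frame I J hIJ r, F.e = e ∧ F.f₁ = f₁ ∧ F.f₂ = f₂ := by
  classical
  obtain ⟨r, rfl⟩ := Nat.exists_eq_add_one_of_ne_zero hr.ne'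
  obtain ⟨c, hc, hc1, hc0⟩ := exists_separating I.toRepresentation h0 hv
  set δ := Fintype.card G - 1
  let T : G →* Matrix (Fin (r + 1)) (Fin (r + 1)) ℂ :=
    (LinearMap.toMatrixAlgEquiv b : _ →* _).comp J.toRepresentation
  have hT : ∀ g (x : J.toSubmodule), T g *ᵥ b.repr x = b.repr (J.toRepresentation g x) :=
    fun g x => LinearMap.toMatrix_mulVec_repr b b (J.toRepresentation g) x
  let A := twistedAverage I.toRepresentation T c
  let M := averageMatrix I.toRepresentation T c
  have hM := averageMatrix_mem I.toRepresentation T c hc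
  let π := I.toSubmodule.projectionOnto J.toSubmodule hIJ
  let π' := J.toSubmodule.projectionOnto I.toSubmodule hIJ.symm
  let n := Fintype.card G
  have hn : n - 1 + 1 = n := Nat.sub_add_cancel Fintype.card_pos
  let Φ : (I.toSubmodule → ℂ) →ₐ[ℂ] (W → ℂ) :=
    { toFun := pullbackFn I J hIJ
      map_one' := rfl
      map_mul' := fun _ _ => rfl
      map_zero' := rfl
      map_add' := fun _ _ => rfl
      commutes' := fun _ => rfl }
  let x : Fin (r + 1) → W → ℂ := fun k w => b.repr (π' w) k
  have hx : ∀ k, x k ∈ linearForms I.toSubmodule := coord_mem_linearForms I J hIJ b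
  have hφ : ∀ i w, (A (π w) *ᵥ b.repr (π' w)) i = ∑ k, Φ (M i k) w * x k w := fun _ _ => rfl
  refine ⟨{
    e := e
    -- The matrix has size `r + 1` and entries of degree `δ`; the power `n = |G|` makes its
    -- determinant invariant.
    q := (δ * (r + 1)) * n
    δ := δ
    f₁ := f₁
    f₂ := f₂
    D := M.det ^ n
    φ := fun i w => (A (π w) *ᵥ b.repr (π' w)) i
    f₁_mem := hf₁
    f₂_mem := hf₂
    D_mem := ⟨?_, det_averageMatrix_pow_invariant _ _ _⟩
    φ_mem := ?_
    φ_inv := ?_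
    le := ?_
    cramer := ?_
    surj := ?_
    exists_ne_zero := ⟨v₀, ?_⟩ }, rfl, rfl, rfl⟩
  · have h := Submodule.pow_mem_pow _ (det_mem_pow _ hM) n
    rw [homogeneousFunctions, ← pow_mul, ← pow_mul] at h
    rw [SetLike.mem_coe, mul_assoc]
    exact h
  · intro i
    have h : (fun w => (A (π w) *ᵥ b.repr (π' w)) i) = ∑ k, Φ (M i k) * x k := by
      funext w
      rw [Finset.sum_apply]
      exact hφ i w
    rw [h]
    refine Submodule.sum_mem _ fun k _ => Submodule.mul_mem_mul ?_ ?_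
    · exact pullbackFn_mem_pow I J hIJ (hM i k)
    · rw [homogeneousFunctions, pow_one]
      exact linearForms_mono bot_le (hx k)
  · intro i g w
    change (A (π (ρ g w)) *ᵥ b.repr (π' (ρ g w))) i = _
    rw [projectionOnto_apply_rho I J hIJ, projectionOnto_apply_rho J I hIJ.symm, ← hT,
      Matrix.mulVec_mulVec]
    exact congrArg (fun B => (B *ᵥ b.repr (π' w)) i) (twistedAverage_mul I.toRepresentation T c g _)
  · rw [mul_assoc]
    exact Nat.le_mul_of_pos_right _ (Nat.mul_pos (Nat.succ_pos r) Fintype.card_pos)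
  · rintro _ ⟨l, hl, rfl⟩
    rw [SetLike.mem_coe, Submodule.mem_dualAnnihilator] at hl
    -- Since `φ = A x`, one has `det ^ n • x = det ^ (n - 1) • adj(A) φ`; the coefficients have
    -- degree `δ (r + 1) (n - 1) + δ r = q - δ`.
    refine ⟨fun i => ∑ k, l (b k) • Φ (M.det ^ (n - 1) * M.adjugate k i), fun i => ?_, ?_⟩
    · refine Submodule.sum_mem _ fun k _ => Submodule.smul_mem _ _ ?_
      suffices h : M.det ^ (n - 1) * M.adjugate k i ∈
          homogeneousFunctions I.toSubmodule (δ * (r + 1) * n - δ) from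
        pullbackFn_mem_pow I J hIJ h
      have h1 := Submodule.pow_mem_pow _ (det_mem_pow _ hM) (n - 1)
      have h := Submodule.mul_mem_mul h1 (adjugate_mem_pow _ hM k i)
      rw [homogeneousFunctions, ← pow_mul, ← pow_mul, ← pow_mul, ← pow_add] at h
      rw [homogeneousFunctions]
      convert! h using 2
      rw [← hn]
      simp only [Nat.add_sub_cancel]
      rw [Nat.sub_eq_iff_eq_add]
      · ring
      · nlinarith [Nat.zero_le (δ * (r + 1) * (n - 1)), Nat.zero_le (δ * r)]
    · funext w
      have hl' : l w = ∑ k, l (b k) * b.repr (π' w) k := by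
        have h1 : l w = l (π' w) := by
          have h2 : w - π' w ∈ I.toSubmodule := by
            rw [← Submodule.projectionOnto_apply_eq_zero_iff hIJ.symm, map_sub,
              Submodule.projectionOnto_apply_left, sub_self]
          rw [← sub_eq_zero, ← map_sub]
          exact hl _ h2
        rw [h1]
        refine (congrArg (fun y : J.toSubmodule => l y) (b.sum_repr (π' w)).symm).trans ?_
        rw [AddSubmonoidClass.coe_finsetSum, map_sum]
        refine Finset.sum_congr rfl fun k _ => ?_
        rw [SetLike.val_smul, map_smul, smul_eq_mul, mul_comm]
      have hdet : ∀ k, M.det (π w) * b.repr (π' w) k =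
          ∑ i, M.adjugate k i (π w) * (A (π w) *ᵥ b.repr (π' w)) i := by
        intro k
        have h1 : M.adjugate.map (Pi.evalRingHom (fun _ => ℂ) (π w)) = (A (π w)).adjugate :=
          RingHom.map_adjugate (Pi.evalRingHom (fun _ => ℂ) (π w)) M
        have h2 : ∀ i, M.adjugate k i (π w) = (A (π w)).adjugate k i :=
          fun i => congrFun (congrFun h1 k) i
        simp only [h2]
        change _ = ((A (π w)).adjugate *ᵥ (A (π w) *ᵥ b.repr (π' w))) k
        rw [Matrix.mulVec_mulVec, Matrix.adjugate_mul, Matrix.smul_mulVec, Matrix.one_mulVec]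
        exact congrArg (· * _) (det_averageMatrix _ _ _ _)
      rw [Pi.mul_apply, Finset.sum_apply]
      change (M.det ^ n) (π w) * l w = _
      rw [hl', Pi.pow_apply, ← hn, pow_succ, mul_assoc]
      simp only [Finset.mul_sum, Pi.mul_apply, Finset.sum_apply, Finset.sum_mul, Pi.smul_apply,
        smul_eq_mul]
      rw [Finset.sum_comm]
      refine Finset.sum_congr rfl fun k _ => ?_
      rw [show ∀ y z u s : ℂ, y * (z * (u * s)) = y * u * (z * s) by intros; ring, hdet,
        Finset.mul_sum]
      refine Finset.sum_congr rfl fun i _ => ?_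
      change _ = l (b k) * ((M.det ^ (n - 1)) (π w) * M.adjugate k i (π w)) * _
      rw [Pi.pow_apply]
      ring
  · intro v hD z
    have hA : (A v).det ≠ 0 := by
      intro h
      refine hD ?_
      rw [Pi.pow_apply, det_averageMatrix]
      exact (congrArg (· ^ n) h).trans (zero_pow Fintype.card_ne_zero)
    let y : J.toSubmodule := b.equivFun.symm ((A v)⁻¹ *ᵥ z)
    have h1 : π (v + y) = v := by
      rw [map_add, Submodule.projectionOnto_apply_left, Submodule.projectionOnto_apply_right,
        add_zero]
    have h2 : π' (v + y) = y := by
      rw [map_add, Submodule.projectionOnto_apply_left, Submodule.projectionOnto_apply_right,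
        zero_add]
    refine ⟨v + y, h1, fun i => ?_⟩
    rw [h1, h2]
    have h3 : (b.repr y : Fin (r + 1) → ℂ) = (A v)⁻¹ *ᵥ z := b.equivFun.apply_symm_apply _
    rw [h3, Matrix.mulVec_mulVec, Matrix.mul_nonsing_inv _ (Ne.isUnit hA), Matrix.one_mulVec]
  · rw [Pi.pow_apply, det_averageMatrix, twistedAverage_eq_one _ _ _ hc1 hc0, Matrix.det_one,
      one_pow, mul_one]
    exact hf

end ExistsFrame


open scoped Matrix

/-! ### Homogeneity of polynomial functions -/

section Homogeneous

variable {V : Type} [AddCommGroup V] [Module ℂ V]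

lemma homogeneousFunctions_smul {n : ℕ} {f : V → ℂ} (hf : f ∈ homogeneousFunctions V n) (c : ℂ)
    (v : V) : f (c • v) = c ^ n * f v := by
  induction n generalizing f with
  | zero =>
    rw [homogeneousFunctions, pow_zero] at hf
    obtain ⟨a, rfl⟩ := Submodule.mem_one.mp hf
    rw [pow_zero, one_mul]
    rfl
  | succ n ih =>
    rw [homogeneousFunctions, pow_succ] at hf
    induction hf using Submodule.mul_induction_on' with
    | mem_mul_mem x hx y hy =>
      obtain ⟨l, -, rfl⟩ := hy
      rw [Pi.mul_apply, Pi.mul_apply, ih hx]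
      change _ * l (c • v) = _ * (_ * l v)
      rw [map_smul, smul_eq_mul]
      ring
    | add x _ y _ hx hy => rw [Pi.add_apply, Pi.add_apply, hx, hy, mul_add]

lemma linearMap_mem_linearForms (l : V →ₗ[ℂ] ℂ) :
    (l : V → ℂ) ∈ linearForms (⊥ : Submodule ℂ V) := by
  refine ⟨l, ?_, rfl⟩
  rw [SetLike.mem_coe, Submodule.mem_dualAnnihilator]
  intro w hw
  rw [(Submodule.mem_bot ℂ).mp hw, map_zero]

end Homogeneous

/-! ### Linear forms on the hyperplane -/

section Hyperplane

/-- The coordinates on the hyperplane. -/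
def hcoord (i : Fin 6) : hyperplane →L[ℂ] ℂ :=
  (ContinuousLinearMap.proj i).comp hyperplane.subtypeL

lemma sum_hcoord (z : hyperplane) : ∑ i, hcoord i z = 0 := z.2

/-- A linear form on the hyperplane is a combination of the coordinates. -/
lemma exists_eq_sum_hcoord {f : hyperplane → ℂ}
    (hf : f ∈ linearForms (⊥ : Submodule ℂ hyperplane)) :
    ∃ a : Fin 6 → ℂ, ∀ z, f z = ∑ i, a i * hcoord i z := by
  obtain ⟨l, -, rfl⟩ := hf
  obtain ⟨l', hl'⟩ := LinearMap.exists_extend l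
  refine ⟨fun i => l' (Pi.single i 1), fun z => ?_⟩
  change l z = _
  rw [← hl']
  change l' (z : Fin 6 → ℂ) = _
  rw [LinearMap.pi_apply_eq_sum_univ l']
  refine Finset.sum_congr rfl fun i _ => ?_
  rw [smul_eq_mul, mul_comm]
  congr 2
  funext j
  simp [Pi.single_apply, eq_comm]

/-- The vector `eᵢ - eⱼ`. -/
def diffVec (i j : Fin 6) : hyperplane := ⟨Pi.single i 1 - Pi.single j 1, by
  change ∑ k, _ = 0
  simp [Finset.sum_sub_distrib]⟩

lemma hcoord_diffVec (i j k : Fin 6) :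
    hcoord k (diffVec i j) = (if k = i then 1 else 0) - if k = j then 1 else 0 := by
  change (Pi.single i 1 - Pi.single j 1 : Fin 6 → ℂ) k = _
  rw [Pi.sub_apply, Pi.single_apply, Pi.single_apply]

lemma sum_mul_hcoord_diffVec (a : Fin 6 → ℂ) (i j : Fin 6) :
    ∑ k, a k * hcoord k (diffVec i j) = a i - a j := by
  simp [hcoord_diffVec, mul_sub, Finset.sum_sub_distrib]

/-- Test on `eᵢ - eⱼ`. In the study of the Segre cubic this plays the part of a Lagrange multiplier.
-/
lemma eq_of_forall_sum_mul_hcoord {a : Fin 6 → ℂ} (h : ∀ u, ∑ k, a k * hcoord k u = 0)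
    (i j : Fin 6) : a i = a j := by
  rw [← sub_eq_zero, ← sum_mul_hcoord_diffVec]
  exact h _

end Hyperplane

/-! ### The singular points of the Segre cubic -/

section Segre

section SumOfCubes

variable {E : Type} [NormedAddCommGroup E] [NormedSpace ℂ E] (x : Fin 6 → E →L[ℂ] ℂ)

lemma fderiv_sum_cube : fderiv ℂ (fun z => ∑ i, x i z ^ 3) =
    fun z => ∑ i, (3 * x i z ^ 2) • x i := by
  funext z
  refine HasFDerivAt.fderiv (HasFDerivAt.fun_sum fun i _ => ?_)
  simpa using (x i).hasFDerivAt (x := z) |>.pow 3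

lemma fderiv_fderiv_sum_cube (z w u : E) :
    fderiv ℂ (fderiv ℂ fun z => ∑ i, x i z ^ 3) z w u = ∑ i, (6 * x i z * x i w) * x i u := by
  have h : ∀ i ∈ Finset.univ, HasFDerivAt (fun z => (3 * x i z ^ 2) • x i)
      (((3 * (2 * x i z)) • x i).smulRight (x i)) z := fun i _ => by
    have h1 := (((x i).hasFDerivAt (x := z) |>.pow 2).const_mul 3).smul_const (x i)
    convert! h1 using 2
    ext v
    simp
    ring
  rw [fderiv_sum_cube, (HasFDerivAt.fun_sum h).fderiv, sum_apply, sum_apply]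
  refine Finset.sum_congr rfl fun i _ => ?_
  simp only [ContinuousLinearMap.smulRight_apply, smul_apply, smul_eq_mul]
  ring

end SumOfCubes

lemma fderiv_segreCubic :
    fderiv ℂ segreCubic = fun z => ∑ i, (3 * hcoord i z ^ 2) • hcoord i :=
  fderiv_sum_cube hcoord

lemma fderiv_fderiv_segreCubic (z w u : hyperplane) :
    fderiv ℂ (fderiv ℂ segreCubic) z w u =
      ∑ i, (6 * hcoord i z * hcoord i w) * hcoord i u :=
  fderiv_fderiv_sum_cube hcoord z w u

/-- The vectors whose coordinates have the same square. -/
def IsBalanced (z : hyperplane) : Prop := ∀ i j, hcoord i z ^ 2 = hcoord j z ^ 2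

/-- The differential vanishes along the hyperplane exactly when the ambient gradient `(3 zᵢ²)` is a
multiple of `(1, …, 1)`. -/
lemma fderiv_segreCubic_eq_zero_iff {z : hyperplane} :
    fderiv ℂ segreCubic z = 0 ↔ IsBalanced z := by
  rw [fderiv_segreCubic]
  constructor
  · intro h i j
    have h1 := eq_of_forall_sum_mul_hcoord (a := fun i => 3 * hcoord i z ^ 2) (fun u => by
      have := congrArg (fun l => l u) h
      simpa [sum_apply] using this) i j
    exact mul_left_cancel₀ three_ne_zero h1
  · intro h
    ext u
    rw [sum_apply, zero_apply]
    simp only [smul_apply, smul_eq_mul, h _ 0]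
    rw [← Finset.mul_sum, sum_hcoord, mul_zero]

lemma IsBalanced.segreCubic_eq_zero {z : hyperplane} (h : IsBalanced z) : segreCubic z = 0 := by
  have h1 : segreCubic z = ∑ i, hcoord 0 z ^ 2 * hcoord i z :=
    Finset.sum_congr rfl fun i _ => by rw [h 0 i, ← pow_succ]; rfl
  rw [h1, ← Finset.mul_sum, sum_hcoord, mul_zero]

lemma mem_segreSing_iff {x : Projectivization ℂ hyperplane} :
    x ∈ segreSing ↔ IsBalanced x.rep :=
  ⟨fun h => fderiv_segreCubic_eq_zero_iff.mp h.2,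
    fun h => ⟨h.segreCubic_eq_zero, fderiv_segreCubic_eq_zero_iff.mpr h⟩⟩

lemma IsBalanced.smul {z : hyperplane} (h : IsBalanced z) (c : ℂ) : IsBalanced (c • z) := by
  intro i j
  rw [map_smul, map_smul, smul_eq_mul, smul_eq_mul, mul_pow, mul_pow, h i j]

lemma mk_mem_segreSing {z : hyperplane} (hz : z ≠ 0) :
    Projectivization.mk ℂ z hz ∈ segreSing ↔ IsBalanced z := by
  rw [mem_segreSing_iff]
  obtain ⟨a, ha⟩ := Projectivization.exists_smul_eq_mk_rep ℂ z hz
  rw [← ha]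
  refine ⟨fun h => ?_, fun h => h.smul _⟩
  have := IsBalanced.smul h (a⁻¹ : ℂˣ)
  rwa [← Units.smul_def, inv_smul_smul] at this

/-- For `w` in the kernel of the Hessian, the products `zᵢ wᵢ` do not depend on `i`. Neither do the
`zᵢ²`, which are nonzero, so `w` is proportional to `z`. The radial direction is thus the whole
kernel, which is nondegeneracy of the singular point in `ℙ⁴`. -/
lemma mem_span_of_hessian {z w : hyperplane} (h0 : z ≠ 0) (hz : IsBalanced z)
    (h : ∀ u, fderiv ℂ (fderiv ℂ segreCubic) z w u = 0) : w ∈ Submodule.span ℂ {z} := by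
  simp only [fderiv_fderiv_segreCubic] at h
  have h1 := fun i => eq_of_forall_sum_mul_hcoord h i 0
  have h2 : hcoord 0 z ≠ 0 := by
    intro h3
    refine h0 (Subtype.ext (funext fun i => ?_))
    have := hz i 0
    rw [h3, zero_pow two_ne_zero] at this
    exact pow_eq_zero_iff two_ne_zero |>.mp this
  refine Submodule.mem_span_singleton.mpr ⟨hcoord 0 w / hcoord 0 z,
    Subtype.ext (funext fun i => ?_)⟩
  change hcoord 0 w / hcoord 0 z * hcoord i z = hcoord i w
  have h3 : hcoord i z ≠ 0 := by
    rw [← pow_ne_zero_iff two_ne_zero, hz i 0]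
    exact pow_ne_zero 2 h2
  rw [div_mul_eq_mul_div, div_eq_iff h2]
  refine mul_left_cancel₀ h3 ?_
  linear_combination (hcoord 0 w) * hz i 0 - (hcoord 0 z) / 6 * h1 i

/-- The vector with coordinates `1` on `A` and `-1` outside. -/
def signVec (A : {A : Finset (Fin 6) // A.card = 3 ∧ 0 ∈ A}) : hyperplane :=
  ⟨fun i => if i ∈ A.1 then 1 else -1, by
    change ∑ i, (if i ∈ A.1 then (1 : ℂ) else -1) = 0
    have h : ∀ i, (if i ∈ A.1 then (1 : ℂ) else -1) = 2 * (if i ∈ A.1 then 1 else 0) - 1 := by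
      intro i
      split_ifs <;> norm_num
    simp only [h, Finset.sum_sub_distrib, ← Finset.mul_sum, Finset.sum_ite_mem]
    simp [A.2.1]
    norm_num⟩

lemma hcoord_signVec (A) (i : Fin 6) : hcoord i (signVec A) = if i ∈ A.1 then 1 else -1 := rfl

lemma signVec_ne_zero (A) : signVec A ≠ 0 := by
  intro h
  have := hcoord_signVec A 0
  rw [h, map_zero, if_pos A.2.2] at this
  exact zero_ne_one this

lemma isBalanced_signVec (A) : IsBalanced (signVec A) := by
  intro i j
  rw [hcoord_signVec, hcoord_signVec]
  split_ifs <;> norm_num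

lemma IsBalanced.hcoord_ne_zero {z : hyperplane} (hz : IsBalanced z) (h0 : z ≠ 0) (i : Fin 6) :
    hcoord i z ≠ 0 := by
  intro h
  refine h0 (Subtype.ext (funext fun j => ?_))
  have := hz j i
  rw [h, zero_pow two_ne_zero] at this
  exact pow_eq_zero_iff two_ne_zero |>.mp this

/-- Dividing by `z 0` leaves coordinates `±1`, and the vanishing of their sum forces three of each
sign. -/
lemma IsBalanced.exists_eq_smul_signVec {z : hyperplane} (hz : IsBalanced z) (h0 : z ≠ 0) :
    ∃ A, z = hcoord 0 z • signVec A := by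
  have h1 := hz.hcoord_ne_zero h0 0
  have h2 : ∀ i, hcoord i z = hcoord 0 z * if hcoord i z = hcoord 0 z then 1 else -1 := by
    intro i
    split_ifs with h
    · rw [mul_one, h]
    · rw [mul_neg_one]
      exact (sq_eq_sq_iff_eq_or_eq_neg.mp (hz i 0)).resolve_left h
  let A : Finset (Fin 6) := Finset.univ.filter fun i => hcoord i z = hcoord 0 z
  have h3 : A.card = 3 := by
    have h4 := sum_hcoord z
    have h5 : ∀ i, hcoord i z = hcoord 0 z * (2 * (if i ∈ A then 1 else 0) - 1) := by
      intro i
      rw [h2 i]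
      congr 1
      simp only [A, Finset.mem_filter, Finset.mem_univ, true_and]
      split_ifs <;> norm_num
    rw [Finset.sum_congr rfl fun i _ => h5 i, ← Finset.mul_sum] at h4
    have h6 := (mul_eq_zero.mp h4).resolve_left h1
    simp only [Finset.sum_sub_distrib, ← Finset.mul_sum, Finset.sum_ite_mem] at h6
    simp only [Finset.univ_inter, Finset.sum_const, nsmul_eq_mul, mul_one, Finset.card_univ,
      Fintype.card_fin] at h6
    have h7 : (A.card : ℂ) = (3 : ℕ) := by
      push_cast at h6 ⊢
      linear_combination h6 / 2
    exact_mod_cast h7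
  refine ⟨⟨A, h3, by simp [A]⟩, Subtype.ext (funext fun i => (h2 i).trans ?_)⟩
  change _ = hcoord 0 z * hcoord i (signVec _)
  rw [hcoord_signVec]
  simp [A]

lemma ncard_segreSing : segreSing.ncard = 10 := by
  have h : segreSing =
      Set.range fun A => Projectivization.mk ℂ (signVec A) (signVec_ne_zero A) := by
    ext x
    induction x using Projectivization.ind with
    | h z hz =>
      rw [mk_mem_segreSing]
      constructor
      · intro h
        obtain ⟨A, hA⟩ := h.exists_eq_smul_signVec hz
        refine ⟨A, ?_⟩
        refine (Projectivization.mk_eq_mk_iff' ℂ _ _ _ _).mpr ⟨(hcoord 0 z)⁻¹, ?_⟩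
        nth_rewrite 2 [hA]
        exact inv_smul_smul₀ (h.hcoord_ne_zero hz 0) _
      · rintro ⟨A, hA⟩
        rw [← mk_mem_segreSing hz, ← hA, mk_mem_segreSing]
        exact isBalanced_signVec A
  have hinj : Function.Injective
      fun A => Projectivization.mk ℂ (signVec A) (signVec_ne_zero A) := by
    intro A B hAB
    obtain ⟨a, ha⟩ := (Projectivization.mk_eq_mk_iff' ℂ _ _ _ _).mp hAB
    have h1 : ∀ i, a * hcoord i (signVec B) = hcoord i (signVec A) := fun i => by
      rw [← ha, map_smul, smul_eq_mul]
    simp only [hcoord_signVec] at h1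
    have h2 := h1 0
    rw [if_pos B.2.2, if_pos A.2.2, mul_one] at h2
    refine Subtype.ext (Finset.ext fun i => ?_)
    have h3 := h1 i
    rw [h2, one_mul] at h3
    by_cases hB : i ∈ B.1 <;> by_cases hA : i ∈ A.1
    · exact iff_of_true hA hB
    · rw [if_pos hB, if_neg hA] at h3
      norm_num at h3
    · rw [if_neg hB, if_pos hA] at h3
      norm_num at h3
    · exact iff_of_false hA hB
  rw [h, Set.ncard_range_of_injective hinj, Nat.card_eq_fintype_card]
  -- The three-element subsets containing `0`: a choice of two among the other five indices.
  decide

end Segre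

/-! ### Quadrics through the singular points -/

section Quadrics

/-- The subrepresentation of the quadrics through the singular points of the Segre cubic. -/
def segreQuadrics : Subrepresentation quadricRep where
  toSubmodule :=
    { carrier := {Q | ∀ z, IsBalanced z → (Q : hyperplane → ℂ) z = 0}
      add_mem' := fun {Q R} hQ hR z hz => by
        change (Q : hyperplane → ℂ) z + (R : hyperplane → ℂ) z = 0
        rw [hQ z hz, hR z hz, add_zero]
      zero_mem' := fun _ _ => rfl
      smul_mem' := fun c Q hQ z hz => by
        change c * (Q : hyperplane → ℂ) z = 0
        rw [hQ z hz, mul_zero] }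
  apply_mem_toSubmodule σ Q hQ z hz := hQ _ fun i j => hz _ _

lemma mem_segreQuadrics_iff (Q : quadrics) : Q ∈ segreQuadrics.toSubmodule ↔
    ∀ x ∈ segreSing, (Q : hyperplane → ℂ) x.rep = 0 := by
  constructor
  · exact fun h x hx => h _ (mem_segreSing_iff.mp hx)
  · intro h z hz
    by_cases h0 : z = 0
    · have := homogeneousFunctions_smul Q.2 0 z
      rw [zero_smul, zero_pow two_ne_zero, zero_mul] at this
      rw [h0, this]
    · have h1 := h _ ((mk_mem_segreSing h0).mpr hz)
      obtain ⟨a, ha⟩ := Projectivization.exists_smul_eq_mk_rep ℂ z h0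
      rw [← ha, Units.smul_def, homogeneousFunctions_smul Q.2] at h1
      exact (mul_eq_zero.mp h1).resolve_left (pow_ne_zero _ a.ne_zero)

/-- A quadratic form on the hyperplane has a unique symmetric matrix with vanishing diagonal. -/
lemma exists_matrix (Q : quadrics) : ∃ b : Fin 6 → Fin 6 → ℂ, (∀ i j, b i j = b j i) ∧
    (∀ i, b i i = 0) ∧
    ∀ z, (Q : hyperplane → ℂ) z = ∑ i, ∑ j, b i j * (hcoord i z * hcoord j z) := by
  obtain ⟨Q, hQ⟩ := Q
  have h : ∃ c : Fin 6 → Fin 6 → ℂ, ∀ z, Q z = ∑ i, ∑ j, c i j * (hcoord i z * hcoord j z) := by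
    rw [quadrics, homogeneousFunctions, pow_two] at hQ
    induction hQ using Submodule.mul_induction_on' with
    | mem_mul_mem x hx y hy =>
      obtain ⟨a, ha⟩ := exists_eq_sum_hcoord hx
      obtain ⟨b, hb⟩ := exists_eq_sum_hcoord hy
      refine ⟨fun i j => a i * b j, fun z => ?_⟩
      rw [Pi.mul_apply, ha, hb, Finset.sum_mul_sum]
      exact Finset.sum_congr rfl fun i _ => Finset.sum_congr rfl fun j _ => by ring
    | add x _ y _ hx hy =>
      obtain ⟨a, ha⟩ := hx
      obtain ⟨b, hb⟩ := hy
      refine ⟨fun i j => a i j + b i j, fun z => ?_⟩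
      rw [Pi.add_apply, ha, hb]
      simp only [add_mul, Finset.sum_add_distrib]
  obtain ⟨c, hc⟩ := h
  -- After symmetrization, the terms `c i i * zᵢ zⱼ` and `c j j * zᵢ zⱼ` may be subtracted, as they
  -- sum to zero on the hyperplane; this clears the diagonal.
  refine ⟨fun i j => (c i j + c j i - c i i - c j j) / 2, fun i j => by ring, fun i => by ring,
    fun z => ?_⟩
  have h1 : ∑ i, ∑ j, c j i * (hcoord i z * hcoord j z) = Q z := by
    rw [hc, Finset.sum_comm]
    exact Finset.sum_congr rfl fun i _ => Finset.sum_congr rfl fun j _ => by ring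
  have h2 : ∑ i, ∑ j, c i i * (hcoord i z * hcoord j z) = 0 := by
    simp only [← mul_assoc, ← Finset.mul_sum, sum_hcoord, mul_zero, Finset.sum_const_zero]
  have h3 : ∑ i, ∑ j, c j j * (hcoord i z * hcoord j z) = 0 := by
    rw [Finset.sum_comm, ← h2]
    exact Finset.sum_congr rfl fun i _ => Finset.sum_congr rfl fun j _ => by ring
  have h4 : ∀ i j, (c i j + c j i - c i i - c j j) / 2 * (hcoord i z * hcoord j z) =
      (c i j * (hcoord i z * hcoord j z) + c j i * (hcoord i z * hcoord j z) -
        c i i * (hcoord i z * hcoord j z) - c j j * (hcoord i z * hcoord j z)) / 2 :=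
    fun i j => by ring
  simp only [h4, ← Finset.sum_div, Finset.sum_sub_distrib, Finset.sum_add_distrib, h1, h2, h3,
    ← hc]
  ring

/-- Add the conditions at the four sign vectors that are `+1` at `i`, at `j` and at one further
index. The entries away from rows and columns `i` and `j` cancel, since each occurs twice with
either sign. -/
lemma eq_of_forall_sign {b : Fin 6 → Fin 6 → ℂ} (hs : ∀ i j, b i j = b j i) (h0 : ∀ i, b i i = 0)
    (h : ∀ ε : Fin 6 → ℂ, (∀ i, ε i = 1 ∨ ε i = -1) → ∑ i, ε i = 0 →
      ∑ i, ∑ j, b i j * (ε i * ε j) = 0) {i j : Fin 6} (hij : i ≠ j) :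
    4 * b i j = ∑ k, b i k + ∑ k, b j k := by
  wlog hij' : i = 0 ∧ j = 1 generalizing b i j
  · obtain ⟨σ, hσ⟩ : ∃ σ : Equiv.Perm (Fin 6), σ 0 = i ∧ σ 1 = j := by
      refine ⟨(Equiv.swap 0 i) * (Equiv.swap 1 (Equiv.swap 0 i j)), ?_, ?_⟩
      · have h1 : Equiv.swap 0 i j ≠ 0 := by
          intro h1
          rw [Equiv.swap_apply_eq_iff, Equiv.swap_apply_left] at h1
          exact hij h1.symm
        rw [Equiv.Perm.mul_apply, Equiv.swap_apply_of_ne_of_ne (by decide) h1.symm,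
          Equiv.swap_apply_left]
      · rw [Equiv.Perm.mul_apply, Equiv.swap_apply_left, Equiv.swap_apply_self]
    have h2 := this (b := fun k l => b (σ k) (σ l)) (i := 0) (j := 1) (fun _ _ => hs _ _)
      (fun _ => h0 _) (fun ε hε hε' => ?_) (by decide) ⟨rfl, rfl⟩
    · rw [hσ.1, hσ.2, Equiv.sum_comp σ (b i), Equiv.sum_comp σ (b j)] at h2
      exact h2
    · have h3 := h (fun k => ε (σ.symm k)) (fun k => hε _)
        ((Equiv.sum_comp σ.symm ε).trans hε')
      rw [← Equiv.sum_comp σ] at h3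
      refine Eq.trans (Finset.sum_congr rfl fun k _ => ?_) h3
      rw [← Equiv.sum_comp σ (fun l => b (σ k) l * _)]
      simp only [Equiv.symm_apply_apply]
  obtain ⟨rfl, rfl⟩ := hij'
  have h1 := h ![1, 1, 1, -1, -1, -1] (by intro i; fin_cases i <;> simp)
    (by simp [Fin.sum_univ_six])
  have h2 := h ![1, 1, -1, 1, -1, -1] (by intro i; fin_cases i <;> simp)
    (by simp [Fin.sum_univ_six])
  have h3 := h ![1, 1, -1, -1, 1, -1] (by intro i; fin_cases i <;> simp)
    (by simp [Fin.sum_univ_six])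
  have h4 := h ![1, 1, -1, -1, -1, 1] (by intro i; fin_cases i <;> simp)
    (by simp [Fin.sum_univ_six])
  simp only [Fin.sum_univ_six, Matrix.cons_val, h0, hs 1 0, hs 2 0, hs 3 0, hs 4 0, hs 5 0, hs 2 1,
    hs 3 1, hs 4 1, hs 5 1, hs 3 2, hs 4 2, hs 5 2, hs 4 3, hs 5 3, hs 5 4] at h1 h2 h3 h4 ⊢
  linear_combination (h1 + h2 + h3 + h4) / 4

/-- The quadratic form `∑ aᵢ zᵢ²`. -/
def diagonalForm : hyperplane →ₗ[ℂ] quadrics where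
  toFun a := ⟨fun z => ∑ i, hcoord i a * hcoord i z ^ 2, by
    have h : (fun z => ∑ i, hcoord i a * hcoord i z ^ 2) =
        ∑ i, hcoord i a • ((hcoord i : hyperplane → ℂ) * (hcoord i : hyperplane → ℂ)) := by
      funext z
      rw [Finset.sum_apply]
      exact Finset.sum_congr rfl fun i _ => by
        rw [Pi.smul_apply, Pi.mul_apply, smul_eq_mul, pow_two]
    rw [h, quadrics, homogeneousFunctions, pow_two]
    exact Submodule.sum_mem _ fun i _ => Submodule.smul_mem _ _ (Submodule.mul_mem_mul
      (linearMap_mem_linearForms (hcoord i).toLinearMap)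
      (linearMap_mem_linearForms (hcoord i).toLinearMap))⟩
  map_add' a b := by
    ext z
    change ∑ i, hcoord i (a + b) * hcoord i z ^ 2 =
      ∑ i, hcoord i a * hcoord i z ^ 2 + ∑ i, hcoord i b * hcoord i z ^ 2
    simp only [map_add, add_mul, Finset.sum_add_distrib]
  map_smul' c a := by
    ext z
    change ∑ i, hcoord i (c • a) * hcoord i z ^ 2 = c * ∑ i, hcoord i a * hcoord i z ^ 2
    simp only [map_smul, smul_eq_mul, mul_assoc, Finset.mul_sum]

lemma diagonalForm_apply (a z : hyperplane) :
    (diagonalForm a : hyperplane → ℂ) z = ∑ i, hcoord i a * hcoord i z ^ 2 := rfl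

lemma diagonalForm_mem (a : hyperplane) : diagonalForm a ∈ segreQuadrics.toSubmodule := by
  intro z hz
  rw [diagonalForm_apply]
  simp only [hz _ 0]
  rw [← Finset.sum_mul, sum_hcoord, zero_mul]

lemma diagonalForm_equivariant (σ : Equiv.Perm (Fin 6)) (a : hyperplane) :
    diagonalForm (stdRep σ a) = quadricRep σ (diagonalForm a) := by
  ext z
  change ∑ i, hcoord (σ⁻¹ i) a * hcoord i z ^ 2 = ∑ i, hcoord i a * hcoord (σ⁻¹⁻¹ i) z ^ 2
  rw [← Equiv.sum_comp σ, inv_inv]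
  have h : ∀ i, σ⁻¹ (σ i) = i := σ.symm_apply_apply
  simp only [h]

/-- The value at `eᵢ - eⱼ` is `aᵢ + aⱼ`; three distinct indices then give `aᵢ = 0`. -/
lemma diagonalForm_injective : Function.Injective diagonalForm := by
  rw [injective_iff_map_eq_zero]
  intro a ha
  have h : ∀ i j, i ≠ j → hcoord i a + hcoord j a = 0 := by
    intro i j hij
    have h1 : (diagonalForm a : hyperplane → ℂ) (diffVec i j) = 0 := by
      rw [ha]
      rfl
    rw [diagonalForm_apply] at h1
    rw [← h1]
    have h2 : ∀ k, hcoord k (diffVec i j) ^ 2 =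
        (if k = i then 1 else 0) + if k = j then 1 else 0 := by
      intro k
      rw [hcoord_diffVec]
      by_cases hi : k = i
      · rw [if_pos hi, if_neg (hi ▸ hij)]
        norm_num
      · rw [if_neg hi]
        split_ifs <;> norm_num
    simp only [h2, mul_add, Finset.sum_add_distrib, mul_ite, mul_one, mul_zero,
      Finset.sum_ite_eq', Finset.mem_univ, if_true]
  refine Subtype.ext (funext fun i => ?_)
  change hcoord i a = 0
  obtain ⟨j, k, hij, hik, hjk⟩ : ∃ j k : Fin 6, i ≠ j ∧ i ≠ k ∧ j ≠ k := by
    revert i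
    decide
  linear_combination (h i j hij + h i k hik - h j k hjk) / 2

/-- By `eq_of_forall_sign` the off-diagonal entries are `(Sᵢ + Sⱼ) / 4`, with `Sᵢ` the row sums.
Filling in the diagonal by the same formula gives a multiple of `∑ zᵢ`, so only the correction `-½ ∑
Sᵢ zᵢ²` survives. Summing the relations over all pairs yields `∑ Sᵢ = 0`. -/
lemma exists_diagonalForm_eq {Q : quadrics} (hQ : Q ∈ segreQuadrics.toSubmodule) :
    ∃ a, diagonalForm a = Q := by
  obtain ⟨b, hs, h0, hb⟩ := exists_matrix Q
  have h1 : ∀ {i j}, i ≠ j → 4 * b i j = ∑ k, b i k + ∑ k, b j k :=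
      eq_of_forall_sign hs h0 (fun ε hε hε' => by
    have := hQ ⟨ε, hε'⟩ fun i j => by
      change ε i ^ 2 = ε j ^ 2
      obtain h | h := hε i <;> obtain h' | h' := hε j <;> rw [h, h'] <;> norm_num
    rwa [hb] at this)
  have h2 : ∑ i, ∑ j, b i j = 0 := by
    have h3 : ∀ i, ∑ j, (4 * b i j + if i = j then 2 * ∑ k, b i k else 0) =
        ∑ j, (∑ k, b i k + ∑ k, b j k) := by
      intro i
      refine Finset.sum_congr rfl fun j _ => ?_
      split_ifs with h
      · rw [← h, h0]
        ring
      · rw [add_zero, h1 h]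
    have h4 := Finset.sum_congr rfl fun i (_ : i ∈ Finset.univ) => h3 i
    simp only [Finset.sum_add_distrib, ← Finset.mul_sum, Finset.sum_ite_eq, Finset.mem_univ,
      if_true, Finset.sum_const, Finset.card_univ, Fintype.card_fin, nsmul_eq_mul] at h4
    push_cast at h4
    linear_combination -h4 / 6
  let a : hyperplane := ⟨fun i => -(∑ j, b i j) / 2, by
    change ∑ i, -(∑ j, b i j) / 2 = 0
    rw [← Finset.sum_div, Finset.sum_neg_distrib, h2]
    norm_num⟩
  refine ⟨a, Subtype.ext (funext fun z => ?_)⟩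
  rw [diagonalForm_apply, hb]
  have h5 : ∀ i j, b i j * (hcoord i z * hcoord j z) =
      (-(hcoord i a + hcoord j a) / 2 + if i = j then hcoord i a else 0) *
        (hcoord i z * hcoord j z) := by
    intro i j
    congr 1
    change b i j = (-(-(∑ k, b i k) / 2 + -(∑ k, b j k) / 2) / 2 +
      if i = j then -(∑ k, b i k) / 2 else 0)
    split_ifs with h
    · rw [← h, h0]
      ring
    · linear_combination h1 h / 4
  simp only [h5, add_mul, Finset.sum_add_distrib, ite_mul, zero_mul, Finset.sum_ite_eq,
    Finset.mem_univ, if_true]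
  have h6 : ∑ i, ∑ j, -(hcoord i a + hcoord j a) / 2 * (hcoord i z * hcoord j z) = 0 := by
    have h7 : ∑ i, ∑ j, hcoord i a * (hcoord i z * hcoord j z) = 0 := by
      simp only [← Finset.mul_sum, sum_hcoord, mul_zero, Finset.sum_const_zero]
    have h8 : ∑ i, ∑ j, hcoord j a * (hcoord i z * hcoord j z) = 0 := by
      rw [Finset.sum_comm, ← h7]
      exact Finset.sum_congr rfl fun i _ => Finset.sum_congr rfl fun j _ => by ring
    have h9 : ∀ i j, -(hcoord i a + hcoord j a) / 2 * (hcoord i z * hcoord j z) =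
        -(hcoord i a * (hcoord i z * hcoord j z) + hcoord j a * (hcoord i z * hcoord j z)) / 2 :=
      fun i j => by ring
    simp only [h9, ← Finset.sum_div, Finset.sum_neg_distrib, Finset.sum_add_distrib, h7, h8]
    norm_num
  rw [h6, zero_add]
  exact Finset.sum_congr rfl fun i _ => by ring

/-- The quadrics through the singular points of the Segre cubic form the standard
representation. -/
def segreQuadricsEquiv : hyperplane ≃ₗ[ℂ] segreQuadrics.toSubmodule :=
  LinearEquiv.ofBijective (diagonalForm.codRestrict _ diagonalForm_mem)
    ⟨fun _ _ h => diagonalForm_injective (congrArg Subtype.val h), fun Q => by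
      obtain ⟨a, ha⟩ := exists_diagonalForm_eq Q.2
      exact ⟨a, Subtype.ext ha⟩⟩

lemma segreQuadricsEquiv_equivariant (σ : Equiv.Perm (Fin 6)) (a : hyperplane) :
    segreQuadricsEquiv (stdRep σ a) = segreQuadrics.toRepresentation σ (segreQuadricsEquiv a) :=
  Subtype.ext (diagonalForm_equivariant σ a)

lemma nonempty_equiv_stdRep : Nonempty (segreQuadrics.toRepresentation.Equiv stdRep) := by
  have h : ∀ σ, (segreQuadricsEquiv : hyperplane →ₗ[ℂ] segreQuadrics.toSubmodule) ∘ₗ stdRep σ =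
      segreQuadrics.toRepresentation σ ∘ₗ segreQuadricsEquiv :=
    fun σ => LinearMap.ext fun a => segreQuadricsEquiv_equivariant σ a
  exact ⟨(Representation.Equiv.mk segreQuadricsEquiv h).symm⟩

end Quadrics


open scoped Matrix

/-! ### Dimensions and invariant complements -/

section Dimensions

lemma finrank_hyperplane : Module.finrank ℂ hyperplane = 5 := by
  let l : Module.Dual ℂ (Fin 6 → ℂ) := ∑ i, LinearMap.proj i
  have hl : ∀ z, l z = ∑ i, z i := fun z => by simp [l]
  have h : hyperplane = LinearMap.ker l := by
    ext z
    rw [LinearMap.mem_ker, hl]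
    rfl
  have h0 : l ≠ 0 := by
    intro h1
    have h2 := hl (Pi.single 0 1)
    rw [h1] at h2
    simp at h2
  have h3 := Module.Dual.finrank_ker_add_one_of_ne_zero h0
  rw [← h, Module.finrank_fin_fun] at h3
  omega

/-- The pairs of distinct coordinates. -/
abbrev CoordPair : Type := {p : Fin 6 × Fin 6 // p.1 < p.2}

/-- The quadratic form `∑ q_p z_i z_j`, the sum being over the pairs `p = {i, j}` of distinct
coordinates. -/
def pairForm : (CoordPair → ℂ) →ₗ[ℂ] quadrics where
  toFun q := ⟨fun z => ∑ p : CoordPair, q p * (hcoord p.1.1 z * hcoord p.1.2 z), by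
    have h : (fun z => ∑ p : CoordPair, q p * (hcoord p.1.1 z * hcoord p.1.2 z)) =
        ∑ p : CoordPair, q p •
          ((hcoord p.1.1 : hyperplane → ℂ) * (hcoord p.1.2 : hyperplane → ℂ)) := by
      funext z
      rw [Finset.sum_apply]
      rfl
    rw [h, quadrics, homogeneousFunctions, pow_two]
    exact Submodule.sum_mem _ fun p _ => Submodule.smul_mem _ _ (Submodule.mul_mem_mul
      (linearMap_mem_linearForms (hcoord p.1.1).toLinearMap)
      (linearMap_mem_linearForms (hcoord p.1.2).toLinearMap))⟩
  map_add' a b := by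
    ext z
    change ∑ p : CoordPair, (a p + b p) * (hcoord p.1.1 z * hcoord p.1.2 z) =
      ∑ p : CoordPair, a p * (hcoord p.1.1 z * hcoord p.1.2 z) +
        ∑ p : CoordPair, b p * (hcoord p.1.1 z * hcoord p.1.2 z)
    simp only [add_mul, Finset.sum_add_distrib]
  map_smul' c a := by
    ext z
    change ∑ p : CoordPair, (c * a p) * (hcoord p.1.1 z * hcoord p.1.2 z) =
      c * ∑ p : CoordPair, a p * (hcoord p.1.1 z * hcoord p.1.2 z)
    simp only [mul_assoc, Finset.mul_sum]

lemma pairForm_apply (q : CoordPair → ℂ) (z : hyperplane) : (pairForm q : hyperplane → ℂ) z =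
    ∑ p : CoordPair, q p * (hcoord p.1.1 z * hcoord p.1.2 z) := rfl

/-- At `eᵢ - eⱼ` the only nonzero product of two distinct coordinates is `zᵢ zⱼ`, so the value there
is `-q` at that pair. -/
lemma pairForm_injective : Function.Injective pairForm := by
  rw [injective_iff_map_eq_zero]
  intro q hq
  funext ⟨⟨i, j⟩, hij⟩
  have h : (pairForm q : hyperplane → ℂ) (diffVec i j) = 0 := by
    rw [hq]
    rfl
  rw [pairForm_apply, Finset.sum_eq_single ⟨⟨i, j⟩, hij⟩] at h
  · rw [hcoord_diffVec, hcoord_diffVec, if_pos rfl, if_pos rfl, if_neg hij.ne, if_neg hij.ne'] at h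
    rw [Pi.zero_apply]
    linear_combination -h
  · rintro ⟨⟨k, l⟩, hkl⟩ - hne
    rw [hcoord_diffVec, hcoord_diffVec]
    dsimp only at hkl hij ⊢
    by_cases h1 : k = i
    · have h2 : l ≠ j := by
        rintro rfl
        exact hne (Subtype.ext (Prod.ext h1 rfl))
      have h3 : l ≠ i := (h1 ▸ hkl).ne'
      rw [if_neg h2, if_neg h3]
      ring
    · by_cases h2 : k = j
      · have h3 : l ≠ j := (h2 ▸ hkl).ne'
        have h4 : l ≠ i := (hij.trans (h2 ▸ hkl)).ne'
        rw [if_neg h3, if_neg h4]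
        ring
      · rw [if_neg h1, if_neg h2]
        ring
  · exact fun h => absurd (Finset.mem_univ _) h

lemma pairForm_surjective : Function.Surjective pairForm := by
  intro Q
  obtain ⟨b, hs, h0, hb⟩ := exists_matrix Q
  refine ⟨fun p => 2 * b p.1.1 p.1.2, Subtype.ext (funext fun z => ?_)⟩
  rw [pairForm_apply, hb]
  have h1 : ∀ f : Fin 6 × Fin 6 → ℂ, ∑ p : CoordPair, f p.1 =
      ∑ i, ∑ j, if i < j then f (i, j) else 0 := by
    intro f
    rw [← Finset.sum_subtype (Finset.univ.filter fun p : Fin 6 × Fin 6 => p.1 < p.2)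
      (fun p => by simp) f, Finset.sum_filter, Fintype.sum_prod_type]
  rw [h1 fun p => 2 * b p.1 p.2 * (hcoord p.1 z * hcoord p.2 z)]
  have h2 : ∑ i, ∑ j, (if j < i then b i j * (hcoord i z * hcoord j z) else 0) =
      ∑ i, ∑ j, if i < j then b i j * (hcoord i z * hcoord j z) else 0 := by
    rw [Finset.sum_comm]
    refine Finset.sum_congr rfl fun i _ => Finset.sum_congr rfl fun j _ => ?_
    rw [hs, mul_comm (hcoord j z)]
  have h3 : ∀ i j, b i j * (hcoord i z * hcoord j z) =
      (if i < j then b i j * (hcoord i z * hcoord j z) else 0) +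
        if j < i then b i j * (hcoord i z * hcoord j z) else 0 := by
    intro i j
    obtain h | rfl | h := lt_trichotomy i j
    · rw [if_pos h, if_neg h.not_gt, add_zero]
    · rw [h0]
      simp
    · rw [if_pos h, if_neg h.not_gt, zero_add]
  rw [Finset.sum_congr rfl fun i _ => Finset.sum_congr rfl fun j _ => h3 i j]
  simp only [Finset.sum_add_distrib, h2]
  rw [← two_mul]
  simp only [Finset.mul_sum]
  refine Finset.sum_congr rfl fun i _ => Finset.sum_congr rfl fun j _ => ?_
  split_ifs <;> ring

/-- The products of two distinct coordinates are a basis of the quadratic forms. -/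
def pairFormEquiv : (CoordPair → ℂ) ≃ₗ[ℂ] quadrics :=
  LinearEquiv.ofBijective pairForm ⟨pairForm_injective, pairForm_surjective⟩

instance : FiniteDimensional ℂ quadrics := Module.Finite.equiv pairFormEquiv

lemma finrank_quadrics : Module.finrank ℂ quadrics = 15 := by
  rw [← pairFormEquiv.finrank_eq, Module.finrank_fintype_fun_eq_card]
  decide

/-- Complete reducibility, in the form that the lattice of subrepresentations is complemented. -/
lemma exists_isCompl_segreQuadrics : ∃ J : Subrepresentation quadricRep,
    IsCompl segreQuadrics.toSubmodule J.toSubmodule := by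
  obtain ⟨J, hJ⟩ := exists_isCompl segreQuadrics
  refine ⟨J, isCompl_iff.mpr ⟨?_, ?_⟩⟩
  · rw [disjoint_iff, ← Subrepresentation.toSubmodule_inf, hJ.inf_eq_bot]
    rfl
  · rw [codisjoint_iff, ← Subrepresentation.toSubmodule_sup, hJ.sup_eq_top]
    rfl

lemma finrank_complement {J : Subrepresentation quadricRep}
    (hJ : IsCompl segreQuadrics.toSubmodule J.toSubmodule) :
    Module.finrank ℂ J.toSubmodule = 10 := by
  have h := Submodule.finrank_add_eq_of_isCompl hJ
  rw [finrank_quadrics, ← segreQuadricsEquiv.finrank_eq, finrank_hyperplane] at h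
  omega

end Dimensions


/-! ### Systems of fundamental invariants -/

open scoped Matrix

/-- A system of invariant forms that separates the values of all invariant forms and takes all
values: the invariant ring is the polynomial ring in these forms. -/
structure FundamentalInvariants {G : Type} [Group G] {V : Type} [AddCommGroup V] [Module ℂ V]
    (τ : Representation ℂ G V) {n : ℕ} (w : Fin n → ℕ) where
  E : Fin n → V → ℂ
  E_mem : ∀ j, E j ∈ invariantForms τ (w j)
  exists_eval_eq : ∀ {m : ℕ} {f : V → ℂ}, f ∈ invariantForms τ m →
    ∃ P : MvPolynomial (Fin n) ℂ, P.IsWeightedHomogeneous w m ∧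
      ∀ v, f v = MvPolynomial.eval (fun j => E j v) P
  surj : ∀ u : Fin n → ℂ, ∃ v, ∀ j, E j v = u j

section Transport

variable {G : Type} [Group G] {V V' : Type} [AddCommGroup V] [Module ℂ V] [AddCommGroup V']
  [Module ℂ V'] {τ : Representation ℂ G V} {τ' : Representation ℂ G V'}

lemma comp_mem_invariantForms (θ : V →ₗ[ℂ] V') (hθ : ∀ g v, θ (τ g v) = τ' g (θ v)) {n : ℕ}
    {f : V' → ℂ} (hf : f ∈ invariantForms τ' n) : (fun v => f (θ v)) ∈ invariantForms τ n :=
  ⟨comp_mem_linearForms_pow θ bot_le hf.1, fun g v => by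
    change f (θ (τ g v)) = f (θ v)
    rw [hθ]
    exact hf.2 g _⟩

/-- Transport of invariant forms along an isomorphism of representations. -/
def FundamentalInvariants.transport {n : ℕ} {w : Fin n → ℕ} (S : FundamentalInvariants τ w)
    (θ : V ≃ₗ[ℂ] V') (hθ : ∀ g v, θ (τ g v) = τ' g (θ v)) : FundamentalInvariants τ' w where
  E j v := S.E j (θ.symm v)
  E_mem j := comp_mem_invariantForms θ.symm.toLinearMap (fun g v => θ.injective (by
    change θ (θ.symm _) = θ (τ g (θ.symm v))
    rw [hθ, θ.apply_symm_apply, θ.apply_symm_apply])) (S.E_mem j)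
  exists_eval_eq {m f} hf := by
    obtain ⟨P, hP, h⟩ := S.exists_eval_eq (comp_mem_invariantForms θ.toLinearMap hθ hf)
    refine ⟨P, hP, fun v => ?_⟩
    rw [← h]
    exact congrArg f (θ.apply_symm_apply v).symm
  surj u := by
    obtain ⟨v, hv⟩ := S.surj u
    exact ⟨θ v, fun j => by rw [θ.symm_apply_apply, hv]⟩

end Transport

section WeightedComponent

/-- Weighted homogeneity of a polynomial can be achieved if it takes homogeneous values. -/
lemma exists_isWeightedHomogeneous {σ X : Type} {w : σ → ℕ} {m : ℕ} (P : MvPolynomial σ ℂ)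
    {E : σ → X → ℂ} {f : X → ℂ} (act : ℂ → X → X) (hE : ∀ j c x, E j (act c x) = c ^ w j * E j x)
    (hf : ∀ c x, f (act c x) = c ^ m * f x)
    (h : ∀ x, f x = MvPolynomial.eval (fun j => E j x) P) :
    ∃ Q : MvPolynomial σ ℂ, Q.IsWeightedHomogeneous w m ∧
      ∀ x, f x = MvPolynomial.eval (fun j => E j x) Q := by
  refine ⟨MvPolynomial.weightedHomogeneousComponent w m P,
    MvPolynomial.weightedHomogeneousComponent_isWeightedHomogeneous m P, fun x => ?_⟩
  -- The value of `P` after acting by `c` is a polynomial in `c` equal to `c ^ m * f x`. Its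
  -- coefficient of degree `m` is the value of the weighted component.
  let F : ℂ[X] := ∑ d ∈ P.support, monomial (Finsupp.weight w d)
    (MvPolynomial.coeff d P * ∏ i ∈ d.support, E i x ^ d i)
  have hF : F = monomial m (f x) := by
    refine Polynomial.funext fun c => ?_
    rw [eval_monomial, mul_comm, ← hf, h, MvPolynomial.eval_eq, eval_finsetSum]
    refine Finset.sum_congr rfl fun d _ => ?_
    rw [eval_monomial]
    simp only [hE, mul_pow, Finset.prod_mul_distrib, ← pow_mul]
    rw [Finset.prod_pow_eq_pow_sum, Finsupp.weight_apply, Finsupp.sum]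
    simp only [smul_eq_mul, mul_comm (w _)]
    ring
  have h1 := congrArg (fun p => p.coeff m) hF
  simp only [F, finsetSum_coeff, coeff_monomial, if_true] at h1
  rw [← h1, MvPolynomial.weightedHomogeneousComponent_apply, map_sum, Finset.sum_filter]
  refine Finset.sum_congr rfl fun d _ => ?_
  split_ifs
  · rw [MvPolynomial.eval_monomial]
    rfl
  · rfl

end WeightedComponent

/-! ### Symmetric functions on the hyperplane -/

section SymmetricFunctions

/-- The elementary symmetric functions on the hyperplane. -/
def esym (k : ℕ) (z : hyperplane) : ℂ :=
  MvPolynomial.eval (fun i => hcoord i z) (MvPolynomial.esymm (Fin 6) ℂ k)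

lemma esym_apply (k : ℕ) (z : hyperplane) :
    esym k z = ∑ s ∈ Finset.powersetCard k Finset.univ, ∏ i ∈ s, hcoord i z := by
  simp [esym, MvPolynomial.esymm]

lemma esym_one (z : hyperplane) : esym 1 z = 0 := by
  rw [esym, MvPolynomial.esymm_one, map_sum]
  simp only [MvPolynomial.eval_X]
  exact sum_hcoord z

lemma esym_mem (k : ℕ) : esym k ∈ invariantForms stdRep k := by
  constructor
  · have h : esym k = ∑ s ∈ Finset.powersetCard k Finset.univ,
        ∏ i ∈ s, (hcoord i : hyperplane → ℂ) := by
      funext z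
      simp only [esym_apply, Finset.sum_apply, Finset.prod_apply]
    rw [h]
    refine Submodule.sum_mem _ fun s hs => ?_
    rw [homogeneousFunctions, ← (Finset.mem_powersetCard.mp hs).2]
    exact prod_mem_pow_card _ _ fun i _ => linearMap_mem_linearForms (hcoord i).toLinearMap
  · intro σ z
    have h : MvPolynomial.eval (fun i => hcoord i z) (MvPolynomial.rename (σ⁻¹ : Equiv.Perm (Fin 6))
        (MvPolynomial.esymm (Fin 6) ℂ k)) = esym k (stdRep σ z) := by
      rw [MvPolynomial.eval_rename]
      rfl
    rw [← h, MvPolynomial.rename_esymm]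
    rfl

/-- The projection to the hyperplane along the invariant vectors. -/
def meanProj (z : Fin 6 → ℂ) : hyperplane := ⟨fun i => z i - (∑ k, z k) / 6, by
  change ∑ i, (z i - (∑ k, z k) / 6) = 0
  simp [Finset.sum_sub_distrib]
  ring⟩

lemma meanProj_hcoord (z : hyperplane) : meanProj (fun i => hcoord i z) = z := by
  refine Subtype.ext (funext fun i => ?_)
  change hcoord i z - (∑ k, hcoord k z) / 6 = hcoord i z
  rw [sum_hcoord, zero_div, sub_zero]

lemma meanProj_comp (σ : Equiv.Perm (Fin 6)) (z : Fin 6 → ℂ) :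
    meanProj (z ∘ σ) = stdRep σ⁻¹ (meanProj z) := by
  refine Subtype.ext (funext fun i => ?_)
  change z (σ i) - (∑ k, z (σ k)) / 6 = z (σ⁻¹⁻¹ i) - (∑ k, z k) / 6
  rw [inv_inv, Equiv.sum_comp σ z]

/-- Composition with the equivariant projection `meanProj` extends forms to `ℂ⁶`, where the
fundamental theorem on symmetric polynomials applies. -/
lemma exists_polynomial {n : ℕ} {f : hyperplane → ℂ} (hf : f ∈ homogeneousFunctions hyperplane n) :
    ∃ P : MvPolynomial (Fin 6) ℂ, ∀ z : Fin 6 → ℂ, f (meanProj z) = MvPolynomial.eval z P := by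
  induction n generalizing f with
  | zero =>
    rw [homogeneousFunctions, pow_zero] at hf
    obtain ⟨a, rfl⟩ := Submodule.mem_one.mp hf
    exact ⟨MvPolynomial.C a, fun z => (MvPolynomial.eval_C a).symm⟩
  | succ n ih =>
    rw [homogeneousFunctions, pow_succ] at hf
    induction hf using Submodule.mul_induction_on' with
    | mem_mul_mem x hx y hy =>
      obtain ⟨P, hP⟩ := ih hx
      obtain ⟨a, ha⟩ := exists_eq_sum_hcoord hy
      refine ⟨P * ∑ i, MvPolynomial.C (a i) * (MvPolynomial.X i -
        (∑ k, MvPolynomial.X k) * MvPolynomial.C (1 / 6)), fun z => ?_⟩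
      rw [Pi.mul_apply, hP, ha, map_mul, map_sum]
      congr 1
      refine Finset.sum_congr rfl fun i _ => ?_
      simp only [map_mul, map_sub, map_sum, MvPolynomial.eval_X, MvPolynomial.eval_C]
      change a i * (z i - (∑ k, z k) / 6) = _
      ring
    | add x _ y _ hx hy =>
      obtain ⟨P, hP⟩ := hx
      obtain ⟨Q, hQ⟩ := hy
      exact ⟨P + Q, fun z => by rw [Pi.add_apply, hP, hQ, map_add]⟩

lemma eval_aeval {σ κ : Type} (y : κ → ℂ) (q : σ → MvPolynomial κ ℂ) (P : MvPolynomial σ ℂ) :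
    MvPolynomial.eval y (MvPolynomial.aeval q P) =
      MvPolynomial.eval (fun i => MvPolynomial.eval y (q i)) P := by
  induction P using MvPolynomial.induction_on with
  | C c => simp
  | add P R hP hR => rw [map_add, map_add, hP, hR, map_add]
  | mul_X P i hP =>
    rw [map_mul, map_mul, hP, MvPolynomial.aeval_X, map_mul, MvPolynomial.eval_X]

lemma exists_eval_esym_eq {n : ℕ} {f : hyperplane → ℂ} (hf : f ∈ invariantForms stdRep n) :
    ∃ P : MvPolynomial (Fin 5) ℂ,
      ∀ z, f z = MvPolynomial.eval (fun j : Fin 5 => esym (j + 2) z) P := by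
  obtain ⟨B, hB⟩ := exists_polynomial hf.1
  have hsymm : B.IsSymmetric := by
    intro σ
    refine MvPolynomial.funext fun z => ?_
    rw [MvPolynomial.eval_rename, ← hB, ← hB, meanProj_comp]
    exact hf.2 _ _
  obtain ⟨Q, hQ⟩ := MvPolynomial.esymmAlgHom_surjective (σ := Fin 6) (n := 6) ℂ
    (Fintype.card_fin 6).le ⟨B, hsymm⟩
  have hQ' : MvPolynomial.aeval (fun i : Fin 6 => MvPolynomial.esymm (Fin 6) ℂ (i + 1)) Q = B := by
    rw [← MvPolynomial.esymmAlgHom_apply, hQ]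
  -- The first elementary symmetric function vanishes on the hyperplane, so its variable is set to
  -- zero.
  refine ⟨MvPolynomial.aeval (Fin.cons 0 fun j => MvPolynomial.X j) Q, fun z => ?_⟩
  rw [← meanProj_hcoord z, hB, meanProj_hcoord, ← hQ']
  rw [eval_aeval, eval_aeval]
  congr 2
  funext i
  refine Fin.cases ?_ (fun j => ?_) i
  · rw [Fin.cons_zero, map_zero]
    exact esym_one z
  · rw [Fin.cons_succ, MvPolynomial.eval_X]
    rfl

lemma exists_map_univ_eq {X : Type} {n : ℕ} (s : Multiset X) (hs : s.card = n) :
    ∃ x : Fin n → X, Finset.univ.val.map x = s := by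
  subst hs
  refine Quot.inductionOn s fun l => ⟨l.get, ?_⟩
  exact (Fin.univ_val_map _).trans (congrArg _ (List.ofFn_get l))

/-- Take the negatives of the roots of the monic sextic with the prescribed coefficients. It has no
term of degree five, so these numbers sum to zero. -/
lemma exists_esym_eq (u : Fin 5 → ℂ) : ∃ z, ∀ j : Fin 5, esym (j + 2) z = u j := by
  let p : ℂ[X] := X ^ 6 + ∑ j : Fin 5, C (u j) * X ^ (4 - (j : ℕ))
  have hdeg : (∑ j : Fin 5, C (u j) * X ^ (4 - (j : ℕ))).degree < ((6 : ℕ) : WithBot ℕ) := by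
    refine (degree_sum_le _ _).trans_lt ((Finset.sup_lt_iff (WithBot.bot_lt_coe 6)).mpr
      fun j _ => (degree_C_mul_X_pow_le _ _).trans_lt ?_)
    exact_mod_cast (by omega : 4 - (j : ℕ) < 6)
  have hp : p.Monic := monic_X_pow_add hdeg
  have hp6 : p.natDegree = 6 := natDegree_eq_of_degree_eq_some
    ((degree_add_eq_left_of_degree_lt (by rwa [degree_X_pow])).trans (degree_X_pow 6))
  have hcoeff : ∀ k, k ≤ 5 → p.coeff k = ∑ j : Fin 5, if k = 4 - (j : ℕ) then u j else 0 := by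
    intro k hk
    simp only [p, coeff_add, coeff_X_pow, finsetSum_coeff, coeff_C_mul]
    rw [if_neg (by omega), zero_add]
    simp
  have hcard : p.roots.card = 6 := by
    rw [← hp6]
    exact (IsAlgClosed.splits p).natDegree_eq_card_roots.symm
  obtain ⟨x, hx⟩ := exists_map_univ_eq p.roots hcard
  have hprod : p = ((Finset.univ.val.map fun i => -x i).map fun r => X + C r).prod := by
    rw [(IsAlgClosed.splits p).eq_prod_roots_of_monic hp, ← hx, Multiset.map_map, Multiset.map_map]
    congr 2
    funext i
    simp [sub_eq_add_neg]
  have hvieta : ∀ k, k ≤ 6 → MvPolynomial.eval (fun i => -x i) (MvPolynomial.esymm (Fin 6) ℂ k) =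
      p.coeff (6 - k) := by
    intro k hk
    rw [hprod, Multiset.prod_X_add_C_coeff _ (by simp)]
    rw [← MvPolynomial.coe_aeval_eq_eval]
    change MvPolynomial.aeval _ _ = _
    rw [MvPolynomial.aeval_esymm_eq_multiset_esymm]
    congr 1
    simp
    omega
  have hsum : ∑ i, -x i = 0 := by
    have h := hvieta 1 (by norm_num)
    rw [MvPolynomial.esymm_one, map_sum] at h
    simp only [MvPolynomial.eval_X] at h
    rw [h, hcoeff _ (by norm_num)]
    refine Finset.sum_eq_zero fun j _ => if_neg ?_
    omega
  refine ⟨⟨fun i => -x i, hsum⟩, fun j => ?_⟩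
  refine (hvieta (j + 2) (by omega)).trans ?_
  rw [hcoeff _ (by omega), Finset.sum_eq_single j]
  · exact if_pos (by omega)
  · intro i _ hi
    refine if_neg fun h => hi (Fin.ext ?_)
    omega
  · exact fun h => absurd (Finset.mem_univ _) h

lemma weights_eq (j : Fin 5) : (![2, 3, 4, 5, 6] : Fin 5 → ℕ) j = j + 2 := by
  fin_cases j <;> rfl

/-- The elementary symmetric functions are fundamental invariants of the standard
representation. -/
def stdInvariants : FundamentalInvariants stdRep ![2, 3, 4, 5, 6] where
  E j := esym (j + 2)
  E_mem j := by
    rw [weights_eq]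
    exact esym_mem _
  exists_eval_eq {m f} hf := by
    obtain ⟨P, hP⟩ := exists_eval_esym_eq hf
    refine exists_isWeightedHomogeneous P (fun c z => c • z) (fun j c z => ?_)
      (fun c z => homogeneousFunctions_smul hf.1 c z) hP
    rw [weights_eq]
    exact homogeneousFunctions_smul (esym_mem _).1 c z
  surj := exists_esym_eq

/-- The fundamental invariants of the quadrics through the singular points of the Segre cubic. -/
def segreInvariants : FundamentalInvariants (V := segreQuadrics.toSubmodule)
    segreQuadrics.toRepresentation ![2, 3, 4, 5, 6] :=
  stdInvariants.transport segreQuadricsEquiv segreQuadricsEquiv_equivariant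

end SymmetricFunctions


open scoped Matrix

/-! ### Isomorphisms of `Proj` over `Spec ℂ` -/

section ProjIso

variable {R R' : Type} [CommRing R] [Algebra ℂ R] [CommRing R'] [Algebra ℂ R']
  {𝒜 : ℕ → Submodule ℂ R} [GradedAlgebra 𝒜] {ℬ : ℕ → Submodule ℂ R'} [GradedAlgebra ℬ]

lemma irrelevant_le_map_of_rightInverse (f : 𝒜 →+*ᵍ ℬ) (g : ℬ →+*ᵍ 𝒜) (h : ∀ x, f (g x) = x) :
    HomogeneousIdeal.irrelevant ℬ ≤ (HomogeneousIdeal.irrelevant 𝒜).map f := by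
  refine (HomogeneousIdeal.irrelevant_le _).mpr fun n hn x hx => ?_
  have h1 : f (g x) ∈ Ideal.map f (HomogeneousIdeal.irrelevant 𝒜).toIdeal :=
    Ideal.mem_map_of_mem _ (HomogeneousIdeal.mem_irrelevant_of_mem _ hn (g.map_mem hx))
  rw [h] at h1
  exact h1

lemma map_projStr (f : 𝒜 →+*ᵍ ℬ)
    (hf : HomogeneousIdeal.irrelevant ℬ ≤ (HomogeneousIdeal.irrelevant 𝒜).map f)
    (hc : ∀ c, f (algebraMap ℂ R c) = algebraMap ℂ R' c) :
    Proj.map f hf ≫ projStr 𝒜 = projStr ℬ := by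
  have key : ∀ {i : ℕ} (hi : 0 < i) (s : R) (hs : s ∈ 𝒜 i),
      Proj.awayι ℬ (f s) (f.2 hs) hi ≫ Proj.map f hf ≫ projStr 𝒜 =
        Proj.awayι ℬ (f s) (f.2 hs) hi ≫ projStr ℬ := by
    intro i hi s hs
    rw [Proj.awayι_comp_map_assoc f hf hi s hs, awayι_projStr, awayι_projStr, ← Spec.map_comp,
      ← CommRingCat.ofHom_comp]
    congr 2
    refine RingHom.ext fun c => ?_
    rw [RingHom.comp_apply, constHom_eq_mk _ hs, constHom_eq_mk _ (f := f s) (f.2 hs)]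
    refine (HomogeneousLocalization.Away.map_mk _ _ _ _ _ _).trans ?_
    congr 1
    exact hc c
  exact (Proj.mapAffineOpenCover f hf).openCover.hom_ext _ _ fun s => key s.1.2 s.2.1 s.2.2

lemma exists_projIso (f : 𝒜 →+*ᵍ ℬ) (g : ℬ →+*ᵍ 𝒜) (hgf : ∀ x, g (f x) = x)
    (hfg : ∀ x, f (g x) = x) (hc : ∀ c, f (algebraMap ℂ R c) = algebraMap ℂ R' c) :
    ∃ e : Proj ℬ ≅ Proj 𝒜, e.hom ≫ projStr 𝒜 = projStr ℬ := by
  have hf := irrelevant_le_map_of_rightInverse f g hfg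
  have hg := irrelevant_le_map_of_rightInverse g f hgf
  refine ⟨⟨Proj.map f hf, Proj.map g hg, ?_, ?_⟩, map_projStr f hf hc⟩
  · rw [← Proj.map_comp, ← Proj.map_id]
    congr 1
    exact GradedRingHom.ext hfg
  · rw [← Proj.map_comp, ← Proj.map_id]
    congr 1
    exact GradedRingHom.ext hgf

end ProjIso

/-! ### Quotients that are weighted projective spaces -/

section WeightedProjectiveSpace

attribute [local instance] MvPolynomial.weightedGradedAlgebra

variable {G : Type} [Group G] {V : Type} [AddCommGroup V] [Module ℂ V]
  {τ : Representation ℂ G V} {n : ℕ} {w : Fin n → ℕ} (S : FundamentalInvariants τ w)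

namespace FundamentalInvariants

/-- The polynomials in the fundamental invariants, as invariant forms. -/
def ringHom : MvPolynomial (Fin n) ℂ →ₐ[ℂ] sectionRing (invariantForms τ) :=
  MvPolynomial.aeval fun j => homElem _ (S.E j) (S.E_mem j)

lemma evalSection_ringHom (P : MvPolynomial (Fin n) ℂ) (v : V) :
    evalSection _ (S.ringHom P) v = MvPolynomial.eval (fun j => S.E j v) P := by
  induction P using MvPolynomial.induction_on with
  | C c =>
    rw [MvPolynomial.eval_C, ringHom, MvPolynomial.aeval_C]
    simp [evalSection]
  | add p q hp hq => rw [map_add, map_add, map_add, Pi.add_apply, hp, hq]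
  | mul_X p i hp =>
    rw [map_mul, map_mul, map_mul, Pi.mul_apply, hp, ringHom, MvPolynomial.aeval_X,
      evalSection_homElem, MvPolynomial.eval_X]

lemma ringHom_mem {m : ℕ} {P : MvPolynomial (Fin n) ℂ}
    (hP : P ∈ MvPolynomial.weightedHomogeneousSubmodule ℂ w m) :
    S.ringHom P ∈ sectionGrading (invariantForms τ) m :=
  aeval_mem_graded _ (fun j => homElem_mem _ _ (S.E_mem j)) hP

/-- The fundamental invariants take all values, so a polynomial relation between them vanishes on
all of `ℂⁿ`. -/
lemma ringHom_injective : Function.Injective S.ringHom := by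
  rw [injective_iff_map_eq_zero]
  intro P hP
  refine MvPolynomial.funext fun u => ?_
  obtain ⟨v, hv⟩ := S.surj u
  have h := S.evalSection_ringHom P v
  rw [hP, map_zero, funext hv] at h
  rw [← h, map_zero]
  rfl

lemma exists_ringHom_eq {m : ℕ} {x : sectionRing (invariantForms τ)}
    (hx : x ∈ sectionGrading (invariantForms τ) m) :
    ∃ P ∈ MvPolynomial.weightedHomogeneousSubmodule ℂ w m, S.ringHom P = x := by
  obtain ⟨P, hP, h⟩ := S.exists_eval_eq (x.2 m)
  refine ⟨P, hP, ?_⟩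
  rw [← homElem_coeff _ hx, ← homElem_coeff _ (S.ringHom_mem hP)]
  refine homElem_congr _ rfl (funext fun v => ?_) _ _
  rw [h, ← S.evalSection_ringHom]
  nth_rewrite 2 [← homElem_coeff _ (S.ringHom_mem hP)]
  rw [evalSection_homElem]

lemma ringHom_surjective : Function.Surjective S.ringHom := by
  classical
  intro x
  rw [← DirectSum.sum_support_decompose (sectionGrading (invariantForms τ)) x]
  choose P hP using fun m => S.exists_ringHom_eq
    (DirectSum.decompose (sectionGrading (invariantForms τ)) x m).2
  refine ⟨∑ m ∈ (DirectSum.decompose (sectionGrading (invariantForms τ)) x).support, P m, ?_⟩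
  rw [map_sum]
  exact Finset.sum_congr rfl fun m _ => (hP m).2

/-- The invariant ring is the polynomial ring in the fundamental invariants. -/
def ringEquiv : MvPolynomial (Fin n) ℂ ≃+* sectionRing (invariantForms τ) :=
  RingEquiv.ofBijective S.ringHom ⟨S.ringHom_injective, S.ringHom_surjective⟩

lemma exists_iso (S : FundamentalInvariants τ w) : ∃ e : gitQuotient τ ≅ weightedProj w,
    e.hom ≫ weightedProjStr w = gitQuotientStr τ := by
  let f : MvPolynomial.weightedHomogeneousSubmodule ℂ w →+*ᵍ
      sectionGrading (invariantForms τ) :=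
    { S.ringEquiv.toRingHom with map_mem := fun hP => S.ringHom_mem hP }
  let g : sectionGrading (invariantForms τ) →+*ᵍ
      MvPolynomial.weightedHomogeneousSubmodule ℂ w :=
    { S.ringEquiv.symm.toRingHom with
      map_mem := fun {m x} hx => by
        obtain ⟨P, hP, rfl⟩ := S.exists_ringHom_eq hx
        have h : S.ringEquiv.symm (S.ringHom P) = P := S.ringEquiv.symm_apply_apply P
        change S.ringEquiv.symm (S.ringHom P) ∈ _
        rwa [h] }
  exact exists_projIso f g (fun x => S.ringEquiv.symm_apply_apply x)
    (fun x => S.ringEquiv.apply_symm_apply x) fun c => S.ringHom.commutes c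

end FundamentalInvariants

end WeightedProjectiveSpace

lemma exists_iso_weightedProj : ∃ e : subQuotient segreQuadrics ≅ weightedProj ![2, 3, 4, 5, 6],
    e.hom ≫ weightedProjStr ![2, 3, 4, 5, 6] = subQuotientStr segreQuadrics :=
  segreInvariants.exists_iso


open scoped Matrix

/-! ### Integrality of the invariant ring -/

section Integrality

variable {V : Type} [AddCommGroup V] [Module ℂ V]

lemma exists_eval_line {n : ℕ} {f : V → ℂ} (hf : f ∈ homogeneousFunctions V n) (v u : V) :
    ∃ p : ℂ[X], ∀ t, f (v + t • u) = p.eval t := by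
  rw [homogeneousFunctions] at hf
  induction hf using Submodule.pow_induction_on_left' with
  | algebraMap c => exact ⟨C c, fun t => by rw [eval_C]; rfl⟩
  | add f g i _ _ h₁ h₂ =>
    obtain ⟨p, hp⟩ := h₁
    obtain ⟨q, hq⟩ := h₂
    exact ⟨p + q, fun t => by rw [eval_add, ← hp, ← hq]; rfl⟩
  | mem_mul l hl i f _ h =>
    obtain ⟨p, hp⟩ := h
    obtain ⟨l, -, rfl⟩ := hl
    refine ⟨(C (l v) + C (l u) * X) * p, fun t => ?_⟩
    rw [eval_mul, ← hp]
    simp [LinearMap.ltoFun]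
    left
    ring

/-- Restrict to the line joining a point where `f` is nonzero to one where `g` is nonzero: both
become nonzero polynomials in one variable. -/
lemma eq_zero_or_eq_zero_of_mul_eq_zero {m n : ℕ} {f g : V → ℂ} (hf : f ∈ homogeneousFunctions V m)
    (hg : g ∈ homogeneousFunctions V n) (h : f * g = 0) : f = 0 ∨ g = 0 := by
  by_contra! h'
  obtain ⟨v, hv⟩ := Function.ne_iff.mp h'.1
  obtain ⟨u, hu⟩ := Function.ne_iff.mp h'.2
  obtain ⟨p, hp⟩ := exists_eval_line hf v (u - v)
  obtain ⟨q, hq⟩ := exists_eval_line hg v (u - v)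
  have h1 : p * q = 0 := Polynomial.funext fun t => by
    rw [eval_mul, ← hp, ← hq, eval_zero]
    exact congrFun h _
  rcases mul_eq_zero.mp h1 with h2 | h2
  · exact hv (by simpa [h2] using hp 0)
  · exact hu (by simpa [h2] using hq 1)

instance isDomain_sectionRing {G : Type} [Group G] (ρ : Representation ℂ G V) :
    IsDomain (sectionRing (invariantForms ρ)) := by
  have : NoZeroDivisors (sectionRing (invariantForms ρ)) := by
    refine ⟨fun {p q} h => ?_⟩
    have h1 := congrArg (fun x : sectionRing (invariantForms ρ) =>
      (x : (V → ℂ)[X]).coeff ((p : (V → ℂ)[X]).natDegree + (q : (V → ℂ)[X]).natDegree)) h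
    simp only [MulMemClass.coe_mul, coeff_mul_degree_add_degree, ZeroMemClass.coe_zero,
      coeff_zero] at h1
    rcases eq_zero_or_eq_zero_of_mul_eq_zero (p.2 _).1 (q.2 _).1 h1 with h2 | h2
    · exact Or.inl (Subtype.ext (leadingCoeff_eq_zero.mp h2))
    · exact Or.inr (Subtype.ext (leadingCoeff_eq_zero.mp h2))
  exact NoZeroDivisors.to_isDomain _

/-- The zero ideal is a point of `Proj`, it lies in the basic open set of any nonzero `f`, and its
closure is everything. -/
lemma isDominant_awayι {R : Type} [CommRing R] [IsDomain R] [Algebra ℂ R] (𝒜 : ℕ → Submodule ℂ R)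
    [GradedAlgebra 𝒜] {f : R} {m : ℕ} (hf : f ∈ 𝒜 m) (hm : 0 < m) (h0 : f ≠ 0) :
    IsDominant (Proj.awayι 𝒜 f hf hm) := by
  let η : ProjectiveSpectrum 𝒜 := ⟨⊥, Ideal.isPrime_bot, fun h =>
    h0 ((Submodule.mem_bot R).mp (h (HomogeneousIdeal.mem_irrelevant_of_mem _ hm hf)))⟩
  have h1 : η ∈ Set.range (Proj.awayι 𝒜 f hf hm) := by
    have h2 : (η : Proj 𝒜) ∈ (Proj.awayι 𝒜 f hf hm).opensRange := by
      rw [Proj.opensRange_awayι]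
      exact fun h => h0 ((Submodule.mem_bot R).mp h)
    exact h2
  refine ⟨fun x => ?_⟩
  refine closure_mono (Set.singleton_subset_iff.mpr h1) ?_
  exact (ProjectiveSpectrum.le_iff_mem_closure 𝒜 η x).mp
    ((ProjectiveSpectrum.as_ideal_le_as_ideal 𝒜 η x).mp bot_le)

end Integrality

/-! ### Birational charts in affine space -/

section AffineSpace

lemma isDominant_of_isOpenImmersion {X Y : Scheme} [Nonempty X] [IrreducibleSpace Y] (f : X ⟶ Y)
    [IsOpenImmersion f] : IsDominant f :=
  ⟨f.isOpenEmbedding.isOpen_range.dense (Set.range_nonempty f)⟩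

lemma birationalOver_affineSpace_of_equiv {κ κ' : Type} (e : κ ≃ κ') (S : Scheme.{0}) :
    Scheme.BirationalOver (𝔸(κ; S) ↘ S) (𝔸(κ'; S) ↘ S) := by
  have : IsIso (AffineSpace.reindex e.symm S) := ⟨AffineSpace.reindex e S,
    (AffineSpace.reindex_comp (↾e) (↾e.symm) S).symm.trans (by
      rw [← AffineSpace.reindex_id]
      congr 1
      exact funext e.symm_apply_apply),
    (AffineSpace.reindex_comp (↾e.symm) (↾e) S).symm.trans (by
      rw [← AffineSpace.reindex_id]
      congr 1
      exact funext e.apply_symm_apply)⟩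
  exact Scheme.Hom.birationalOver (AffineSpace.reindex e.symm S) _ _ (AffineSpace.reindex_over _ _)

variable {G : Type} [Group G] {V : Type} [AddCommGroup V] [Module ℂ V] {ρ : Representation ℂ G V}
  {κ : Type} {d : ℕ} {F : V → ℂ}

/-- The hypotheses identify the ring of `{F ≠ 0}` with the polynomial ring localized at `g`: `hg`
inverts `g`, `hsurj` excludes relations between the `z j`, and `hgen` writes every element with a
power of `g` as denominator. -/
lemma birationalOver_affineSpace (hF : F ∈ invariantForms ρ d) (hd : 0 < d) (h0 : F ≠ 0)
    (z : κ → FracRing (invariantForms ρ) F hF) (g : MvPolynomial κ ℂ)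
    (hg : ∃ y, ∀ w, evalFrac hF y w * MvPolynomial.eval (fun j => evalFrac hF (z j) w) g = 1)
    (hsurj : ∀ u, MvPolynomial.eval u g ≠ 0 → ∃ w, ∀ j, evalFrac hF (z j) w = u j)
    (hgen : ∀ y, ∃ (N : ℕ) (P : MvPolynomial κ ℂ), ∀ w,
      evalFrac hF y w * MvPolynomial.eval (fun j => evalFrac hF (z j) w) g ^ N =
        MvPolynomial.eval (fun j => evalFrac hF (z j) w) P) :
    Scheme.BirationalOver (gitQuotientStr ρ) (𝔸(κ; Spec (.of ℂ)) ↘ Spec (.of ℂ)) := by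
  let c : ℂ →+* FracRing (invariantForms ρ) F hF := constHom _ _
  let Ψ : MvPolynomial κ ℂ →+* FracRing (invariantForms ρ) F hF := MvPolynomial.eval₂Hom c z
  have hΨ : ∀ P w, evalFrac hF (Ψ P) w = MvPolynomial.eval (fun j => evalFrac hF (z j) w) P := by
    intro P w
    induction P using MvPolynomial.induction_on with
    | C a => rw [MvPolynomial.eval_C, MvPolynomial.coe_eval₂Hom, MvPolynomial.eval₂_C,
        evalFrac_constHom]
    | add p q hp hq => rw [map_add, map_add, map_add, Pi.add_apply, hp, hq]
    | mul_X p i hp => rw [map_mul, map_mul, map_mul, Pi.mul_apply, hp, MvPolynomial.coe_eval₂Hom,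
        MvPolynomial.eval₂_X, MvPolynomial.eval_X]
  obtain ⟨w₀, hw₀⟩ := Function.ne_iff.mp h0
  let ι : Spec (.of (FracRing (invariantForms ρ) F hF)) ⟶ gitQuotient ρ :=
    Proj.awayι (sectionGrading (invariantForms ρ)) _ (homElem_mem _ F hF) hd
  have hopen : IsOpenImmersion ι :=
    inferInstanceAs (IsOpenImmersion (Proj.awayι (sectionGrading (invariantForms ρ)) _ _ _))
  have hdom : IsDominant ι := by
    refine isDominant_awayι _ _ hd fun h => hw₀ ?_
    have h1 := congrArg (fun x => evalSection (invariantForms ρ) x w₀) h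
    simpa only [evalSection_homElem, map_zero] using h1
  have h1 := Scheme.Hom.birationalOver ι (gitQuotientStr ρ) _
    (awayι_projStr (sectionGrading (invariantForms ρ)) (homElem_mem _ F hF) hd)
  refine h1.symm.trans ?_
  let _ : Algebra (MvPolynomial κ ℂ) (FracRing (invariantForms ρ) F hF) := Ψ.toAlgebra
  have hloc : IsLocalization.Away g (FracRing (invariantForms ρ) F hF) := by
    obtain ⟨y, hy⟩ := hg
    have h2 : y * Ψ g = 1 := evalFrac_ext hF fun w => by
      rw [map_mul, map_one, Pi.mul_apply, hΨ, hy, Pi.one_apply]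
    have h3 : Ψ g * y = 1 := evalFrac_ext hF fun w => by
      rw [map_mul, map_one, Pi.mul_apply, hΨ, mul_comm, hy, Pi.one_apply]
    have hu : IsUnit (Ψ g) := ⟨⟨Ψ g, y, h3, h2⟩, rfl⟩
    refine ⟨?_, fun y => ?_, fun {p q} h => ⟨⟨g, 1, pow_one g⟩, ?_⟩⟩
    · rintro ⟨_, n, rfl⟩
      exact (map_pow Ψ g n) ▸ hu.pow n
    · obtain ⟨N, P, hP⟩ := hgen y
      refine ⟨⟨P, ⟨g ^ N, N, rfl⟩⟩, evalFrac_ext hF fun w => ?_⟩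
      change evalFrac hF (y * Ψ (g ^ N)) w = evalFrac hF (Ψ P) w
      rw [map_mul, Pi.mul_apply, hΨ, hΨ, map_pow, hP]
    · refine MvPolynomial.funext fun u => ?_
      change MvPolynomial.eval u (g * p) = MvPolynomial.eval u (g * q)
      rw [map_mul, map_mul]
      by_cases hu : MvPolynomial.eval u g = 0
      · rw [hu, zero_mul, zero_mul]
      · obtain ⟨w, hw⟩ := hsurj u hu
        have h2 : Ψ p = Ψ q := h
        rw [← funext hw, ← hΨ p, ← hΨ q, h2]
  have : IsOpenImmersion (Spec.map (CommRingCat.ofHom Ψ)) := IsOpenImmersion.of_isLocalization g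
  have : Nontrivial (FracRing (invariantForms ρ) F hF) :=
    ⟨0, 1, fun h => zero_ne_one (α := ℂ) (by
      simpa using congrArg (fun x => evalFrac hF x ⟨w₀, hw₀⟩) h)⟩
  have : IsDominant (Spec.map (CommRingCat.ofHom Ψ)) := isDominant_of_isOpenImmersion _
  refine Scheme.Hom.birationalOver (Spec.map (CommRingCat.ofHom Ψ) ≫
    (AffineSpace.SpecIso κ (.of ℂ)).inv) _ _ ?_
  rw [Category.assoc, AffineSpace.SpecIso_inv_over, ← Spec.map_comp, ← CommRingCat.ofHom_comp]
  congr 2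
  exact RingHom.ext fun a => MvPolynomial.eval₂_C _ _ _

end AffineSpace


open scoped Matrix

/-! ### Rationality of the quotient of `ℙ(W)` -/

section Rationality

variable {G : Type} [Group G] {W : Type} [AddCommGroup W] [Module ℂ W] {ρ : Representation ℂ G W}
  {I J : Subrepresentation ρ} {hIJ : IsCompl I.toSubmodule J.toSubmodule} {r : ℕ}

lemma pullbackFn_mem_invariantForms {n : ℕ} {a : I.toSubmodule → ℂ}
    (ha : a ∈ invariantForms I.toRepresentation n) :
    pullbackFn I J hIJ a ∈ invariantForms ρ n :=
  ⟨pow_le_pow_left' (linearForms_mono bot_le) n (pullbackFn_mem_pow I J hIJ ha.1),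
    pullbackFn_invariant I J hIJ ha.2⟩

lemma pullbackFn_pow_mem_invariantForms {n : ℕ} {a : I.toSubmodule → ℂ}
    (ha : a ∈ invariantForms I.toRepresentation n) (k : ℕ) :
    pullbackFn I J hIJ a ^ k ∈ invariantForms ρ (k * n) :=
  SetLike.pow_mem_graded k (pullbackFn_mem_invariantForms ha)

namespace Frame

variable (F : Frame I J hIJ r)

/-- The invariant form on `W` given by the form `f` on `I`. -/
lemma pullbackFn_f_mem : pullbackFn I J hIJ F.f ∈ invariantForms ρ F.d :=
  pullbackFn_mem_invariantForms F.f_mem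

lemma exists_evalFrac_eq_div {m : ℕ} {a : W → ℂ} (ha : a ∈ invariantForms ρ m) :
    ∃ z, ∀ w : F.Dom, evalFrac F.pullbackFn_f_mem z w = a w.1 / F.t w ^ m := by
  have h := SetLike.mul_mem_graded ha (SetLike.mul_mem_graded
    (pullbackFn_pow_mem_invariantForms (hIJ := hIJ) F.f₂_mem (2 * m))
    (pullbackFn_pow_mem_invariantForms (hIJ := hIJ) F.D_mem m))
  rw [show m + (2 * m * F.e + m * F.q) = m • F.d by simp only [d, smul_eq_mul]; ring] at h
  refine ⟨frac F.pullbackFn_f_mem m _ h, fun w => ?_⟩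
  refine (evalFrac_frac F.pullbackFn_f_mem m _ h w).trans ?_
  change a w.1 * (F.f₂ (F.proj w) ^ (2 * m) * F.D (F.proj w) ^ m) / F.f (F.proj w) ^ m =
    a w.1 / (F.f₁ (F.proj w) / F.f₂ (F.proj w)) ^ m
  have h1 := F.f₁_ne_zero w
  have h2 := F.f₂_ne_zero w
  have h3 := F.D_ne_zero w
  rw [F.f_proj, div_pow, mul_pow, mul_pow]
  field_simp
  ring

/-- This is the inverse of `f / t ^ d`, the polynomial in the coordinates at which one localizes; it
equals `f₁ ^ (2 d) D ^ d / f ^ (d + 1)`. -/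
lemma exists_evalFrac_eq_t_pow_div :
    ∃ z, ∀ w : F.Dom, evalFrac F.pullbackFn_f_mem z w = F.t w ^ F.d / F.f (F.proj w) := by
  have h := SetLike.mul_mem_graded
    (pullbackFn_pow_mem_invariantForms (hIJ := hIJ) F.f₁_mem (2 * F.d))
    (pullbackFn_pow_mem_invariantForms (hIJ := hIJ) F.D_mem F.d)
  rw [show 2 * F.d * (F.e + 1) + F.d * F.q = (F.d + 1) • F.d by
    simp only [smul_eq_mul, d]; ring] at h
  refine ⟨frac F.pullbackFn_f_mem (F.d + 1) _ h, fun w => ?_⟩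
  refine (evalFrac_frac F.pullbackFn_f_mem (F.d + 1) _ h w).trans ?_
  change F.f₁ (F.proj w) ^ (2 * F.d) * F.D (F.proj w) ^ F.d / F.f (F.proj w) ^ (F.d + 1) =
    (F.f₁ (F.proj w) / F.f₂ (F.proj w)) ^ F.d / F.f (F.proj w)
  have h1 := F.f₁_ne_zero w
  have h2 := F.f₂_ne_zero w
  have h3 := F.D_ne_zero w
  rw [F.f_proj, pow_succ, div_pow, mul_pow, mul_pow]
  field_simp
  ring

lemma φ_mem_invariantForms (i : Fin r) : F.φ i ∈ invariantForms ρ (F.δ + 1) := by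
  refine ⟨?_, F.φ_inv i⟩
  have h := mul_le_mul' (pow_le_pow_left' (linearForms_le (J := J)) F.δ) le_rfl (F.φ_mem i)
  rw [homogeneousFunctions, ← pow_add] at h
  exact h

variable (S : FundamentalInvariants (V := I.toSubmodule) I.toRepresentation ![2, 3, 4, 5, 6])

/-- The numerators of the coordinates on the quotient. -/
def coordForm : Fin 4 ⊕ Fin r → W → ℂ :=
  Sum.elim (fun i => pullbackFn I J hIJ (S.E (![0, 2, 3, 4] i))) F.φ

/-- The degrees of the numerators of the coordinates on the quotient. -/
def coordDeg : Fin 4 ⊕ Fin r → ℕ := Sum.elim ![2, 4, 5, 6] fun _ => F.δ + 1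

lemma coordForm_mem (k : Fin 4 ⊕ Fin r) : F.coordForm S k ∈ invariantForms ρ (F.coordDeg k) := by
  rcases k with i | i
  · have h := pullbackFn_mem_invariantForms (hIJ := hIJ) (S.E_mem (![0, 2, 3, 4] i))
    fin_cases i <;> exact h
  · exact F.φ_mem_invariantForms i

/-- Coordinates of degree zero on the quotient. -/
def coord (w : F.Dom) (k : Fin 4 ⊕ Fin r) : ℂ := F.coordForm S k w.1 / F.t w ^ F.coordDeg k

/-- The coordinate which is a fundamental invariant divided by a power of `t`. -/
def coordIndex : Fin 5 → Fin 4 ⊕ Fin r := fun j => Sum.inl (![0, 0, 1, 2, 3] j)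

/-- From `E₁ = t E₀` follows `E₁ / t³ = E₀ / t²`. This is why `coordIndex` takes its first value
twice, and why the five invariants give four coordinates. -/
lemma E_proj (h₁ : F.f₁ = S.E 1) (h₂ : F.f₂ = S.E 0) (w : F.Dom) (j : Fin 5) :
    S.E j (F.proj w) = F.t w ^ (![2, 3, 4, 5, 6] : Fin 5 → ℕ) j * F.coord S w (coordIndex j) := by
  have key : ∀ (m : ℕ) (c : ℂ), c = F.t w ^ m * (c / F.t w ^ m) := fun m c =>
    (mul_div_cancel₀ c (pow_ne_zero m (F.t_ne_zero w))).symm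
  have ht : S.E 1 (F.proj w) = F.t w * S.E 0 (F.proj w) := by
    rw [← h₁, ← h₂]
    exact (div_mul_cancel₀ _ (F.f₂_ne_zero w)).symm
  fin_cases j
  · exact key 2 _
  · refine ht.trans ((congrArg (F.t w * ·) (key 2 _)).trans ?_)
    change F.t w * (F.t w ^ 2 * _) = F.t w ^ 3 * _
    rw [← mul_assoc, ← pow_succ']
    rfl
  · exact key 4 _
  · exact key 5 _
  · exact key 6 _

lemma eval_rename_coordIndex (h₁ : F.f₁ = S.E 1) (h₂ : F.f₂ = S.E 0) {m : ℕ}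
    {P : MvPolynomial (Fin 5) ℂ} (hP : P.IsWeightedHomogeneous ![2, 3, 4, 5, 6] m) (w : F.Dom) :
    F.t w ^ m * MvPolynomial.eval (F.coord S w) (MvPolynomial.rename coordIndex P) =
      MvPolynomial.eval (fun j => S.E j (F.proj w)) P := by
  rw [MvPolynomial.eval_rename, ← eval_mul_of_isWeightedHomogeneous hP]
  exact congrArg (fun x => MvPolynomial.eval x P) (funext fun j => (F.E_proj S h₁ h₂ w j).symm)

/-- By `invFracForms_eq`, `b` is a sum of products `u v`. With `u = a / f ^ k` and `f = t ^ d Q`,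
the product `u Q ^ k` is a polynomial in the coordinates. A form `v` of degree `n` in the `Yⱼ` is `t
^ n` times such a polynomial, because `Y = t · (1, φᵢ / t ^ (δ + 1))`. -/
lemma exists_eval_coord_eq [Fintype G] (h₁ : F.f₁ = S.E 1) (h₂ : F.f₂ = S.E 0)
    {Q : MvPolynomial (Fin 4 ⊕ Fin r) ℂ}
    (hQ : ∀ w, F.t w ^ F.d * MvPolynomial.eval (F.coord S w) Q = F.f (F.proj w))
    {n : ℕ} {b : F.Dom → ℂ} (hb : b ∈ F.invFracForms n) :
    ∃ (N : ℕ) (P : MvPolynomial (Fin 4 ⊕ Fin r) ℂ), ∀ w,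
      b w * MvPolynomial.eval (F.coord S w) Q ^ N =
        F.t w ^ n * MvPolynomial.eval (F.coord S w) P := by
  rw [F.invFracForms_eq] at hb
  induction hb using Submodule.mul_induction_on' with
  | mem_mul_mem u hu v hv =>
    obtain ⟨z, hz⟩ := F.exists_evalFrac_eq hu
    obtain ⟨k, a, ha, rfl⟩ := exists_frac F.f_mem z
    obtain ⟨A, hA, ha'⟩ := S.exists_eval_eq ha
    obtain ⟨B, hB, hv'⟩ := F.exists_isHomogeneous_eq hv
    refine ⟨k, MvPolynomial.rename coordIndex A *
      MvPolynomial.aeval (Fin.cons 1 fun i => MvPolynomial.X (Sum.inr i)) B, fun w => ?_⟩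
    have e1 : u w * MvPolynomial.eval (F.coord S w) Q ^ k =
        MvPolynomial.eval (F.coord S w) (MvPolynomial.rename coordIndex A) := by
      have e := F.eval_rename_coordIndex S h₁ h₂ hA w
      have h0 := F.f_ne_zero w
      have ht := F.t_ne_zero w
      rw [← ha', smul_eq_mul, mul_comm k, pow_mul] at e
      rw [← hz, evalFrac_frac]
      change a (F.proj w) / F.f (F.proj w) ^ k * _ = _
      rw [← e, div_mul_eq_mul_div, div_eq_iff (pow_ne_zero _ h0), ← hQ, mul_pow]
      ring
    have e2 : v w = F.t w ^ n * MvPolynomial.eval (F.coord S w)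
        (MvPolynomial.aeval (Fin.cons 1 fun i => MvPolynomial.X (Sum.inr i)) B) := by
      rw [← hv', eval_aeval, ← eval_mul_of_isHomogeneous (by simpa using hB)]
      refine congrArg (fun x => MvPolynomial.eval x B) (funext (Fin.cases ?_ fun i => ?_))
      · simp [Y]
      · rw [Fin.cons_succ, MvPolynomial.eval_X]
        change F.φ i w.1 * (F.t w)⁻¹ ^ F.δ = F.t w * (F.φ i w.1 / F.t w ^ (F.δ + 1))
        have ht := F.t_ne_zero w
        rw [pow_succ, inv_pow]
        field_simp
    rw [Pi.mul_apply, mul_right_comm, e1, e2, map_mul]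
    ring
  | add x _ y _ hx hy =>
    obtain ⟨N, P, h⟩ := hx
    obtain ⟨N', P', h'⟩ := hy
    refine ⟨N + N', P * Q ^ N' + P' * Q ^ N, fun w => ?_⟩
    simp only [Pi.add_apply, map_add, map_mul, map_pow]
    linear_combination (MvPolynomial.eval (F.coord S w) Q) ^ N' * h w +
      (MvPolynomial.eval (F.coord S w) Q) ^ N * h' w

lemma birationalOver_affineSpace [Fintype G] (h₁ : F.f₁ = S.E 1) (h₂ : F.f₂ = S.E 0) :
    Scheme.BirationalOver (gitQuotientStr ρ)
      (𝔸(Fin 4 ⊕ Fin r; Spec (.of ℂ)) ↘ Spec (.of ℂ)) := by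
  obtain ⟨P, hP, hf⟩ := S.exists_eval_eq F.f_mem
  let Q : MvPolynomial (Fin 4 ⊕ Fin r) ℂ := MvPolynomial.rename coordIndex P
  have hQ : ∀ w, F.t w ^ F.d * MvPolynomial.eval (F.coord S w) Q = F.f (F.proj w) := fun w =>
    (F.eval_rename_coordIndex S h₁ h₂ hP w).trans (hf _).symm
  choose z hz using fun k => F.exists_evalFrac_eq_div (F.coordForm_mem S k)
  have hz' : ∀ w : F.Dom, (fun k => evalFrac F.pullbackFn_f_mem (z k) w) = F.coord S w :=
    fun w => funext fun k => hz k w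
  refine IgusaPencils.birationalOver_affineSpace F.pullbackFn_f_mem F.d_pos ?_ z Q ?_ ?_ ?_
  · obtain ⟨v, hv⟩ := F.exists_ne_zero
    refine Function.ne_iff.mpr ⟨v, ?_⟩
    change F.f (I.toSubmodule.projectionOnto J.toSubmodule hIJ v) ≠ 0
    rwa [Submodule.projectionOnto_apply_left]
  · obtain ⟨y, hy⟩ := F.exists_evalFrac_eq_t_pow_div
    refine ⟨y, fun (w : F.Dom) => ?_⟩
    have h := hy w
    have h0 := F.f_ne_zero w
    rw [hz', h, div_mul_eq_mul_div, hQ, div_self h0]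
  · intro u hu
    -- This choice makes `E₁(v) = E₀(v)`, so `t = 1` and the coordinates are the numerators
    -- themselves.
    obtain ⟨v, hv⟩ := S.surj fun j => u (coordIndex j)
    have hfv : F.f v ≠ 0 := by
      rw [hf, funext hv]
      rwa [MvPolynomial.eval_rename] at hu
    obtain ⟨w, hw, hw'⟩ := F.surj v (right_ne_zero_of_mul hfv) fun i => u (Sum.inr i)
    let w' : F.Dom := ⟨w, by rwa [hw]⟩
    have ht : F.t w' = 1 := by
      change F.f₁ (I.toSubmodule.projectionOnto J.toSubmodule hIJ w) /
        F.f₂ (I.toSubmodule.projectionOnto J.toSubmodule hIJ w) = 1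
      have h0 : S.E 0 v ≠ 0 := by
        rw [← h₂]
        exact right_ne_zero_of_mul (left_ne_zero_of_mul hfv)
      rw [hw, h₁, h₂, div_eq_one_iff_eq h0, hv, hv]
      rfl
    refine ⟨w', fun k => (hz k w').trans ?_⟩
    rw [ht, one_pow, div_one]
    rcases k with i | i
    · change S.E (![0, 2, 3, 4] i) (I.toSubmodule.projectionOnto J.toSubmodule hIJ w) = _
      rw [hw, hv]
      fin_cases i <;> rfl
    · exact hw' i
  · intro y
    obtain ⟨k, a, ha, rfl⟩ := exists_frac F.pullbackFn_f_mem y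
    obtain ⟨N, P', hP'⟩ := F.exists_eval_coord_eq S h₁ h₂ hQ (F.res_mem_invFracForms ha)
    refine ⟨N + k, P', fun (w : F.Dom) => ?_⟩
    have e := hP' w
    have h0 := F.f_ne_zero w
    rw [hz']
    refine (congrArg (· * _) (evalFrac_frac F.pullbackFn_f_mem k a ha w)).trans ?_
    change a w.1 / F.f (F.proj w) ^ k * _ = _
    rw [← mul_right_inj' (pow_ne_zero (k • F.d) (F.t_ne_zero w)), ← e, res_apply,
      div_mul_eq_mul_div, mul_div_assoc', div_eq_iff (pow_ne_zero _ h0), ← hQ, smul_eq_mul,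
      mul_comm k, pow_mul]
    ring

end Frame

end Rationality


open scoped Matrix

/-! ### A point whose line has trivial stabilizer -/

section GenericPoint

/-- The coordinates of a point of the hyperplane whose line has trivial stabilizer. -/
def genericCoords : Fin 6 → ℤ := ![0, 1, 2, 3, 4, -10]

/-- A point of the hyperplane whose line has trivial stabilizer. -/
def genericPoint : hyperplane := ⟨fun i => genericCoords i, by
  change ∑ i, (genericCoords i : ℂ) = 0
  exact_mod_cast (by decide : ∑ i, genericCoords i = 0)⟩

lemma esym_genericPoint (k : ℕ) : esym k genericPoint =
    (∑ s ∈ Finset.powersetCard k Finset.univ, ∏ i ∈ s, genericCoords i : ℤ) := by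
  rw [esym_apply]
  push_cast
  rfl

lemma esym_two_genericPoint_ne_zero : esym 2 genericPoint ≠ 0 := by
  rw [esym_genericPoint]
  exact_mod_cast (by decide +kernel : ∑ s ∈ Finset.powersetCard 2 Finset.univ,
    ∏ i ∈ s, genericCoords i ≠ 0)

lemma esym_three_genericPoint_ne_zero : esym 3 genericPoint ≠ 0 := by
  rw [esym_genericPoint]
  exact_mod_cast (by decide +kernel :
    ∑ s ∈ Finset.powersetCard 3 Finset.univ, ∏ i ∈ s, genericCoords i ≠ 0)

lemma genericPoint_ne_zero : genericPoint ≠ 0 := fun h => by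
  have h1 := congrArg (hcoord 1) h
  rw [map_zero] at h1
  exact one_ne_zero ((by norm_num [genericCoords] : (1 : ℂ) = genericCoords 1).trans h1)

/-- The power sums of degrees 2 and 3 are invariant and nonzero at the point, so `a² = a³ = 1` and
`a = 1`. The coordinates are distinct, hence `σ = 1`. -/
lemma eq_one_of_stdRep_genericPoint {σ : Equiv.Perm (Fin 6)} {a : ℂ}
    (h : stdRep σ genericPoint = a • genericPoint) : σ = 1 := by
  have h1 : ∀ i, (genericCoords (σ⁻¹ i) : ℂ) = a * genericCoords i := fun i =>
    congrFun (congrArg (fun z : hyperplane => (z : Fin 6 → ℂ)) h) i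
  have key : ∀ n : ℕ, (∑ i, genericCoords i ^ n : ℤ) ≠ 0 → a ^ n = 1 := by
    intro n hn
    have h2 : (∑ i, (genericCoords i : ℂ) ^ n) = a ^ n * ∑ i, (genericCoords i : ℂ) ^ n := by
      rw [Finset.mul_sum, ← Equiv.sum_comp σ⁻¹]
      exact Finset.sum_congr rfl fun i _ => by rw [h1, mul_pow]
    have h3 : (∑ i, (genericCoords i : ℂ) ^ n) ≠ 0 := by exact_mod_cast hn
    exact (mul_eq_right₀ h3).mp h2.symm
  have ha : a = 1 := by
    have h2 := key 2 (by decide)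
    have h3 := key 3 (by decide)
    rwa [pow_succ, h2, one_mul] at h3
  refine inv_eq_one.mp (Equiv.ext fun i => ?_)
  have hinj : Function.Injective genericCoords := by decide
  have h2 := h1 i
  rw [ha, one_mul] at h2
  exact hinj (by exact_mod_cast h2)

end GenericPoint

lemma nonempty_basis_of_finrank_eq {V : Type} [AddCommGroup V] [Module ℂ V] {n : ℕ} (hn : 0 < n)
    (h : Module.finrank ℂ V = n) : Nonempty (Module.Basis (Fin n) ℂ V) := by
  have := Module.finite_of_finrank_pos (hn.trans_eq h.symm)
  exact ⟨Module.finBasisOfFinrankEq ℂ V h⟩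

/-- A frame for the projection of quadrics. -/
lemma exists_segreFrame {J : Subrepresentation quadricRep}
    (hJ : IsCompl segreQuadrics.toSubmodule J.toSubmodule) :
    ∃ F : Frame segreQuadrics J hJ 10, F.f₁ = segreInvariants.E 1 ∧ F.f₂ = segreInvariants.E 0 := by
  obtain ⟨b⟩ := nonempty_basis_of_finrank_eq (V := J.toSubmodule) (by norm_num)
    (finrank_complement hJ)
  -- The consecutive degrees are 3 and 2, those of the first two fundamental invariants.
  obtain ⟨F, -, h₁, h₂⟩ := exists_frame segreQuadrics J hJ (by norm_num) b (e := 2)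
    (segreInvariants.E_mem 1) (segreInvariants.E_mem 0)
    (v₀ := segreQuadricsEquiv genericPoint)
    ((map_ne_zero_iff _ segreQuadricsEquiv.injective).mpr genericPoint_ne_zero)
    (fun σ hσ a h => hσ (eq_one_of_stdRep_genericPoint (a := a) (segreQuadricsEquiv.injective (by
      rw [segreQuadricsEquiv_equivariant, map_smul, h]))))
    (mul_ne_zero (by
      change esym 3 (segreQuadricsEquiv.symm (segreQuadricsEquiv genericPoint)) ≠ 0
      rw [LinearEquiv.symm_apply_apply]
      exact esym_three_genericPoint_ne_zero) (by
      change esym 2 (segreQuadricsEquiv.symm (segreQuadricsEquiv genericPoint)) ≠ 0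
      rw [LinearEquiv.symm_apply_apply]
      exact esym_two_genericPoint_ne_zero))
  exact ⟨F, h₁, h₂⟩

lemma birationalOver_moduliIgusaPencils : Scheme.BirationalOver moduliIgusaPencilsStr
    (𝔸(Fin 14; Spec (.of ℂ)) ↘ Spec (.of ℂ)) := by
  obtain ⟨J, hJ⟩ := exists_isCompl_segreQuadrics
  obtain ⟨F, h₁, h₂⟩ := exists_segreFrame hJ
  exact (F.birationalOver_affineSpace segreInvariants h₁ h₂).trans
    (birationalOver_affineSpace_of_equiv finSumFinEquiv _)

end IgusaPencils

end

theorem mainTheorem6 :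
    -- The moduli space is rational, of dimension 14
    Scheme.BirationalOver IgusaPencils.moduliIgusaPencilsStr
      (𝔸(Fin 14; Spec (.of ℂ)) ↘ Spec (.of ℂ)) ∧
    -- The Segre cubic has ten singular points, and they are nodes
    IgusaPencils.segreSing.ncard = 10 ∧
    (∀ x ∈ IgusaPencils.segreSing, ∀ w : IgusaPencils.hyperplane,
      (∀ u : IgusaPencils.hyperplane,
        fderiv ℂ (fderiv ℂ IgusaPencils.segreCubic) x.rep w u = 0) →
      w ∈ Submodule.span ℂ {x.rep}) ∧
    -- The quadrics through them form a subrepresentation `I` isomorphic to the standard one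
    ∃ I : Subrepresentation IgusaPencils.quadricRep,
      (∀ Q : IgusaPencils.quadrics, Q ∈ I.toSubmodule ↔
        ∀ x ∈ IgusaPencils.segreSing, (Q : IgusaPencils.hyperplane → ℂ) x.rep = 0) ∧
      Nonempty (I.toRepresentation.Equiv IgusaPencils.stdRep) ∧
      -- The projective quotient of `I` is `ℙ(2,3,4,5,6)`
      (∃ e : IgusaPencils.subQuotient I ≅
          IgusaPencils.weightedProj ![2, 3, 4, 5, 6],
        e.hom ≫ IgusaPencils.weightedProjStr ![2, 3, 4, 5, 6] =
          IgusaPencils.subQuotientStr I) ∧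
      -- There is an invariant complement `J`, and for each such `J` the projection from `ℙ(J)`
      -- induces a morphism on quotients that is a projective bundle over a non-empty open set
      (∃ J : Subrepresentation IgusaPencils.quadricRep,
        IsCompl I.toSubmodule J.toSubmodule) ∧
      ∀ (J : Subrepresentation IgusaPencils.quadricRep)
        (hIJ : IsCompl I.toSubmodule J.toSubmodule),
        ∃ p : IgusaPencils.blowupQuotient J ⟶ IgusaPencils.subQuotient I,
          IgusaPencils.IsInducedByProjection I J hIJ p ∧
          ∃ U : (IgusaPencils.subQuotient I).Opens,
            (U : Set (IgusaPencils.subQuotient I)).Nonempty ∧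
            IgusaPencils.IsProjectiveBundle 10
              (U.ι ≫ IgusaPencils.subQuotientStr I) (p ∣_ U) := by
  refine ⟨IgusaPencils.birationalOver_moduliIgusaPencils, IgusaPencils.ncard_segreSing,
    fun x hx w h => IgusaPencils.mem_span_of_hessian x.rep_nonzero
      (IgusaPencils.mem_segreSing_iff.mp hx) h,
    IgusaPencils.segreQuadrics, IgusaPencils.mem_segreQuadrics_iff,
    IgusaPencils.nonempty_equiv_stdRep, IgusaPencils.exists_iso_weightedProj,
    IgusaPencils.exists_isCompl_segreQuadrics, fun J hIJ => ?_⟩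
  obtain ⟨F, -, -⟩ := IgusaPencils.exists_segreFrame hIJ
  exact ⟨IgusaPencils.projectionMap _ J hIJ,
    IgusaPencils.isInducedByProjection_projectionMap _ J hIJ,
    F.baseι.opensRange, F.nonempty_opensRange_baseι, F.isProjectiveBundle⟩
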